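/- \textbf{Setting.} Let $\mathcal H_n=(\mathbb C^2)^{\otimes n}$ with its standard inner product. A code on $n$ qubits is a subspace $C\subseteq\mathcal H_n$. It has distance at least $d$ if for every $E=A_1\otimes\cdots\otimes A_n$ with $A_i\in M_2(\mathbb C)$ and $A_i\neq \mathbf 1$ for fewer than $d$ indices $i$, there is $c_E\in\mathbb C$ with $\langle u,Ev\rangle=c_E\langle u,v\rangle$ for all $u,v\in C$. It is an $((n,K,d))$ code if $\dim C=K$ and its distance is at least $d$ but not at least $d+1$. A code with $K=2$ is nontrivial if it has distance at least $2$. The binary icosahedral group is the subgroup $2\mathrm I=\langle \mathsf X,\mathsf Z,\mathsf F,\mathsf\Phi\rangle$ of $\mathrm{SU}(2)$ of order $120$, where $$\mathsf X=\begin{pmatrix}0&-i\\-i&0\end{pmatrix},\quad \mathsf Z=\begin{pmatrix}-i&0\\0&i\end{pmatrix},\quad \mathsf F=\frac{e^{-i\pi/4}}{\sqrt2}\begin{pmatrix}1&-i\\1&i\end{pmatrix},\quad \mathsf\Phi=\frac12\begin{pmatrix}\varphi+i\varphi^{-1}&1\\-1&\varphi-i\varphi^{-1}\end{pmatrix},\quad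 \varphi=\frac{1+\sqrt5}2 .$$ Let $H\subseteq \mathrm U(2)$ be a subgroup. We say that $2\mathrm I$ is strongly transversal on a two-dimensional code $C\subseteq\mathcal H_n$ with physical gates from $H$ if there is an isometry $V:\mathbb C^2\to\mathcal H_n$ with image $C$ such that for every $g\in 2\mathrm I$ there is $h\in H$ with $h^{\otimes n}V=Vg$. If $H=\mathrm U(2)$ we simply say that $2\mathrm I$ is strongly transversal on $C$. For $0\le w\le n$ let $|D^n_w\rangle=\binom nw^{-1/2}\sum_{|x|=w}|x\rangle$, the sum over bit strings $x\in\{0,1\}^n$ of Hamming weight $w$, and let $C_0\subseteq\mathcal H_7$ be the span of $$|\overline 0\rangle=\tfrac{\sqrt{15}}8|D^7_0\rangle+\tfrac{\sqrt7}8|D^7_2\rangle+\tfrac{\sqrt{21}}8|D^7_4\rangle-\tfrac{\sqrt{21}}8|D^7_6\rangle,\qquad |\overline 1\rangle=-\tfrac{\sqrt{21}}8|D^7_1\rangle+\tfrac{\sqrt{21}}8|D^7_3\rangle+\tfrac{\sqrt7}8|D^7_5\rangle+\tfrac{\sqrt{15}}8|D^7_7\rangle .$$ \textbf{Theorem.}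 The smallest nontrivial code with $2\mathrm I$ strongly transversal is $C_0$, and it is the unique such code on $7$ qubits. Precisely: \begin{enumerate} \item $C_0$ is a $((7,2,3))$ code on which $2\mathrm I$ is strongly transversal, and the physical gates may even be taken from $2\mathrm I$. \item If $C\subseteq\mathcal H_n$ is a two-dimensional code of distance at least $2$ on which $2\mathrm I$ is strongly transversal, then $n\ge 7$. \item If $C\subseteq\mathcal H_7$ is a two-dimensional code of distance at least $2$ on which $2\mathrm I$ is strongly transversal, then $C=u^{\otimes 7}C_0$ for some $u\in\mathrm U(2)$. If moreover the physical gates can be taken from $2\mathrm I$, then $C=C_0$. \end{enumerate} -/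

import Mathlib

noncomputable section

namespace QubitCode

open Complex Matrix

/-- The group `U(2)` of single-qubit gates. -/
abbrev U2 : Type := Matrix.unitaryGroup (Fin 2) ℂ

/-- The Pauli gate `-i X`, with determinant one. -/
def gateX : U2 :=
  ⟨!![0, -I; -I, 0], by
    rw [Matrix.mem_unitaryGroup_iff]
    ext i j
    fin_cases i <;> fin_cases j <;> simp [Matrix.mul_apply, Matrix.star_apply, Fin.sum_univ_two]⟩

/-- The Pauli gate `-i Z`, with determinant one. -/
def gateZ : U2 :=
  ⟨!![-I, 0; 0, I], by
    rw [Matrix.mem_unitaryGroup_iff]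
    ext i j
    fin_cases i <;> fin_cases j <;> simp [Matrix.mul_apply, Matrix.star_apply, Fin.sum_univ_two]⟩

/-- The facet gate with determinant one; the prefactor `(1 - i) / 2` is `e^{-i π / 4} / √2`. -/
def gateF : U2 :=
  ⟨((1 - I) / 2) • !![1, -I; 1, I], by
    have h2 : (starRingEnd ℂ) 2 = 2 := map_ofNat _ 2
    rw [Matrix.mem_unitaryGroup_iff]
    ext i j
    fin_cases i <;> fin_cases j <;>
      simp [Matrix.mul_apply, Matrix.star_apply, Fin.sum_univ_two, h2] <;>
      ring_nf <;> simp [I_sq] <;> norm_num⟩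

/-- The icosahedral gate `Φ = (1/2) (φ + i φ⁻¹, 1; -1, φ - i φ⁻¹)`, `φ` the golden ratio. -/
def gatePhi : U2 :=
  ⟨(1 / 2 : ℂ) • !![(Real.goldenRatio : ℂ) + I * (Real.goldenRatio : ℂ)⁻¹, 1;
      -1, (Real.goldenRatio : ℂ) - I * (Real.goldenRatio : ℂ)⁻¹], by
    have hinv : ((Real.goldenRatio : ℂ))⁻¹ = (Real.goldenRatio : ℂ) - 1 := by
      have h := Real.inv_goldenRatio
      have h2 := Real.goldenRatio_add_goldenConj
      have h3 : (Real.goldenRatio)⁻¹ = Real.goldenRatio - 1 := by linarith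
      exact_mod_cast congrArg (fun r : ℝ => (r : ℂ)) h3
    have hsq : (Real.goldenRatio : ℂ) ^ 2 = (Real.goldenRatio : ℂ) + 1 := by
      exact_mod_cast congrArg (fun r : ℝ => (r : ℂ)) Real.goldenRatio_sq
    have h2 : (starRingEnd ℂ) 2 = 2 := map_ofNat _ 2
    rw [Matrix.mem_unitaryGroup_iff, hinv]
    generalize hg : Real.goldenRatio = g at *
    ext i j
    fin_cases i <;> fin_cases j <;>
      simp [Matrix.mul_apply, Matrix.star_apply, Fin.sum_univ_two, h2] <;>
      ring_nf <;> simp [I_sq] <;> (try rw [hsq]) <;> ring_nf⟩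

/-- The binary icosahedral group `2I = ⟨X, Z, F, Φ⟩` inside `SU(2) ⊆ U(2)`. -/
def binaryIcosahedral : Subgroup U2 :=
  Subgroup.closure {gateX, gateZ, gateF, gatePhi}

/-- The Hilbert space of `n` qubits, with the computational basis indexed by bit strings. -/
abbrev Qubits (n : ℕ) : Type := EuclideanSpace ℂ (Fin n → Fin 2)

/-- The operator `A 0 ⊗ ⋯ ⊗ A (n - 1)` on `n` qubits. -/
def tensorOp {n : ℕ} (A : Fin n → Matrix (Fin 2) (Fin 2) ℂ) : Qubits n →ₗ[ℂ] Qubits n :=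
  Matrix.toEuclideanLin (Matrix.of fun x y : Fin n → Fin 2 => ∏ i, A i (x i) (y i))

/-- The physical gate `h ^ {⊗ n}`. -/
def tensorPow (n : ℕ) (h : U2) : Qubits n →ₗ[ℂ] Qubits n :=
  tensorOp fun _ : Fin n => (h : Matrix (Fin 2) (Fin 2) ℂ)

/-- The Knill-Laflamme conditions for all errors acting on fewer than `d` qubits: the code
space `C` has distance at least `d`. -/
def DistanceAtLeast {n : ℕ} (C : Submodule ℂ (Qubits n)) (d : ℕ) : Prop :=
  ∀ A : Fin n → Matrix (Fin 2) (Fin 2) ℂ, {i | A i ≠ 1}.ncard < d →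
    ∃ c : ℂ, ∀ u ∈ C, ∀ v ∈ C, inner ℂ u (tensorOp A v) = c * inner ℂ u v

/-- `C` is an `((n, K, d))` code: its dimension is `K` and its distance is exactly `d`. -/
def IsCode {n : ℕ} (C : Submodule ℂ (Qubits n)) (K d : ℕ) : Prop :=
  Module.finrank ℂ C = K ∧ DistanceAtLeast C d ∧ ¬ DistanceAtLeast C (d + 1)

/-- For some encoding (an isometry of the logical qubit onto the code space `C`), every logical
gate `g ∈ G` is implemented on `C` by a physical gate `h ^ {⊗ n}` with `h ∈ H`. -/
def StronglyTransversalVia {n : ℕ} (H G : Subgroup U2) (C : Submodule ℂ (Qubits n)) : Prop :=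
  ∃ V : EuclideanSpace ℂ (Fin 2) →ₗᵢ[ℂ] Qubits n, LinearMap.range V.toLinearMap = C ∧
    ∀ g ∈ G, ∃ h ∈ H, ∀ v : EuclideanSpace ℂ (Fin 2),
      tensorPow n h (V v) = V (Matrix.toEuclideanLin (g : Matrix (Fin 2) (Fin 2) ℂ) v)

/-- The group `G` is strongly transversal on `C`: the physical gates are `h ^ {⊗ n}` with `h`
arbitrary in `U(2)`. -/
def StronglyTransversal {n : ℕ} (G : Subgroup U2) (C : Submodule ℂ (Qubits n)) : Prop :=
  StronglyTransversalVia ⊤ G C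

/-- The Hamming weight of a bit string. -/
def hammingWeight {n : ℕ} (x : Fin n → Fin 2) : ℕ := (Finset.univ.filter fun i => x i = 1).card

/-- The Dicke state: the normalized uniform superposition of the `n`-qubit computational basis
states of Hamming weight `w`. -/
def dicke (n w : ℕ) : Qubits n :=
  WithLp.toLp 2 fun x => if hammingWeight x = w then ((1 / √(n.choose w : ℝ) : ℝ) : ℂ) else 0

/-- The logical zero of the seven-qubit code. -/
def logicalZero : Qubits 7 :=
  ((√15 / 8 : ℝ) : ℂ) • dicke 7 0 + ((√7 / 8 : ℝ) : ℂ) • dicke 7 2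
    + ((√21 / 8 : ℝ) : ℂ) • dicke 7 4 - ((√21 / 8 : ℝ) : ℂ) • dicke 7 6

/-- The logical one of the seven-qubit code. -/
def logicalOne : Qubits 7 :=
  -((√21 / 8 : ℝ) : ℂ) • dicke 7 1 + ((√21 / 8 : ℝ) : ℂ) • dicke 7 3
    + ((√7 / 8 : ℝ) : ℂ) • dicke 7 5 + ((√15 / 8 : ℝ) : ℂ) • dicke 7 7

/-- The seven-qubit code. -/
def dickeCode : Submodule ℂ (Qubits 7) := Submodule.span ℂ {logicalZero, logicalOne}

end QubitCode

end

/-! Let V be an encoding of the logical qubit. The proof shows that, up to scalars, physical and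
logical gates determine each other, that the physical gates can then be only one of two icosahedral
groups, and that these two cases have opposite outcomes.

Rigidity. On at most eight qubits a physical gate is scalar exactly when its logical gate is
(`center_iff_of_gatePairs`). Contracting two qubits with the antisymmetric form is equivariant up to
a determinant, and a tensor killed by all contractions is symmetric. V can therefore be replaced by
a pair of binary forms of degree m ≤ 8. A gate that scales both forms alike preserves the fibres of
their quotient, a rational map of degree at most m, so there are few such gates up to scalars
(`exists_proportional`). Since they are also normalized by the gates implementing X, Z, F and Φ,
none but scalars remain (`kernel_le_center`). The projective relations of the logical gates now hold
for the physical ones, and a single change of frame brings those to X, Z, F and Φ_a, where a is the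
golden ratio φ or its Galois conjugate 1 - φ (`IcosahedralRelations.exists_frame`). Exact relations
remove the leftover scalars and force n to be odd (`equivariant_of_smul`).

Dichotomy. If a = φ, the symmetric powers of degree 3, 5 and 7 contain no copy of the logical
representation, so the code lies in the spin-1/2 part of the n qubits (`Equivariant.weightOp_eq`).
Then ∑ Z_i takes different values on the two basis states, which distance two forbids
(`not_distanceAtLeast_two`). If a = 1 - φ, the symmetric powers of degree 1, 3 and 5 contain no
copy, and degree 7 contains one up to scalars (`Equivariant.symm_seven`). Descent by contractions
extends this to all tensors: nothing exists for n < 7, and V is a multiple of `codeTensor` for n =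
7.

Existence. Equivariance of `codeTensor` is a polynomial identity. The Hadamard gate conjugates the
Galois conjugate group of logical gates back to 2I, and the Knill-Laflamme conditions reduce to sums
over Hamming weights.

Uniqueness on the nose. If the physical gates lie in 2I, finiteness of the projective image of 2I
makes every element of 2I physical, up to scalars. Then X, Z, F and Φ themselves are physical and
only the logical frame has to be changed, which leaves the span unchanged. -/

namespace QubitCode

open Complex Matrix

/-! ### Product operators, permutations and contractions of tensors. -/

/-- The amplitudes of an `n`-qubit state in the computational basis. -/
abbrev Tensor (n : ℕ) : Type := (Fin n → Fin 2) → ℂ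

/-- The operator `A 0 ⊗ ⋯ ⊗ A (n - 1)` on amplitudes. -/
noncomputable def act {n : ℕ} (A : Fin n → Matrix (Fin 2) (Fin 2) ℂ) : Tensor n →ₗ[ℂ] Tensor n :=
  Matrix.mulVecLin (Matrix.of fun x y : Fin n → Fin 2 => ∏ i, A i (x i) (y i))

theorem act_apply {n : ℕ} (A : Fin n → Matrix (Fin 2) (Fin 2) ℂ) (T : Tensor n)
    (x : Fin n → Fin 2) : act A T x = ∑ y, (∏ i, A i (x i) (y i)) * T y := rfl

theorem act_mul {n : ℕ} (A B : Fin n → Matrix (Fin 2) (Fin 2) ℂ) (T : Tensor n) :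
    act (fun i => A i * B i) T = act A (act B T) := by
  ext x
  simp only [act_apply, Finset.mul_sum, Matrix.mul_apply]
  rw [Finset.sum_comm]
  refine Finset.sum_congr rfl fun z _ => ?_
  have h := Finset.prod_univ_sum (fun _ : Fin n => (Finset.univ : Finset (Fin 2)))
    (fun i j => A i (x i) j * B i j (z i))
  rw [h, Fintype.piFinset_univ, Finset.sum_mul]
  exact Finset.sum_congr rfl fun y _ => by rw [Finset.prod_mul_distrib]; ring

theorem prod_one_apply {n : ℕ} (x y : Fin n → Fin 2) :
    (∏ i, (1 : Matrix (Fin 2) (Fin 2) ℂ) (x i) (y i)) = if x = y then 1 else 0 := by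
  split_ifs with h
  · subst h; simp
  · obtain ⟨i, hi⟩ := Function.ne_iff.mp h
    exact Finset.prod_eq_zero (Finset.mem_univ i) (Matrix.one_apply_ne hi)

theorem act_one {n : ℕ} (T : Tensor n) : act (fun _ => 1) T = T := by
  ext x
  simp [act_apply, prod_one_apply]

theorem tensorOp_apply {n : ℕ} (A : Fin n → Matrix (Fin 2) (Fin 2) ℂ) (v : Qubits n) :
    tensorOp A v = WithLp.toLp 2 (act A v.ofLp) := rfl

/-- The operator `h ^ {⊗ n}` on amplitudes. -/
noncomputable abbrev actPow {n : ℕ} (h : Matrix (Fin 2) (Fin 2) ℂ) : Tensor n →ₗ[ℂ] Tensor n :=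
  act fun _ => h

theorem actPow_mul {n : ℕ} (g h : Matrix (Fin 2) (Fin 2) ℂ) (T : Tensor n) :
    actPow (g * h) T = actPow g (actPow h T) := act_mul _ _ T

theorem actPow_smul {n : ℕ} (c : ℂ) (h : Matrix (Fin 2) (Fin 2) ℂ) (T : Tensor n) :
    actPow (c • h) T = c ^ n • actPow h T := by
  ext x
  simp [act_apply, Finset.prod_mul_distrib, Finset.mul_sum, mul_assoc]

/-- Permutation of the qubits. -/
def perm {n : ℕ} (σ : Equiv.Perm (Fin n)) : Tensor n →ₗ[ℂ] Tensor n :=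
  LinearMap.funLeft ℂ ℂ fun x => x ∘ σ

theorem perm_apply {n : ℕ} (σ : Equiv.Perm (Fin n)) (T : Tensor n) (x : Fin n → Fin 2) :
    perm σ T x = T (x ∘ σ) := rfl

theorem perm_mul {n : ℕ} (σ τ : Equiv.Perm (Fin n)) (T : Tensor n) :
    perm (σ * τ) T = perm σ (perm τ T) := rfl

theorem actPow_perm {n : ℕ} (h : Matrix (Fin 2) (Fin 2) ℂ) (σ : Equiv.Perm (Fin n))
    (T : Tensor n) : actPow h (perm σ T) = perm σ (actPow h T) := by
  ext x
  simp only [act_apply, perm_apply]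
  refine Fintype.sum_equiv (Equiv.arrowCongr σ.symm (Equiv.refl _)) _ _ fun y => ?_
  have : (Equiv.arrowCongr σ.symm (Equiv.refl (Fin 2))) y = y ∘ σ := rfl
  rw [this]
  congr 1
  exact (Equiv.prod_comp σ fun i => h (x i) (y i)).symm

/-- Invariance under all permutations of the qubits. -/
def IsSymm {n : ℕ} (T : Tensor n) : Prop := ∀ σ, perm σ T = T

/-- The sum of all permutations of a tensor. -/
def symm {n : ℕ} : Tensor n →ₗ[ℂ] Tensor n := ∑ σ, perm σ

theorem symm_apply {n : ℕ} (T : Tensor n) : symm T = ∑ σ, perm σ T := by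
  simp [symm]

theorem isSymm_symm {n : ℕ} (T : Tensor n) : IsSymm (symm T) := fun σ => by
  rw [symm_apply, map_sum]
  exact Fintype.sum_equiv (Equiv.mulLeft σ) _ _ fun τ => (perm_mul σ τ T).symm

theorem IsSymm.symm_eq {n : ℕ} {T : Tensor n} (hT : IsSymm T) :
    symm T = (n.factorial : ℂ) • T := by
  rw [symm_apply, Finset.sum_congr rfl fun σ _ => hT σ]
  simp [Fintype.card_perm, Nat.cast_smul_eq_nsmul]

theorem IsSymm.eq_zero {n : ℕ} {T : Tensor n} (hT : IsSymm T) (h : symm T = 0) : T = 0 := by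
  rw [hT.symm_eq] at h
  exact (smul_eq_zero.mp h).resolve_left (by exact_mod_cast n.factorial_ne_zero)

theorem actPow_symm {n : ℕ} (h : Matrix (Fin 2) (Fin 2) ℂ) (T : Tensor n) :
    actPow h (symm T) = symm (actPow h T) := by
  simp only [symm_apply, map_sum, actPow_perm]

/-- Contraction of the first two qubits with the antisymmetric form. -/
def contr {n : ℕ} : Tensor (n + 2) →ₗ[ℂ] Tensor n where
  toFun T z := T (Fin.cons 0 (Fin.cons 1 z)) - T (Fin.cons 1 (Fin.cons 0 z))
  map_add' S T := by ext z; simp only [Pi.add_apply]; ring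
  map_smul' c T := by ext z; simp only [Pi.smul_apply, smul_eq_mul, RingHom.id_apply]; ring

theorem contr_apply {n : ℕ} (T : Tensor (n + 2)) (z : Fin n → Fin 2) :
    contr T z = T (Fin.cons 0 (Fin.cons 1 z)) - T (Fin.cons 1 (Fin.cons 0 z)) := rfl

theorem sum_cons {n : ℕ} (f : (Fin (n + 1) → Fin 2) → ℂ) :
    ∑ y, f y = ∑ z : Fin n → Fin 2, (f (Fin.cons 0 z) + f (Fin.cons 1 z)) := by
  rw [← (Fin.consEquiv fun _ : Fin (n + 1) => Fin 2).sum_comp, Fintype.sum_prod_type_right]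
  exact Finset.sum_congr rfl fun z _ => Fin.sum_univ_two _

/-- The antisymmetric form on ℂ² is the determinant, which h multiplies by its own determinant. -/
theorem contr_actPow {n : ℕ} (h : Matrix (Fin 2) (Fin 2) ℂ) (T : Tensor (n + 2)) :
    contr (actPow h T) = h.det • actPow h (contr T) := by
  ext z
  simp only [contr_apply, act_apply, sum_cons, Fin.prod_univ_succ, Fin.cons_zero, Fin.cons_succ,
    Pi.smul_apply, smul_eq_mul, Finset.mul_sum, ← Finset.sum_sub_distrib, Matrix.det_fin_two]
  exact Finset.sum_congr rfl fun y _ => by ring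

/-- A vanishing contraction of the first two qubits means invariance under their swap. Testing it on
all permuted tensors gives every transposition, and these generate the symmetric group. -/
theorem isSymm_of_contr {n : ℕ} {T : Tensor (n + 2)} (hT : ∀ σ, contr (perm σ T) = 0) :
    IsSymm T := by
  have h01 : ∀ S : Tensor (n + 2), contr S = 0 → perm (Equiv.swap 0 1) S = S := by
    intro S hS
    ext x
    have key : ∀ a b : Fin 2, ∀ z : Fin n → Fin 2,
        S (Fin.cons a (Fin.cons b z)) = S (Fin.cons b (Fin.cons a z)) := by
      intro a b z
      have h := congrFun hS z
      rw [contr_apply, Pi.zero_apply, sub_eq_zero] at h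
      fin_cases a <;> fin_cases b <;> first | rfl | exact h | exact h.symm
    have hx : x = Fin.cons (x 0) (Fin.cons (x 1) fun i => x i.succ.succ) := by
      ext i
      refine Fin.cases rfl (fun i => Fin.cases rfl (fun i => rfl) i) i
    have hx' : x ∘ Equiv.swap 0 1 = Fin.cons (x 1) (Fin.cons (x 0) fun i => x i.succ.succ) := by
      funext i
      refine Fin.cases ?_ (fun i => Fin.cases ?_ (fun i => ?_) i) i
      · simp
      · have : Fin.succ (0 : Fin (n + 1)) = 1 := rfl
        simp [this]
      · rw [Function.comp_apply, Equiv.swap_apply_of_ne_of_ne (Fin.succ_ne_zero _)]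
        · rfl
        · intro h
          exact Fin.succ_ne_zero i (Fin.succ_injective _ h)
    rw [perm_apply, hx', key, ← hx]
  have hswap : ∀ i j : Fin (n + 2), i ≠ j → perm (Equiv.swap i j) T = T := by
    intro i j hij
    obtain ⟨σ, h0, h1⟩ : ∃ σ : Equiv.Perm (Fin (n + 2)), σ i = 0 ∧ σ j = 1 := by
      refine ⟨Equiv.swap i 0 |>.trans (Equiv.swap (Equiv.swap i 0 j) 1), ?_, ?_⟩
      · have : Equiv.swap i 0 j ≠ 0 := by
          intro h
          exact hij ((Equiv.swap i 0).injective (by rw [h, Equiv.swap_apply_left]))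
        rw [Equiv.trans_apply, Equiv.swap_apply_left,
          Equiv.swap_apply_of_ne_of_ne this.symm (by simp)]
      · simp
    have h := h01 _ (hT σ)
    rw [← perm_mul] at h
    have hs : Equiv.swap i j = σ⁻¹ * Equiv.swap 0 1 * σ := by
      rw [← h0, ← h1, Equiv.swap_apply_apply]
      group
    rw [hs, mul_assoc, perm_mul, h, ← perm_mul, inv_mul_cancel]
    rfl
  intro σ
  induction σ using Equiv.Perm.swap_induction_on with
  | one => rfl
  | swap_mul f x y hxy ih => rw [perm_mul, ih, hswap x y hxy]

/-- The generator `∑ i, Z_i` of the rotations about the `z`-axis. -/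
def weightOp {n : ℕ} : Tensor n →ₗ[ℂ] Tensor n where
  toFun T x := (∑ i, (-1 : ℂ) ^ (x i : ℕ)) * T x
  map_add' S T := by ext z; simp only [Pi.add_apply]; ring
  map_smul' c T := by ext z; simp only [Pi.smul_apply, smul_eq_mul, RingHom.id_apply]; ring

theorem weightOp_apply {n : ℕ} (T : Tensor n) (x : Fin n → Fin 2) :
    weightOp T x = (∑ i, (-1 : ℂ) ^ (x i : ℕ)) * T x := rfl

theorem weightOp_perm {n : ℕ} (σ : Equiv.Perm (Fin n)) (T : Tensor n) :
    weightOp (perm σ T) = perm σ (weightOp T) := by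
  ext x
  simp only [weightOp_apply, perm_apply, Function.comp_apply]
  rw [Equiv.sum_comp σ fun i => (-1 : ℂ) ^ (x i : ℕ)]

theorem weightOp_symm {n : ℕ} (T : Tensor n) : weightOp (symm T) = symm (weightOp T) := by
  simp only [symm_apply, map_sum, weightOp_perm]

/-- The contracted qubits carry opposite bits, so their two contributions to the total weight
cancel. -/
theorem contr_weightOp {n : ℕ} (T : Tensor (n + 2)) :
    contr (weightOp T) = weightOp (contr T) := by
  ext z
  simp only [contr_apply, weightOp_apply, Fin.sum_univ_succ, Fin.cons_zero, Fin.cons_succ]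
  simp
  ring

/-! ### Symmetric tensors as binary forms. -/

/-- The homogeneous polynomial attached to a tensor, evaluated at a vector. -/
def form {n : ℕ} (T : Tensor n) (v : Fin 2 → ℂ) : ℂ := ∑ x, T x * ∏ i, v (x i)

theorem form_add {n : ℕ} (S T : Tensor n) (v : Fin 2 → ℂ) :
    form (S + T) v = form S v + form T v := by
  simp [form, add_mul, Finset.sum_add_distrib]

theorem form_smul {n : ℕ} (c : ℂ) (T : Tensor n) (v : Fin 2 → ℂ) :
    form (c • T) v = c * form T v := by
  simp [form, Finset.mul_sum, mul_assoc]

theorem form_smul_right {n : ℕ} (c : ℂ) (T : Tensor n) (v : Fin 2 → ℂ) :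
    form T (c • v) = c ^ n * form T v := by
  simp only [form, Pi.smul_apply, smul_eq_mul, Finset.prod_mul_distrib, Finset.mul_sum]
  refine Finset.sum_congr rfl fun x _ => ?_
  simp
  ring

theorem form_actPow {n : ℕ} (h : Matrix (Fin 2) (Fin 2) ℂ) (T : Tensor n) (v : Fin 2 → ℂ) :
    form (actPow h T) v = form T (v ᵥ* h) := by
  simp only [form, act_apply, Finset.sum_mul]
  rw [Finset.sum_comm]
  refine Finset.sum_congr rfl fun y _ => ?_
  have hp := Finset.prod_univ_sum (fun _ : Fin n => (Finset.univ : Finset (Fin 2)))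
    (fun i j => v j * h j (y i))
  have : ∀ i, (v ᵥ* h) (y i) = ∑ j, v j * h j (y i) := fun i => rfl
  simp only [this]
  rw [hp, Fintype.piFinset_univ, Finset.mul_sum]
  exact Finset.sum_congr rfl fun x _ => by rw [Finset.prod_mul_distrib]; ring

theorem exists_perm_of_hammingWeight_eq {n : ℕ} {x y : Fin n → Fin 2}
    (h : hammingWeight x = hammingWeight y) : ∃ σ : Equiv.Perm (Fin n), x = y ∘ σ := by
  have h1 : Fintype.card {i // x i = 1} = Fintype.card {i // y i = 1} := by
    simpa [Fintype.card_subtype, hammingWeight] using h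
  have key : ∀ z : Fin n → Fin 2, Fintype.card {i // z i = 0} + Fintype.card {i // z i = 1} = n := by
    intro z
    have hz := Fintype.card_subtype_compl fun i => z i = 1
    have hle := Fintype.card_subtype_le fun i => z i = 1
    have : Fintype.card {i // ¬ z i = 1} = Fintype.card {i // z i = 0} :=
      Fintype.card_congr (Equiv.subtypeEquivRight fun i => by
        generalize z i = a; fin_cases a <;> simp)
    rw [Fintype.card_fin] at hz hle
    omega
  have e : ∀ c, Nonempty ({i // x i = c} ≃ {i // y i = c}) := by
    intro c
    refine ⟨Fintype.equivOfCardEq ?_⟩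
    have hx := key x
    have hy := key y
    fin_cases c
    · simp only [Fin.zero_eta]; omega
    · exact h1
  refine ⟨Equiv.ofFiberEquiv fun c => (e c).some, ?_⟩
  funext i
  exact (Equiv.ofFiberEquiv_map _ i).symm

/-- The bit string with `w` ones followed by zeros. -/
def bits (n w : ℕ) : Fin n → Fin 2 := fun i => if (i : ℕ) < w then 1 else 0

theorem hammingWeight_bits {n w : ℕ} (hw : w ≤ n) : hammingWeight (bits n w) = w := by
  have : (Finset.univ.filter fun i : Fin n => bits n w i = 1)
      = Finset.univ.filter fun i : Fin n => (i : ℕ) < w := by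
    ext i; simp [bits]
  rw [hammingWeight, this, Fin.card_filter_val_lt, min_eq_right hw]

theorem hammingWeight_le {n : ℕ} (x : Fin n → Fin 2) : hammingWeight x ≤ n :=
  (Finset.card_le_univ _).trans_eq (Fintype.card_fin n)

theorem hammingWeight_comp {n : ℕ} (x : Fin n → Fin 2) (σ : Equiv.Perm (Fin n)) :
    hammingWeight (x ∘ σ) = hammingWeight x := by
  refine Finset.card_bij (fun i _ => σ i) ?_ ?_ ?_
  · intro i hi; simpa using hi
  · intro i _ j _ hij; exact σ.injective hij
  · intro j hj; exact ⟨σ.symm j, by simpa using hj, by simp⟩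

theorem IsSymm.apply_eq {n : ℕ} {T : Tensor n} (hT : IsSymm T) (x : Fin n → Fin 2) :
    T x = T (bits n (hammingWeight x)) := by
  obtain ⟨σ, hσ⟩ := exists_perm_of_hammingWeight_eq
    (hammingWeight_bits (hammingWeight_le x)).symm
  have h := congrFun (hT σ) (bits n (hammingWeight x))
  rw [perm_apply] at h
  rwa [← hσ] at h

theorem isSymm_of_apply {n : ℕ} {t : ℕ → ℂ} {T : Tensor n} (h : ∀ x, T x = t (hammingWeight x)) :
    IsSymm T := fun σ => by
  ext x
  rw [perm_apply, h, h, hammingWeight_comp]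

theorem sum_hammingWeight {n : ℕ} (f : ℕ → ℂ) :
    ∑ x : Fin n → Fin 2, f (hammingWeight x) = ∑ w ∈ Finset.range (n + 1), (n.choose w : ℂ) * f w := by
  have h := Finset.sum_powerset_apply_card (x := (Finset.univ : Finset (Fin n))) f
  simp only [Finset.powerset_univ, Finset.card_univ, Fintype.card_fin, nsmul_eq_mul] at h
  rw [← h]
  refine Fintype.sum_bijective (fun x : Fin n → Fin 2 => Finset.univ.filter fun i => x i = 1)
    ⟨?_, ?_⟩ _ _ fun x => rfl
  · intro x y hxy
    funext i
    have := congrArg (i ∈ ·) hxy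
    simp only [Finset.mem_filter, Finset.mem_univ, true_and, eq_iff_iff] at this
    generalize x i = a at *
    generalize y i = b at *
    fin_cases a <;> fin_cases b <;> simp_all
  · intro s
    exact ⟨fun i => if i ∈ s then 1 else 0, by ext i; simp⟩

theorem prod_apply_eq {n : ℕ} (v : Fin 2 → ℂ) (x : Fin n → Fin 2) :
    ∏ i, v (x i) = v 0 ^ (n - hammingWeight x) * v 1 ^ hammingWeight x := by
  have h : ∀ i, v (x i) = if x i = 1 then v 1 else v 0 := by
    intro i
    generalize x i = a
    fin_cases a <;> simp
  simp only [h, Finset.prod_ite, Finset.prod_const]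
  have h2 := Finset.card_filter_add_card_filter_not (s := (Finset.univ : Finset (Fin n)))
    (fun i => x i = 1)
  rw [Finset.card_univ, Fintype.card_fin] at h2
  rw [mul_comm, hammingWeight]
  congr 2
  omega

theorem IsSymm.form_eq {n : ℕ} {T : Tensor n} (hT : IsSymm T) (v : Fin 2 → ℂ) :
    form T v = ∑ w ∈ Finset.range (n + 1),
      (n.choose w : ℂ) * (T (bits n w) * (v 0 ^ (n - w) * v 1 ^ w)) := by
  rw [← sum_hammingWeight fun w => T (bits n w) * (v 0 ^ (n - w) * v 1 ^ w)]
  exact Finset.sum_congr rfl fun x _ => by rw [hT.apply_eq x, prod_apply_eq]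

/-- On the affine line (1, s) the form is a polynomial of degree at most n whose coefficients are
the amplitudes times binomial coefficients. More than n zeros kill it, and the binomials can be
cancelled in characteristic zero. -/
theorem IsSymm.eq_zero_of_form {n : ℕ} {T : Tensor n} (hT : IsSymm T) (S : Finset ℂ)
    (hS : n < S.card) (h : ∀ s ∈ S, form T ![1, s] = 0) : T = 0 := by
  let p : Polynomial ℂ := ∑ w ∈ Finset.range (n + 1),
    Polynomial.monomial w ((n.choose w : ℂ) * T (bits n w))
  have hdeg : p.natDegree ≤ n := by
    refine Polynomial.natDegree_sum_le_of_forall_le _ _ fun w hw => ?_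
    exact (Polynomial.natDegree_monomial_le _).trans (by simpa [Nat.lt_succ_iff] using hw)
  have hp : p = 0 := by
    refine Polynomial.eq_zero_of_natDegree_lt_card_of_eval_eq_zero' p S (fun s hs => ?_)
      (hdeg.trans_lt hS)
    rw [← h s hs, hT.form_eq, Polynomial.eval_finsetSum]
    refine Finset.sum_congr rfl fun w _ => ?_
    simp [mul_assoc]
  ext x
  rw [hT.apply_eq x]
  have hc := congrArg (fun q => Polynomial.coeff q (hammingWeight x)) hp
  simp only [p, Polynomial.finsetSum_coeff, Polynomial.coeff_monomial, Polynomial.coeff_zero,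
    Finset.sum_ite_eq', Finset.mem_range, Nat.lt_succ_iff, hammingWeight_le, if_true] at hc
  refine (mul_eq_zero.mp hc).resolve_left ?_
  exact_mod_cast (Nat.choose_pos (hammingWeight_le x)).ne'

theorem IsSymm.ext_form {n : ℕ} {S T : Tensor n} (hS : IsSymm S) (hT : IsSymm T)
    (h : ∀ v, form S v = form T v) : S = T := by
  rw [← sub_eq_zero]
  have hs : IsSymm (S - T) := fun σ => by rw [map_sub, hS, hT]
  obtain ⟨F, hF⟩ := Infinite.exists_subset_card_eq ℂ (n + 1)
  refine hs.eq_zero_of_form F (by omega) fun s _ => ?_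
  rw [sub_eq_add_neg, form_add, ← neg_one_smul ℂ T, form_smul, h]
  ring

theorem IsSymm.finite_zeros {n : ℕ} {T : Tensor n} (hT : IsSymm T) (h0 : T ≠ 0) :
    {s : ℂ | form T ![1, s] = 0}.Finite := by
  by_contra hinf
  obtain ⟨F, hF, hc⟩ := Set.Infinite.exists_subset_card_eq hinf (n + 1)
  exact h0 (hT.eq_zero_of_form F (by omega) fun s hs => hF hs)

/-! ### Stabilizers of pencils of binary forms. -/

theorem finite_quadratic {a b c : ℂ} (h : ¬ (a = 0 ∧ b = 0 ∧ c = 0)) :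
    {s : ℂ | a + b * s + c * s ^ 2 = 0}.Finite := by
  have hp : Polynomial.C a + Polynomial.C b * Polynomial.X + Polynomial.C c * Polynomial.X ^ 2
      ≠ 0 := by
    intro hp
    refine h ⟨?_, ?_, ?_⟩
    · simpa using congrArg (fun q => Polynomial.coeff q 0) hp
    · simpa [Polynomial.coeff_X] using congrArg (fun q => Polynomial.coeff q 1) hp
    · simpa [Polynomial.coeff_X] using congrArg (fun q => Polynomial.coeff q 2) hp
  refine (Polynomial.finite_setOfPred_isRoot hp).subset fun s hs => ?_
  simpa [Polynomial.IsRoot] using hs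

/-- A pair of linearly independent tensors. -/
def Indep {n : ℕ} (V : Fin 2 → Tensor n) : Prop :=
  ∀ a b : ℂ, a • V 0 + b • V 1 = 0 → a = 0 ∧ b = 0

/-- The hypotheses are the three coefficients in s of the determinant with rows (1, s)h and (1, s)k.
Its vanishing says that h and k induce the same map of the projective line. -/
theorem proportional_of_rows {h k : Matrix (Fin 2) (Fin 2) ℂ} (hh : h.det ≠ 0)
    (h0 : h 0 0 * k 0 1 - h 0 1 * k 0 0 = 0)
    (h1 : h 0 0 * k 1 1 + h 1 0 * k 0 1 - h 0 1 * k 1 0 - h 1 1 * k 0 0 = 0)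
    (h2 : h 1 0 * k 1 1 - h 1 1 * k 1 0 = 0) : ∃ c : ℂ, k = c • h := by
  refine ⟨(k 0 0 * h 1 1 - k 0 1 * h 1 0) / h.det, ?_⟩
  rw [Matrix.det_fin_two] at *
  ext i j
  rw [Matrix.smul_apply, smul_eq_mul, div_mul_eq_mul_div, eq_div_iff hh]
  fin_cases i <;> fin_cases j <;> simp
  · linear_combination h 1 0 * h0
  · linear_combination h 1 1 * h0
  · linear_combination h 1 0 * h1 - h 0 0 * h2
  · linear_combination h 1 1 * h1 - h 0 1 * h2

/-- The stabilizer of a pencil of symmetric tensors acts on the fibres of a rational map, so it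
has few elements up to scalars. -/
theorem exists_proportional {m N : ℕ} (hN : m < N) {V : Fin 2 → Tensor m} (hV : Indep V)
    (hs : ∀ j, IsSymm (V j)) (h : Fin N → Matrix (Fin 2) (Fin 2) ℂ) (hd : ∀ i, (h i).det ≠ 0)
    (hK : ∀ i, ∃ c : ℂ, ∀ j, actPow (h i) (V j) = c • V j) :
    ∃ i j, i ≠ j ∧ ∃ c : ℂ, h j = c • h i := by
  by_contra! hne
  have hV0 : V 0 ≠ 0 := fun h0 => one_ne_zero (hV 1 0 (by simp [h0])).1
  have f1 : {s : ℂ | form (V 0) ![1, s] = 0}.Finite := (hs 0).finite_zeros hV0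
  have f2 : ∀ i, {s : ℂ | h i 0 0 + h i 1 0 * s + 0 * s ^ 2 = 0}.Finite := fun i =>
    finite_quadratic fun ⟨h1, h2, _⟩ => hd i (by rw [Matrix.det_fin_two, h1, h2]; ring)
  have f3 : ∀ i j, i ≠ j → {s : ℂ | (h i 0 0 * h j 0 1 - h i 0 1 * h j 0 0) +
      (h i 0 0 * h j 1 1 + h i 1 0 * h j 0 1 - h i 0 1 * h j 1 0 - h i 1 1 * h j 0 0) * s +
      (h i 1 0 * h j 1 1 - h i 1 1 * h j 1 0) * s ^ 2 = 0}.Finite := fun i j hij =>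
    finite_quadratic fun ⟨h1, h2, h3⟩ => by
      obtain ⟨c, hc⟩ := proportional_of_rows (hd i) h1 h2 h3
      exact hne i j hij c hc
  -- A generic s avoids finitely many bad values: `V 0` is nonzero at (1, s), each (1, s)hᵢ has
  -- nonzero first coordinate, and these points are pairwise distinct in the projective line.
  have f4 := (f1.union (Set.finite_iUnion f2)).union
    (Set.finite_iUnion fun i => Set.finite_iUnion fun j => Set.finite_iUnion (f3 i j))
  obtain ⟨s, hsn⟩ := f4.exists_notMem
  simp only [Set.mem_union, Set.mem_iUnion, Set.mem_ofPred_eq, not_or, not_exists] at hsn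
  obtain ⟨⟨g1, g2⟩, g3⟩ := hsn
  set v : Fin 2 → ℂ := ![1, s] with hv
  have e0 : ∀ i, (v ᵥ* h i) 0 = h i 0 0 + h i 1 0 * s := fun i => by
    simp [hv, Matrix.vecMul, dotProduct, Fin.sum_univ_two, mul_comm]
  have e1 : ∀ i, (v ᵥ* h i) 1 = h i 0 1 + h i 1 1 * s := fun i => by
    simp [hv, Matrix.vecMul, dotProduct, Fin.sum_univ_two, mul_comm]
  have n0 : ∀ i, (v ᵥ* h i) 0 ≠ 0 := fun i hi => g2 i (by rw [e0] at hi; linear_combination hi)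
  let q : Fin N → ℂ := fun i => (v ᵥ* h i) 1 / (v ᵥ* h i) 0
  have hq : Function.Injective q := by
    intro i j hij
    by_contra hne'
    have := (div_eq_div_iff (n0 i) (n0 j)).mp hij
    rw [e0, e0, e1, e1] at this
    exact g3 i j hne' (by linear_combination -this)
  -- The member of the pencil that vanishes at v. Each `h i` scales `V 0` and `V 1` by the same
  -- factor, so it vanishes at all N > m points v hᵢ as well, hence identically.
  let r : Tensor m := form (V 1) v • V 0 + (-form (V 0) v) • V 1
  have hr : IsSymm r := fun σ => by simp only [r, map_add, map_smul, hs 0 σ, hs 1 σ]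
  have hr0 : r = 0 := by
    refine hr.eq_zero_of_form (Finset.univ.image q)
      (by rw [Finset.card_image_of_injective _ hq]; simpa using hN) fun t ht => ?_
    obtain ⟨i, -, rfl⟩ := Finset.mem_image.mp ht
    have hvi : v ᵥ* h i = (v ᵥ* h i) 0 • ![1, q i] := by
      ext k
      fin_cases k
      · simp
      · simp [q, mul_div_cancel₀ _ (n0 i)]
    obtain ⟨c, hc⟩ := hK i
    have hz : form r (v ᵥ* h i) = 0 := by
      have hj : ∀ j, form (V j) (v ᵥ* h i) = c * form (V j) v := fun j => by
        rw [← form_actPow, hc, form_smul]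
      simp only [r, form_add, form_smul, hj]
      ring
    rw [hvi, form_smul_right] at hz
    exact (mul_eq_zero.mp hz).resolve_left (pow_ne_zero _ (n0 i))
  exact g1 (neg_eq_zero.mp (hV _ _ hr0).2)

/-! ### Matching physical and logical gates. -/

/-- The physical gate `h ^ {⊗ n}` implements the logical gate `g` on the encoding with columns
`V 0` and `V 1`. -/
def Intertwines {n : ℕ} (V : Fin 2 → Tensor n) (h g : Matrix (Fin 2) (Fin 2) ℂ) : Prop :=
  ∀ j, actPow h (V j) = ∑ i, g i j • V i

theorem Intertwines.mul {n : ℕ} {V : Fin 2 → Tensor n} {h g h' g' : Matrix (Fin 2) (Fin 2) ℂ}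
    (H : Intertwines V h g) (H' : Intertwines V h' g') : Intertwines V (h * h') (g * g') := by
  intro j
  rw [actPow_mul, H' j]
  simp only [Fin.sum_univ_two, map_add, map_smul, H _, Matrix.mul_apply]
  module

theorem Intertwines.one {n : ℕ} (V : Fin 2 → Tensor n) : Intertwines V 1 1 := by
  intro j
  rw [act_one, Fin.sum_univ_two]
  fin_cases j <;> simp [Matrix.one_apply]

theorem Intertwines.inv {n : ℕ} {V : Fin 2 → Tensor n} {h g h' g' : Matrix (Fin 2) (Fin 2) ℂ}
    (H : Intertwines V h g) (hh : h' * h = 1) (hg : g * g' = 1) : Intertwines V h' g' := by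
  intro j
  have h1 : V j = ∑ i, g' i j • actPow h (V i) := by
    have h2 : V j = ∑ i, (g * g') i j • V i := by
      rw [hg, Fin.sum_univ_two]; fin_cases j <;> simp [Matrix.one_apply]
    rw [h2]
    simp only [H _, Fin.sum_univ_two, Matrix.mul_apply]
    module
  conv_lhs => rw [h1]
  simp only [map_sum, map_smul, ← actPow_mul, hh, act_one]

theorem Intertwines.unique {n : ℕ} {V : Fin 2 → Tensor n} (hV : Indep V)
    {h g g' : Matrix (Fin 2) (Fin 2) ℂ} (H : Intertwines V h g) (H' : Intertwines V h g') :
    g = g' := by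
  have key : ∀ j, g 0 j - g' 0 j = 0 ∧ g 1 j - g' 1 j = 0 := fun j => by
    refine hV _ _ ?_
    have := (H j).symm.trans (H' j)
    simp only [Fin.sum_univ_two] at this
    rw [sub_smul, sub_smul]
    linear_combination (exp := 1) this
  ext i j
  fin_cases i
  · exact sub_eq_zero.mp (key j).1
  · exact sub_eq_zero.mp (key j).2

theorem Intertwines.smul {n : ℕ} {V : Fin 2 → Tensor n} {h g : Matrix (Fin 2) (Fin 2) ℂ} (c : ℂ)
    (H : Intertwines V h g) : Intertwines V (c • h) (c ^ n • g) := by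
  intro j
  rw [actPow_smul, H j]
  simp only [Fin.sum_univ_two, Matrix.smul_apply, smul_eq_mul]
  module

/-- Pairs of a physical and a logical gate that match up to a scalar. -/
def gatePairs {n : ℕ} (V : Fin 2 → Tensor n) : Subgroup (U2 × U2) where
  carrier := {p | ∃ c : ℂ, c ≠ 0 ∧ Intertwines V p.1 (c • (p.2 : Matrix (Fin 2) (Fin 2) ℂ))}
  mul_mem' := by
    rintro p q ⟨c, hc, hp⟩ ⟨d, hd, hq⟩
    refine ⟨c * d, mul_ne_zero hc hd, ?_⟩
    have := hp.mul hq
    rwa [smul_mul_smul_comm] at this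
  one_mem' := ⟨1, one_ne_zero, by simpa using Intertwines.one V⟩
  inv_mem' := by
    rintro p ⟨c, hc, hp⟩
    refine ⟨c⁻¹, inv_ne_zero hc, hp.inv ?_ ?_⟩
    · exact congrArg Subtype.val (inv_mul_cancel p.1)
    · rw [smul_mul_smul_comm, mul_inv_cancel₀ hc, one_smul]
      exact congrArg Subtype.val (mul_inv_cancel p.2)

/-! ### Commuting two-by-two matrices and the centre of U(2). -/

theorem det_ne_zero (h : U2) : (h : Matrix (Fin 2) (Fin 2) ℂ).det ≠ 0 := by
  have := congrArg Matrix.det (Matrix.mem_unitaryGroup_iff.mp h.2)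
  rw [Matrix.det_mul, Matrix.det_one] at this
  exact left_ne_zero_of_mul_eq_one this

theorem coe_ne_zero (h : U2) : (h : Matrix (Fin 2) (Fin 2) ℂ) ≠ 0 := fun h0 =>
  det_ne_zero h (by rw [h0]; simp)

/-- A nonscalar 2 × 2 matrix has a minimal polynomial of degree two, so its commutant is spanned by
1 and itself. The cases divide by whichever of the off-diagonal entries and the diagonal difference
is nonzero. -/
theorem comm_span {A B : Matrix (Fin 2) (Fin 2) ℂ} (hA : ¬ ∃ c : ℂ, A = c • 1)
    (h : A * B = B * A) : ∃ a b : ℂ, B = a • 1 + b • A := by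
  have e := fun i j => congrFun (congrFun h i) j
  simp only [Matrix.mul_apply, Fin.sum_univ_two] at e
  have e00 := e 0 0
  have e01 := e 0 1
  have e10 := e 1 0
  by_cases h01 : A 0 1 = 0
  · by_cases h10 : A 1 0 = 0
    · have hd : A 0 0 - A 1 1 ≠ 0 := fun hd => hA ⟨A 0 0, by
        ext i j
        fin_cases i <;> fin_cases j <;> simp [h01, h10]
        linear_combination -hd⟩
      refine ⟨B 0 0 - (B 0 0 - B 1 1) / (A 0 0 - A 1 1) * A 0 0,
        (B 0 0 - B 1 1) / (A 0 0 - A 1 1), ?_⟩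
      rw [h01] at e01
      rw [h10] at e10
      have z01 : B 0 1 = 0 := (mul_eq_zero.mp (show (A 0 0 - A 1 1) * B 0 1 = 0 by
        linear_combination e01)).resolve_left hd
      have z10 : B 1 0 = 0 := (mul_eq_zero.mp (show (A 0 0 - A 1 1) * B 1 0 = 0 by
        linear_combination -e10)).resolve_left hd
      ext i j
      fin_cases i <;> fin_cases j <;> simp [h01, h10, z01, z10]
      field_simp
      ring
    · refine ⟨B 0 0 - B 1 0 / A 1 0 * A 0 0, B 1 0 / A 1 0, ?_⟩
      ext i j
      fin_cases i <;> fin_cases j <;> simp <;> field_simp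
      · linear_combination -e00
      · linear_combination -e10
  · refine ⟨B 0 0 - B 0 1 / A 0 1 * A 0 0, B 0 1 / A 0 1, ?_⟩
    ext i j
    fin_cases i <;> fin_cases j <;> simp <;> field_simp
    · linear_combination e00
    · linear_combination e01

theorem comm_of_comm {A B C : Matrix (Fin 2) (Fin 2) ℂ} (hA : ¬ ∃ c : ℂ, A = c • 1)
    (hB : A * B = B * A) (hC : A * C = C * A) : B * C = C * B := by
  obtain ⟨a, b, rfl⟩ := comm_span hA hB
  rw [add_mul, mul_add, smul_mul_assoc, smul_mul_assoc, hC]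
  simp

theorem mem_center_iff {h : U2} :
    h ∈ Subgroup.center U2 ↔ ∃ c : ℂ, (h : Matrix (Fin 2) (Fin 2) ℂ) = c • 1 := by
  constructor
  · intro hh
    have hX := congrArg Subtype.val (Subgroup.mem_center_iff.mp hh gateX)
    have hZ := congrArg Subtype.val (Subgroup.mem_center_iff.mp hh gateZ)
    have hX : (gateX : Matrix (Fin 2) (Fin 2) ℂ) * h = h * gateX := hX
    have hZ : (gateZ : Matrix (Fin 2) (Fin 2) ℂ) * h = h * gateZ := hZ
    refine ⟨h.1 0 0, ?_⟩
    have x := fun i j => congrFun (congrFun hX i) j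
    have z := fun i j => congrFun (congrFun hZ i) j
    have x1 := x 0 1
    have z1 := z 0 1
    have z2 := z 1 0
    simp [gateX, gateZ, Matrix.mul_apply, Fin.sum_univ_two] at x1 z1 z2
    ext i j
    fin_cases i <;> fin_cases j <;> simp
    · have : (2 * I) * h.1 0 1 = 0 := by linear_combination -z1
      simpa using this
    · have : (2 * I) * h.1 1 0 = 0 := by linear_combination z2
      simpa using this
    · have : I * (h.1 1 1 - h.1 0 0) = 0 := by linear_combination x1
      simpa [sub_eq_zero] using this
  · rintro ⟨c, hc⟩
    rw [Subgroup.mem_center_iff]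
    intro g
    apply Subtype.ext
    change (g : Matrix (Fin 2) (Fin 2) ℂ) * h = h * g
    simp [hc]

theorem coe_mul (g h : U2) : ((g * h : U2) : Matrix (Fin 2) (Fin 2) ℂ) = g * h := rfl

theorem coe_inv_mul (g : U2) : ((g⁻¹ : U2) : Matrix (Fin 2) (Fin 2) ℂ) * g = 1 :=
  congrArg Subtype.val (inv_mul_cancel g)

theorem coe_mul_inv (g : U2) : (g : Matrix (Fin 2) (Fin 2) ℂ) * (g⁻¹ : U2) = 1 :=
  congrArg Subtype.val (mul_inv_cancel g)

/-! ### Relations among the gates, and commutator arguments. -/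

/-- The matrix of the gate `Φ` with the golden ratio replaced by `a`. -/
noncomputable def icosa (a : ℂ) : Matrix (Fin 2) (Fin 2) ℂ :=
  (1 / 2 : ℂ) • !![a + I * (a - 1), 1; -1, a - I * (a - 1)]

theorem goldenRatio_sq' : (Real.goldenRatio : ℂ) ^ 2 = (Real.goldenRatio : ℂ) + 1 := by
  exact_mod_cast congrArg (fun r : ℝ => (r : ℂ)) Real.goldenRatio_sq

theorem coe_gatePhi : (gatePhi : Matrix (Fin 2) (Fin 2) ℂ) = icosa Real.goldenRatio := by
  have hinv : ((Real.goldenRatio : ℂ))⁻¹ = (Real.goldenRatio : ℂ) - 1 := by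
    exact inv_eq_of_mul_eq_one_right (by linear_combination goldenRatio_sq')
  rw [icosa, ← hinv]
  rfl

/-- Cayley-Hamilton: the trace is a, and the determinant is 1 by the equation for a. -/
theorem icosa_sq {a : ℂ} (ha : a ^ 2 = a + 1) : icosa a * icosa a = a • icosa a - 1 := by
  ext i j
  fin_cases i <;> fin_cases j <;> simp [icosa, Matrix.mul_apply, Fin.sum_univ_two]
  · linear_combination (-1 / 2 : ℂ) * ha + (a - 1) ^ 2 / 4 * I_sq
  · ring
  · ring
  · linear_combination (-1 / 2 : ℂ) * ha + (a - 1) ^ 2 / 4 * I_sq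

theorem icosa_pow_five {a : ℂ} (ha : a ^ 2 = a + 1) : icosa a ^ 5 = -1 := by
  have h2 : icosa a ^ 2 = a • icosa a - 1 := by rw [pow_two, icosa_sq ha]
  have h3 : icosa a ^ 3 = a • icosa a - a • 1 := by
    rw [pow_succ, h2, sub_mul, smul_mul_assoc, icosa_sq ha, smul_sub, smul_smul, ← pow_two, ha,
      one_mul]
    module
  have h5 : icosa a ^ 5 = (a * a) • (icosa a * icosa a) - a • icosa a - (a * a) • icosa a + a • 1 := by
    rw [show 5 = 3 + 2 from rfl, pow_add, h3, h2]
    simp only [sub_mul, mul_sub, smul_mul_assoc, mul_smul_comm, one_mul, mul_one]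
    module
  have h6 : icosa a ^ 5 = (a * a * a - a - a * a) • icosa a + (a - a * a) • 1 := by
    rw [h5, icosa_sq ha]
    module
  rw [h6, show a * a * a - a - a * a = 0 by linear_combination a * ha,
    show a - a * a = -1 by linear_combination -ha]
  simp

theorem gateF_mul_gateX : gateF * gateX = gateZ * gateX * gateF := by
  apply Subtype.ext
  ext i j
  fin_cases i <;> fin_cases j <;>
    simp [gateF, gateX, gateZ] <;> ring_nf <;>
    simp [I_sq] <;> ring_nf

theorem gateF_mul_gateZ : gateF * gateZ = gateX * gateF := by
  apply Subtype.ext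
  ext i j
  fin_cases i <;> fin_cases j <;>
    simp [gateF, gateX, gateZ] <;> ring_nf

theorem gateX_mul_gateZ_ne : gateX * gateZ ≠ gateZ * gateX := by
  intro h
  have := congrFun (congrFun (congrArg Subtype.val h) 0) 1
  simp [gateX, gateZ] at this
  norm_num at this

/-- This commutator and the next one do not commute with each other, which is what makes the group
too large to normalize an abelian kernel. -/
theorem gateX_comm_gateF : gateX * gateF * gateX⁻¹ * gateF⁻¹ = gateZ⁻¹ := by
  rw [mul_inv_eq_iff_eq_mul, mul_inv_eq_iff_eq_mul, eq_comm, mul_assoc,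
    gateF_mul_gateX, mul_assoc, inv_mul_cancel_left]

theorem gateZ_comm_gateF : gateZ * gateF * gateZ⁻¹ * gateF⁻¹ = gateZ * gateX⁻¹ := by
  rw [mul_inv_eq_iff_eq_mul, mul_inv_eq_iff_eq_mul, eq_comm, mul_assoc,
    mul_assoc, gateF_mul_gateZ, inv_mul_cancel_left]

/-- PAP' commutes with A and has the same trace, so the traceless part N of A satisfies PN = bNP for
a nonzero scalar b; the same holds for S. Such scalars multiply along products, hence cancel in the
commutator C. -/
theorem commutator_commute {A P P' S S' C : Matrix (Fin 2) (Fin 2) ℂ}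
    (hA : ¬ ∃ c : ℂ, A = c • 1) (hP : P' * P = 1) (hS : S' * S = 1)
    (hPA : A * (P * A * P') = P * A * P' * A) (hSA : A * (S * A * S') = S * A * S' * A)
    (hC : C * (S * P) = P * S) : C * A = A * C := by
  set N := A - (A.trace / 2) • (1 : Matrix (Fin 2) (Fin 2) ℂ) with hN
  have hN0 : N ≠ 0 := fun h => hA ⟨_, sub_eq_zero.mp h⟩
  have key : ∀ P P' : Matrix (Fin 2) (Fin 2) ℂ, P' * P = 1 →
      A * (P * A * P') = P * A * P' * A → ∃ b : ℂ, b ≠ 0 ∧ P * N = b • (N * P) := by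
    intro P P' hP h
    obtain ⟨a, b, hab⟩ := comm_span hA h
    have hPA' : P * A = (a • 1 + b • A) * P := by
      rw [← hab, mul_assoc, hP, mul_one]
    have htr : A.trace = 2 * a + b * A.trace := by
      have h1 : (P * A * P').trace = A.trace := by
        rw [Matrix.trace_mul_comm, ← mul_assoc, hP, one_mul]
      conv_lhs => rw [← h1, hab]
      simp [Matrix.trace_add, Matrix.trace_smul, mul_comm]
    have hb : P * N = b • (N * P) := by
      have ha : a = (A.trace - b * A.trace) / 2 := by linear_combination -htr / 2
      rw [hN, mul_sub, hPA', ha]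
      simp only [add_mul, sub_mul, smul_mul_assoc, one_mul, mul_smul_comm, mul_one]
      module
    refine ⟨b, fun h0 => hN0 ?_, hb⟩
    rw [h0, zero_smul] at hb
    rw [← one_mul N, ← hP, mul_assoc, hb, mul_zero]
  obtain ⟨b, hb0, hb⟩ := key P P' hP hPA
  obtain ⟨d, hd0, hd⟩ := key S S' hS hSA
  have h1 : P * S * N = (b * d) • (N * (P * S)) := by
    rw [mul_assoc, hd, mul_smul_comm, ← mul_assoc, hb, smul_mul_assoc, smul_smul, mul_assoc,
      mul_comm d]
  have h2 : S * P * N = (b * d) • (N * (S * P)) := by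
    rw [mul_assoc, hb, mul_smul_comm, ← mul_assoc, hd, smul_mul_assoc, smul_smul, mul_assoc]
  have h3 : (b * d) • (C * N * (S * P)) = (b * d) • (N * C * (S * P)) := by
    have e1 : C * (S * P * N) = (b * d) • (C * N * (S * P)) := by
      rw [h2, mul_smul_comm, mul_assoc]
    have e2 : C * (S * P * N) = (b * d) • (N * C * (S * P)) := by
      rw [← mul_assoc, hC, h1, mul_assoc N, hC]
    rw [← e1, e2]
  have h4 : C * N = N * C := by
    have h5 := smul_right_injective _ (mul_ne_zero hb0 hd0) h3
    have hP2 := _root_.mul_eq_one_comm.mp hP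
    have hS2 := _root_.mul_eq_one_comm.mp hS
    have h6 : (S * P) * (P' * S') = 1 := by
      rw [mul_assoc, ← mul_assoc P, hP2, one_mul, hS2]
    rw [← mul_one (C * N), ← mul_one (N * C), ← h6, ← mul_assoc, ← mul_assoc (N * C), h5]
  rw [hN, mul_sub, sub_mul] at h4
  simpa using h4

theorem mem_center_of_mul_comm {k a b : U2} (hk : k ∉ Subgroup.center U2)
    (ha : k * a = a * k) (hb : k * b = b * k) : a * b = b * a := by
  rw [mem_center_iff] at hk
  exact Subtype.ext (comm_of_comm hk (congrArg Subtype.val ha) (congrArg Subtype.val hb))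

/-- Both commutators lie in the commutant of k, which is commutative because k is not scalar. -/
theorem mul_comm_of_conj_comm {k x z f : U2} (hk : k ∉ Subgroup.center U2)
    (H : ∀ p ∈ ({x, z, f} : Set U2), k * (p * k * p⁻¹) = p * k * p⁻¹ * k) :
    (x * f * x⁻¹ * f⁻¹) * (z * f * z⁻¹ * f⁻¹) =
      (z * f * z⁻¹ * f⁻¹) * (x * f * x⁻¹ * f⁻¹) := by
  have key : ∀ p ∈ ({x, z, f} : Set U2), ∀ s ∈ ({x, z, f} : Set U2),
      k * (p * s * p⁻¹ * s⁻¹) = (p * s * p⁻¹ * s⁻¹) * k := by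
    intro p hp s hs
    apply Subtype.ext
    refine (commutator_commute (mem_center_iff.not.mp hk) (coe_inv_mul p) (coe_inv_mul s)
      (congrArg Subtype.val (H p hp)) (congrArg Subtype.val (H s hs)) ?_).symm
    refine congrArg Subtype.val (?_ : (p * s * p⁻¹ * s⁻¹) * (s * p) = p * s)
    group
  exact mem_center_of_mul_comm hk (key x (by simp) f (by simp)) (key z (by simp) f (by simp))

theorem scalar_of_comm_pair {k l a : Matrix (Fin 2) (Fin 2) ℂ} (hk : ¬ ∃ c : ℂ, k = c • 1)
    (hkl : k * l ≠ l * k) (h1 : a * k = k * a) (h2 : a * l = l * a) : ∃ c : ℂ, a = c • 1 := by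
  obtain ⟨b, d, rfl⟩ := comm_span hk h1.symm
  refine ⟨b, ?_⟩
  have : d • (k * l - l * k) = 0 := by
    simp only [add_mul, mul_add, smul_mul_assoc, mul_smul_comm, one_mul, mul_one] at h2
    rw [smul_sub, sub_eq_zero]
    exact add_left_cancel h2
  rw [(smul_eq_zero.mp this).resolve_right (sub_ne_zero.mpr hkl)]
  simp

/-! ### The kernel of the correspondence between physical and logical gates. -/

theorem mem_gatePairs_one {n : ℕ} {V : Fin 2 → Tensor n} {k : U2} (hk : (k, 1) ∈ gatePairs V) :
    ∃ c : ℂ, ∀ j, actPow (k : Matrix (Fin 2) (Fin 2) ℂ) (V j) = c • V j := by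
  obtain ⟨c, -, hc⟩ := hk
  refine ⟨c, fun j => ?_⟩
  rw [hc j, Fin.sum_univ_two]
  fin_cases j <;> simp

theorem center_mem_gatePairs {n : ℕ} (V : Fin 2 → Tensor n) {h g : U2}
    (hh : h ∈ Subgroup.center U2) (hg : g ∈ Subgroup.center U2) : (h, g) ∈ gatePairs V := by
  obtain ⟨c, hc⟩ := mem_center_iff.mp hh
  obtain ⟨d, hd⟩ := mem_center_iff.mp hg
  have hc0 : c ≠ 0 := fun h0 => coe_ne_zero h (by rw [hc, h0, zero_smul])
  have hd0 : d ≠ 0 := fun h0 => coe_ne_zero g (by rw [hd, h0, zero_smul])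
  refine ⟨c ^ n / d, div_ne_zero (pow_ne_zero _ hc0) hd0, ?_⟩
  simp only [hc, hd, smul_smul, div_mul_cancel₀ _ hd0]
  exact (Intertwines.one V).smul c

/-- Pairs match only up to a scalar, so a central logical gate can be replaced by 1. -/
theorem kernel_iff {n : ℕ} {V : Fin 2 → Tensor n} {h g : U2} (hg : (h, g) ∈ gatePairs V)
    (hc : g ∈ Subgroup.center U2) : (h, 1) ∈ gatePairs V := by
  have := mul_mem hg (inv_mem (center_mem_gatePairs V (one_mem _) hc))
  simpa using this

theorem center_of_center {n : ℕ} {V : Fin 2 → Tensor n} (hV : Indep V) {h g : U2}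
    (hg : (h, g) ∈ gatePairs V) (hc : h ∈ Subgroup.center U2) : g ∈ Subgroup.center U2 := by
  have := mul_mem hg (inv_mem (center_mem_gatePairs V hc (one_mem _)))
  obtain ⟨c, hc0, hc⟩ := this
  simp only [Prod.inv_mk, inv_one, Prod.mk_mul_mk, mul_inv_cancel, mul_one] at hc
  have := (Intertwines.one V).unique hV hc
  exact mem_center_iff.mpr ⟨c⁻¹, by rw [this, smul_smul, inv_mul_cancel₀ hc0, one_smul]⟩

theorem zpow_notMem {k : U2} (hk : k ^ 2 ∉ Subgroup.center U2) {a : ℤ} (h1 : -2 ≤ a) (h2 : a ≤ 2)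
    (ha : a ≠ 0) : k ^ a ∉ Subgroup.center U2 := by
  intro h
  have hz : k ^ (2 : ℤ) ∈ Subgroup.center U2 := by
    obtain rfl | rfl | rfl | rfl : a = -2 ∨ a = -1 ∨ a = 1 ∨ a = 2 := by omega
    · simpa using inv_mem h
    · simpa using Subgroup.zpow_mem _ h (-2)
    · simpa using Subgroup.zpow_mem _ h 2
    · exact h
  exact hk (by exact_mod_cast hz)

theorem kernel_comm {m : ℕ} (hm : m < 9) {V : Fin 2 → Tensor m} (hV : Indep V)
    (hs : ∀ j, IsSymm (V j)) {k l : U2} (hk : (k, 1) ∈ gatePairs V) (hl : (l, 1) ∈ gatePairs V)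
    (hk2 : k ^ 2 ∉ Subgroup.center U2) (hl2 : l ^ 2 ∉ Subgroup.center U2) : k * l = l * k := by
  -- Nine products kⁱlʲ with 0 ≤ i, j ≤ 2 outnumber the degree m, so two of them are proportional.
  -- This yields kᵃ = lᵇz with z central, |a|, |b| ≤ 2 and a ≠ 0; since kᵃ is not scalar and
  -- commutes with both k and l, these commute.
  let h : Fin 9 → U2 := fun i => k ^ ((i : ℕ) / 3) * l ^ ((i : ℕ) % 3)
  have hh : ∀ i, (h i, 1) ∈ gatePairs V := fun i => by
    simpa using mul_mem (pow_mem hk ((i : ℕ) / 3)) (pow_mem hl ((i : ℕ) % 3))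
  obtain ⟨i, j, hij, c, hc⟩ := exists_proportional hm hV hs (fun i => (h i).1)
    (fun i => det_ne_zero _) fun i => mem_gatePairs_one (hh i)
  obtain ⟨z, hzdef⟩ : ∃ z, z = (h i)⁻¹ * h j := ⟨_, rfl⟩
  have hz : z ∈ Subgroup.center U2 := by
    rw [hzdef]
    refine mem_center_iff.mpr ⟨c, ?_⟩
    rw [coe_mul, hc, mul_smul_comm, coe_inv_mul]
  set a : ℤ := ((j : ℕ) / 3 : ℕ) - ((i : ℕ) / 3 : ℕ) with ha
  set b : ℤ := ((i : ℕ) % 3 : ℕ) - ((j : ℕ) % 3 : ℕ) with hb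
  have heq : k ^ a = l ^ b * z := by
    have h1 : k ^ ((j : ℕ) / 3) * l ^ ((j : ℕ) % 3)
        = k ^ ((i : ℕ) / 3) * l ^ ((i : ℕ) % 3) * z := by
      change h j = h i * z
      rw [hzdef, mul_inv_cancel_left]
    have h2 : l ^ ((j : ℕ) % 3) * z = z * l ^ ((j : ℕ) % 3) := Subgroup.mem_center_iff.mp hz _
    rw [ha, hb, sub_eq_neg_add, _root_.zpow_add, _root_.zpow_neg, zpow_natCast, zpow_natCast, inv_mul_eq_iff_eq_mul,
      _root_.zpow_sub, zpow_natCast, zpow_natCast, ← mul_left_inj (l ^ ((j : ℕ) % 3)), h1]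
    rw [mul_assoc, mul_assoc (k ^ ((i : ℕ) / 3)), mul_assoc _ z, ← h2]
    group
  have hi := i.2
  have hj := j.2
  have hne : a ≠ 0 ∨ b ≠ 0 := by
    by_contra! hab
    exact hij (Fin.ext (by omega))
  have ha0 : a ≠ 0 := by
    intro h0
    rw [h0, zpow_zero] at heq
    refine zpow_notMem hl2 (a := b) (by omega) (by omega) (by tauto) ?_
    rw [eq_comm, mul_eq_one_iff_eq_inv] at heq
    rw [heq]
    exact inv_mem hz
  have hka := zpow_notMem hk2 (a := a) (by omega) (by omega) ha0
  refine mem_center_of_mul_comm hka ((Commute.refl k).zpow_left a).eq ?_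
  rw [heq, mul_assoc, ← Subgroup.mem_center_iff.mp hz l, ← mul_assoc, ← mul_assoc,
    ((Commute.refl l).zpow_left b).eq]

/-- Two elements of `U(2)` whose squares and whose product's square are scalar commute or
anticommute. -/
theorem comm_or_anticomm {k l : Matrix (Fin 2) (Fin 2) ℂ} {a b c : ℂ} (ha0 : a ≠ 0) (hb0 : b ≠ 0)
    (ha : k * k = a • 1) (hb : l * l = b • 1) (hc : k * l * (k * l) = c • 1) :
    k * l = l * k ∨ k * l = -(l * k) := by
  have hk0 : k ≠ 0 := by
    rintro rfl
    have := congrFun (congrFun ha 0) 0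
    simp at this
    exact ha0 this.symm
  have h1 : (a * b) • (k * l) = c • (l * k) := by
    have : k * l * (k * l) * (l * k) = (a * b) • (k * l) := by
      calc k * l * (k * l) * (l * k) = k * l * k * (l * l) * k := by simp only [mul_assoc]
        _ = k * l * (b • (k * k)) := by rw [hb]; simp [mul_assoc]
        _ = (a * b) • (k * l) := by rw [ha]; simp [smul_smul, mul_comm]
    rw [← this, hc, smul_mul_assoc, one_mul]
  obtain ⟨ν, hν⟩ : ∃ ν : ℂ, k * l = ν • (l * k) :=
    ⟨c / (a * b), by rw [div_eq_inv_mul, mul_smul, ← h1, smul_smul,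
      inv_mul_cancel₀ (mul_ne_zero ha0 hb0), one_smul]⟩
  have h2 : (b * (1 - ν ^ 2)) • k = 0 := by
    have e1 : k * l * l = b • k := by rw [mul_assoc, hb, mul_smul_comm, mul_one]
    have e2 : k * l * l = (ν ^ 2 * b) • k := by
      rw [hν, smul_mul_assoc, mul_assoc, hν, mul_smul_comm, ← mul_assoc, hb, smul_mul_assoc,
        one_mul, smul_smul, smul_smul, pow_two, mul_assoc]
    rw [mul_sub, sub_smul, mul_one, ← e1, e2, mul_comm, sub_self]
  have h3 := (mul_eq_zero.mp ((smul_eq_zero.mp h2).resolve_right hk0)).resolve_left hb0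
  have h4 : (ν - 1) * (ν + 1) = 0 := by linear_combination -h3
  rcases mul_eq_zero.mp h4 with h | h
  · left; rw [hν, sub_eq_zero.mp h, one_smul]
  · right; rw [hν, eq_neg_of_add_eq_zero_left h, neg_smul, one_smul]

/-- An element that commutes up to sign with two anticommuting elements `k` and `l` is
proportional to one of `1`, `k`, `l`, `k * l`. -/
theorem mem_klein {k l s : U2}
    (hkl : (k : Matrix (Fin 2) (Fin 2) ℂ) * l = -(l * k)) (hkl' : k * l ≠ l * k)
    (hsk : (s : Matrix (Fin 2) (Fin 2) ℂ) * k = k * s ∨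
      (s : Matrix (Fin 2) (Fin 2) ℂ) * k = -(k * s))
    (hsl : (s : Matrix (Fin 2) (Fin 2) ℂ) * l = l * s ∨
      (s : Matrix (Fin 2) (Fin 2) ℂ) * l = -(l * s)) :
    ∃ q ∈ ({1, k, l, k * l} : Set U2), s * q ∈ Subgroup.center U2 := by
  have hkn : k ∉ Subgroup.center U2 := fun h => hkl' (Subgroup.mem_center_iff.mp h l).symm
  have main : ∀ q : U2, (s : Matrix (Fin 2) (Fin 2) ℂ) * q * k = k * (s * q) →
      (s : Matrix (Fin 2) (Fin 2) ℂ) * q * l = l * (s * q) → s * q ∈ Subgroup.center U2 :=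
    fun q h1 h2 => mem_center_iff.mpr (scalar_of_comm_pair (mem_center_iff.not.mp hkn)
      (fun h => hkl' (Subtype.ext h)) h1 h2)
  have hlk : (l : Matrix (Fin 2) (Fin 2) ℂ) * k = -(k * l) := by rw [hkl, neg_neg]
  rcases hsk with a | a <;> rcases hsl with b | b
  · exact ⟨1, by simp, main 1 (by simpa using a) (by simpa using b)⟩
  · refine ⟨k, by simp, main k (by rw [a]; simp [mul_assoc, a]) ?_⟩
    rw [mul_assoc, hkl, mul_neg, ← mul_assoc, b, neg_mul, neg_neg, mul_assoc]
  · refine ⟨l, by simp, main l ?_ (by rw [b]; simp [mul_assoc, b])⟩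
    rw [mul_assoc, hlk, mul_neg, ← mul_assoc, a, neg_mul, neg_neg, mul_assoc]
  · refine ⟨k * l, by simp, main (k * l) ?_ ?_⟩
    · rw [coe_mul, mul_assoc, mul_assoc, hlk, mul_neg, mul_neg, ← mul_assoc, a, neg_mul, neg_neg,
        mul_assoc]
    · have b' : (l : Matrix (Fin 2) (Fin 2) ℂ) * s = -(s * l) := by rw [b, neg_neg]
      rw [coe_mul, ← mul_assoc (l : Matrix (Fin 2) (Fin 2) ℂ), b', neg_mul,
        mul_assoc (s : Matrix (Fin 2) (Fin 2) ℂ) l, ← mul_assoc (l : Matrix (Fin 2) (Fin 2) ℂ) k,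
        hlk, neg_mul, mul_neg, neg_neg, mul_assoc (s : Matrix (Fin 2) (Fin 2) ℂ)]

/-- Commutation up to sign. -/
def SignComm (a b : U2) : Prop :=
  (a : Matrix (Fin 2) (Fin 2) ℂ) * b = b * a ∨ (a : Matrix (Fin 2) (Fin 2) ℂ) * b = -(b * a)

theorem mk_eq_iff {a b : U2} : (QuotientGroup.mk a : U2 ⧸ Subgroup.center U2) = QuotientGroup.mk b ↔
    ∃ c : ℂ, (b : Matrix (Fin 2) (Fin 2) ℂ) = c • a := by
  rw [QuotientGroup.eq, mem_center_iff]
  refine exists_congr fun c => ⟨fun h => ?_, fun h => ?_⟩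
  · rw [← one_mul (b : Matrix (Fin 2) (Fin 2) ℂ), ← coe_mul_inv a, mul_assoc, ← coe_mul, h]
    simp
  · rw [coe_mul, h, mul_smul_comm, coe_inv_mul]

theorem SignComm.mk_comm {a b : U2} (h : SignComm a b) :
    (QuotientGroup.mk (a * b) : U2 ⧸ Subgroup.center U2) = QuotientGroup.mk (b * a) := by
  rw [mk_eq_iff]
  rcases h with h | h
  · exact ⟨1, by rw [coe_mul, coe_mul, h, one_smul]⟩
  · exact ⟨-1, by rw [coe_mul, coe_mul, h, smul_neg, neg_one_smul, neg_neg]⟩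

/-- Write ab = c·ba. Moving a past b² produces c², and b² is central, so c = ±1. -/
theorem signComm_of_mk {a b : U2} (hb : b ^ 2 ∈ Subgroup.center U2)
    (h : (QuotientGroup.mk (a * b) : U2 ⧸ Subgroup.center U2) = QuotientGroup.mk (b * a)) :
    SignComm a b := by
  obtain ⟨c, hc⟩ := mk_eq_iff.mp h.symm
  rw [coe_mul, coe_mul] at hc
  have h2 : (a : Matrix (Fin 2) (Fin 2) ℂ) * (b * b) = b * b * a := by
    have := congrArg Subtype.val (Subgroup.mem_center_iff.mp hb a)
    rwa [pow_two] at this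
  have h3 : (c ^ 2 - 1) • ((b * b * a : U2) : Matrix (Fin 2) (Fin 2) ℂ) = 0 := by
    have e : (a : Matrix (Fin 2) (Fin 2) ℂ) * (b * b) = c ^ 2 • ((b : Matrix (Fin 2) (Fin 2) ℂ) * b * a) := by
      rw [← mul_assoc, hc, smul_mul_assoc, mul_assoc, hc, mul_smul_comm, smul_smul, ← mul_assoc,
        pow_two]
    rw [sub_smul, one_smul, coe_mul, coe_mul, sub_eq_zero, ← e, h2]
  have h4 : (c - 1) * (c + 1) = 0 := by
    linear_combination (smul_eq_zero.mp h3).resolve_right (coe_ne_zero _)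
  rcases mul_eq_zero.mp h4 with h | h
  · left; rw [hc, sub_eq_zero.mp h, one_smul]
  · right; rw [hc, eq_neg_of_add_eq_zero_left h, neg_smul, one_smul]

theorem signComm_of_sq {k l : U2} (hk : k ^ 2 ∈ Subgroup.center U2)
    (hl : l ^ 2 ∈ Subgroup.center U2) (hkl : (k * l) ^ 2 ∈ Subgroup.center U2) :
    SignComm k l := by
  obtain ⟨a, ha⟩ := mem_center_iff.mp hk
  obtain ⟨b, hb⟩ := mem_center_iff.mp hl
  obtain ⟨c, hc⟩ := mem_center_iff.mp hkl
  rw [pow_two, coe_mul] at ha hb hc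
  refine comm_or_anticomm (fun h0 => ?_) (fun h0 => ?_) ha hb hc
  · exact coe_ne_zero (k * k) (by rw [coe_mul, ha, h0, zero_smul])
  · exact coe_ne_zero (l * l) (by rw [coe_mul, hb, h0, zero_smul])

theorem gatePhi_pow_five_mem : gatePhi ^ 5 ∈ Subgroup.center U2 := by
  refine mem_center_iff.mpr ⟨-1, ?_⟩
  have h := icosa_pow_five goldenRatio_sq'
  rw [← coe_gatePhi] at h
  rw [neg_one_smul, ← h]
  rfl

theorem gatePhi_sq_notMem : gatePhi ^ 2 ∉ Subgroup.center U2 := by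
  intro h
  obtain ⟨c, hc⟩ := mem_center_iff.mp h
  rw [pow_two, coe_mul, coe_gatePhi, icosa_sq goldenRatio_sq'] at hc
  have := congrFun (congrFun hc 0) 1
  simp [icosa] at this
  have h5 : 1 + √(5 : ℝ) = 0 := by exact_mod_cast this
  linarith [Real.sqrt_nonneg 5]

/-- The symmetric group on three letters has no element of order five. -/
theorem perm_fin_three : ∀ σ : Fin 3 → Fin 3, (∀ i, σ (σ (σ (σ (σ i)))) = i) → ∀ i, σ i = i := by
  decide

theorem klein_distinct {k l : U2} (hk : k ∉ Subgroup.center U2) (hl : l ∉ Subgroup.center U2)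
    (hk2 : k ^ 2 ∈ Subgroup.center U2)
    (hkl : k * l ∉ Subgroup.center U2) :
    Function.Injective fun i : Fin 3 =>
      (QuotientGroup.mk (![k, l, k * l] i) : U2 ⧸ Subgroup.center U2) := by
  have h01 : k⁻¹ * l ∉ Subgroup.center U2 := fun h => hkl (by
    have := mul_mem hk2 h
    rwa [pow_two, mul_assoc, mul_inv_cancel_left] at this)
  have h02 : k⁻¹ * (k * l) ∉ Subgroup.center U2 := by rwa [inv_mul_cancel_left]
  have h12 : l⁻¹ * (k * l) ∉ Subgroup.center U2 := fun h => hk (by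
    have := Subgroup.Normal.conj_mem inferInstance _ h l
    simpa [mul_assoc] using this)
  have sym : ∀ a b : U2, a⁻¹ * b ∉ Subgroup.center U2 → b⁻¹ * a ∉ Subgroup.center U2 :=
    fun a b h h' => h (by simpa using inv_mem h')
  have e01 := sym _ _ h01
  have e02 := sym _ _ h02
  have e12 := sym _ _ h12
  intro i j hij
  rw [QuotientGroup.eq] at hij
  fin_cases i <;> fin_cases j <;> first | rfl | (exfalso; revert hij; assumption)

/-- The stabilizer of an encoding into symmetric states of at most eight qubits is scalar, when the
logical gates `X`, `Z`, `F` and `Φ` have physical implementations. -/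
theorem kernel_le_center {m : ℕ} (hm : m < 9) {V : Fin 2 → Tensor m} (hV : Indep V)
    (hs : ∀ j, IsSymm (V j)) {x z f s : U2} (hx : (x, gateX) ∈ gatePairs V)
    (hz : (z, gateZ) ∈ gatePairs V) (hf : (f, gateF) ∈ gatePairs V)
    (hΦ : (s, gatePhi) ∈ gatePairs V) {k : U2} (hk : (k, 1) ∈ gatePairs V) :
    k ∈ Subgroup.center U2 := by
  have conj : ∀ {a p g : U2}, (a, 1) ∈ gatePairs V → (p, g) ∈ gatePairs V →
      (p * a * p⁻¹, 1) ∈ gatePairs V := fun ha hp => by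
    simpa using mul_mem (mul_mem hp ha) (inv_mem hp)
  have hp : ∀ p ∈ ({x, z, f} : Set U2), ∃ g, (p, g) ∈ gatePairs V := by
    rintro p (rfl | rfl | rfl)
    exacts [⟨_, hx⟩, ⟨_, hz⟩, ⟨_, hf⟩]
  -- Otherwise the commutators of x and z with f would commute, although they implement Z⁻¹ and
  -- ZX⁻¹, which do not.
  have step : ∀ a : U2, a ∉ Subgroup.center U2 →
      ∃ p ∈ ({x, z, f} : Set U2), a * (p * a * p⁻¹) ≠ p * a * p⁻¹ * a := by
    intro a ha
    by_contra! H
    have hcomm := mul_comm_of_conj_comm ha H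
    have h1 := mul_mem (mul_mem (mul_mem hx hf) (inv_mem hx)) (inv_mem hf)
    have h2 := mul_mem (mul_mem (mul_mem hz hf) (inv_mem hz)) (inv_mem hf)
    simp only [Prod.inv_mk, Prod.mk_mul_mk, gateX_comm_gateF, gateZ_comm_gateF] at h1 h2
    obtain ⟨b, hb0, hb⟩ := h1
    obtain ⟨c, hc0, hc⟩ := h2
    have e1 := hb.mul hc
    have e2 := hc.mul hb
    simp only [← coe_mul] at e1 e2
    rw [hcomm] at e1
    have e3 := e1.unique hV e2
    simp only [smul_mul_smul_comm, mul_comm c b, ← coe_mul] at e3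
    have e4 := smul_right_injective _ (mul_ne_zero hb0 hc0) e3
    have e5 : gateZ⁻¹ * (gateZ * gateX⁻¹) = gateZ * gateX⁻¹ * gateZ⁻¹ := Subtype.ext e4
    apply gateX_mul_gateZ_ne
    rw [inv_mul_cancel_left, eq_mul_inv_iff_mul_eq, inv_mul_eq_iff_eq_mul, ← mul_assoc,
      eq_mul_inv_iff_mul_eq] at e5
    exact e5.symm
  -- If a² were not scalar, neither would be the square of any conjugate of a, and `kernel_comm`
  -- would make a commute with the conjugate provided by `step`.
  have hsq : ∀ a : U2, (a, 1) ∈ gatePairs V → a ^ 2 ∈ Subgroup.center U2 := by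
    intro a ha
    by_contra ha2
    obtain ⟨p, hpm, hne⟩ := step a fun h => ha2 (pow_mem h 2)
    obtain ⟨g, hg⟩ := hp p hpm
    refine hne (kernel_comm hm hV hs ha (conj ha hg) ha2 fun h => ha2 ?_)
    have := Subgroup.Normal.conj_mem inferInstance _ h p⁻¹
    rwa [conj_pow, inv_inv, ← mul_assoc, ← mul_assoc, inv_mul_cancel, one_mul,
      inv_mul_cancel_right] at this
  have hsc : ∀ a b : U2, (a, 1) ∈ gatePairs V → (b, 1) ∈ gatePairs V → SignComm a b :=
    fun a b ha hb => signComm_of_sq (hsq a ha) (hsq b hb)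
      (hsq _ (by simpa using mul_mem ha hb))
  by_contra hkc
  obtain ⟨p, hpm, hne⟩ := step k hkc
  obtain ⟨g, hg⟩ := hp p hpm
  obtain ⟨l, hl⟩ : ∃ l, l = p * k * p⁻¹ := ⟨_, rfl⟩
  have hlK : (l, 1) ∈ gatePairs V := hl ▸ conj hk hg
  rw [← hl] at hne
  have hanti : (k : Matrix (Fin 2) (Fin 2) ℂ) * l = -(l * k) :=
    (hsc k l hk hlK).resolve_left fun h => hne (Subtype.ext h)
  have hlc : l ∉ Subgroup.center U2 := fun h => hne (Subgroup.mem_center_iff.mp h k)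
  have hklK : (k * l, 1) ∈ gatePairs V := by simpa using mul_mem hk hlK
  have hklc : k * l ∉ Subgroup.center U2 := fun h => hne (by
    have := Subgroup.mem_center_iff.mp h k
    exact mul_left_cancel (a := k) (this.trans (mul_assoc _ _ _)))
  have hinj := klein_distinct hkc hlc (hsq k hk) hklc
  set q : Fin 3 → U2 := ![k, l, k * l] with hq
  have hqK : ∀ i, (q i, 1) ∈ gatePairs V := fun i => by
    fin_cases i
    exacts [hk, hlK, hklK]
  have hqc : ∀ i, q i ∉ Subgroup.center U2 := fun i => by
    fin_cases i
    exacts [hkc, hlc, hklc]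
  -- A nonscalar kernel thus consists, up to scalars, of the Klein four-group of 1, k, l and kl.
  have hqmem : ∀ a : U2, (a, 1) ∈ gatePairs V → a ∉ Subgroup.center U2 →
      ∃ i, (QuotientGroup.mk a : U2 ⧸ Subgroup.center U2) = QuotientGroup.mk (q i) := by
    intro a ha hac
    obtain ⟨r, hr, hrc⟩ := mem_klein hanti hne (hsc a k ha hk) (hsc a l ha hlK)
    have key : ∀ i, a * q i ∈ Subgroup.center U2 →
        (QuotientGroup.mk a : U2 ⧸ Subgroup.center U2) = QuotientGroup.mk (q i) := fun i hi => by
      rw [eq_comm, QuotientGroup.eq]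
      have h1 := mul_mem (inv_mem (hsq _ (hqK i))) (Subgroup.Normal.conj_mem inferInstance _ hi (q i))
      convert h1 using 1
      group
    rcases hr with rfl | rfl | rfl | rfl
    · exact absurd (by simpa using hrc) hac
    · exact ⟨0, key 0 hrc⟩
    · exact ⟨1, key 1 hrc⟩
    · exact ⟨2, key 2 hrc⟩
  -- Conjugation by s, which implements Φ, permutes the three nontrivial classes. As Φ⁵ is scalar,
  -- s⁵ lies in the kernel and fixes them all, so the permutation has fifth power 1 and is trivial.
  have hσ : ∀ i, ∃ j, (QuotientGroup.mk (s * q i) : U2 ⧸ Subgroup.center U2)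
      = QuotientGroup.mk (q j * s) := fun i => by
    obtain ⟨j, hj⟩ := hqmem _ (conj (hqK i) hΦ) fun h => hqc i (by
      have := Subgroup.Normal.conj_mem inferInstance _ h s⁻¹
      simpa [mul_assoc] using this)
    refine ⟨j, ?_⟩
    rw [QuotientGroup.mk_mul, QuotientGroup.mk_mul, ← hj, ← QuotientGroup.mk_mul,
      ← QuotientGroup.mk_mul, inv_mul_cancel_right]
  choose σ hσ using hσ
  have h5 : (s ^ 5, 1) ∈ gatePairs V := kernel_iff (pow_mem hΦ 5) gatePhi_pow_five_mem
  have hσ5 : ∀ i, σ (σ (σ (σ (σ i)))) = i := by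
    intro i
    refine hinj ?_
    have e1 := (hsc (s ^ 5) (q i) h5 (hqK i)).mk_comm
    simp only [QuotientGroup.mk_mul, QuotientGroup.mk_pow] at e1 hσ ⊢
    generalize (QuotientGroup.mk s : U2 ⧸ Subgroup.center U2) = S at *
    have e2 : ∀ n i, S ^ n * QuotientGroup.mk (q i) = QuotientGroup.mk (q (σ^[n] i)) * S ^ n := by
      intro n
      induction n with
      | zero => intro i; simp
      | succ n ih =>
        intro i
        rw [pow_succ, mul_assoc, hσ, ← mul_assoc, ih, Function.iterate_succ_apply, mul_assoc]
    exact (mul_right_cancel (e1.symm.trans (e2 5 i))).symm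
  have hid := perm_fin_three σ hσ5
  have hsk : ∀ i, SignComm s (q i) := fun i =>
    signComm_of_mk (hsq _ (hqK i)) (by rw [hσ i, hid i])
  obtain ⟨r, hr, hrc⟩ := mem_klein hanti hne (hsk 0) (hsk 1)
  have hrK : (r, 1) ∈ gatePairs V := by
    rcases hr with rfl | rfl | rfl | rfl
    exacts [one_mem _, hk, hlK, hklK]
  -- Now s commutes up to sign with k and l, so it lies in the Klein four-group up to a scalar; its
  -- square is scalar, and then Φ² would be too.
  have hs2 : s ^ 2 ∈ Subgroup.center U2 := by
    have h1 : s ^ 2 = (s * r) * (r⁻¹ * (s * r) * r⁻¹⁻¹) * (r ^ 2)⁻¹ := by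
      simp [pow_two, mul_assoc]
    rw [h1]
    exact mul_mem (mul_mem hrc (Subgroup.Normal.conj_mem inferInstance _ hrc r⁻¹))
      (inv_mem (hsq _ hrK))
  exact gatePhi_sq_notMem (center_of_center hV (pow_mem hΦ 2) hs2)

/-! ### Reduction to symmetric tensors. -/

theorem isSymm_of_subsingleton {n : ℕ} [Subsingleton (Fin n)] (T : Tensor n) : IsSymm T :=
  fun σ => by rw [Subsingleton.elim σ 1]; rfl

theorem Intertwines.perm {n : ℕ} {V : Fin 2 → Tensor n} {h g : Matrix (Fin 2) (Fin 2) ℂ}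
    (H : Intertwines V h g) (σ : Equiv.Perm (Fin n)) : Intertwines (fun j => perm σ (V j)) h g := by
  intro j
  simp only [actPow_perm, H j, map_sum, map_smul]

theorem Intertwines.contr {n : ℕ} {V : Fin 2 → Tensor (n + 2)} {h g : Matrix (Fin 2) (Fin 2) ℂ}
    (H : Intertwines V h g) (hd : h.det ≠ 0) :
    Intertwines (fun j => contr (V j)) h (h.det⁻¹ • g) := by
  intro j
  have h1 := congrArg QubitCode.contr (H j)
  rw [contr_actPow] at h1
  rw [← inv_smul_smul₀ hd (actPow h (QubitCode.contr (V j))), h1]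
  simp only [map_sum, map_smul, Finset.smul_sum, Matrix.smul_apply, smul_eq_mul, smul_smul]

/-- Every encoding has a nonzero equivariant image among encodings into symmetric states. -/
theorem exists_symm_reduction : ∀ (n : ℕ) (V : Fin 2 → Tensor n), V ≠ 0 →
    ∃ m ≤ n, ∃ W : Fin 2 → Tensor m, W ≠ 0 ∧ (∀ j, IsSymm (W j)) ∧ gatePairs V ≤ gatePairs W
  | 0, V, hV => ⟨0, le_rfl, V, hV, fun _ => isSymm_of_subsingleton _, le_rfl⟩
  | 1, V, hV => ⟨1, le_rfl, V, hV, fun _ => isSymm_of_subsingleton _, le_rfl⟩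
  | n + 2, V, hV => by
    -- Either both tensors are symmetric already, or some contraction is a nonzero equivariant image
    -- on two qubits fewer. The determinant it picks up is absorbed by the scalar allowed in
    -- `gatePairs`.
    by_cases h : ∀ j, ∀ σ, contr (perm σ (V j)) = 0
    · exact ⟨n + 2, le_rfl, V, hV, fun j => isSymm_of_contr (h j), le_rfl⟩
    · push Not at h
      obtain ⟨j, σ, hj⟩ := h
      obtain ⟨m, hm, W, hW, hs, hle⟩ := exists_symm_reduction n
        (fun j => contr (perm σ (V j))) fun h0 => hj (congrFun h0 j)
      refine ⟨m, by omega, W, hW, hs, le_trans ?_ hle⟩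
      rintro ⟨h, g⟩ ⟨c, hc, H⟩
      refine ⟨(h : Matrix (Fin 2) (Fin 2) ℂ).det⁻¹ * c,
        mul_ne_zero (inv_ne_zero (det_ne_zero h)) hc, ?_⟩
      rw [mul_smul]
      exact (H.perm σ).contr (det_ne_zero h)

/-- The linear relations between the columns form a subspace of ℂ² stable under the logical X and Z,
which act irreducibly. -/
theorem indep_of_ne_zero {n : ℕ} {V : Fin 2 → Tensor n} (hV : V ≠ 0) {x z : U2}
    (hx : (x, gateX) ∈ gatePairs V) (hz : (z, gateZ) ∈ gatePairs V) : Indep V := by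
  have step : ∀ {h g : U2}, (h, g) ∈ gatePairs V → ∀ a b : ℂ, a • V 0 + b • V 1 = 0 →
      (g.1 0 0 * a + g.1 0 1 * b) • V 0 + (g.1 1 0 * a + g.1 1 1 * b) • V 1 = 0 := by
    rintro h g ⟨c, hc, H⟩ a b hab
    have h1 := congrArg (actPow (h : Matrix (Fin 2) (Fin 2) ℂ)) hab
    rw [map_add, map_smul, map_smul, H 0, H 1, map_zero] at h1
    refine (smul_eq_zero.mp (?_ : c • ((g.1 0 0 * a + g.1 0 1 * b) • V 0 +
      (g.1 1 0 * a + g.1 1 1 * b) • V 1) = 0)).resolve_left hc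
    rw [← h1]
    simp only [Fin.sum_univ_two, Matrix.smul_apply, smul_eq_mul]
    module
  have key : ∀ a b : ℂ, a • V 0 + b • V 1 = 0 → a • V 0 = 0 ∧ b • V 1 = 0 := by
    intro a b hab
    have h1 := step hz a b hab
    simp [gateZ] at h1
    have h2 : (-2 * I) • (a • V 0) = 0 := by
      have : (-2 * I) • (a • V 0) = ((-(I * a)) • V 0 + (I * b) • V 1) - I • (a • V 0 + b • V 1) := by
        module
      rw [this, hab, neg_smul, h1, smul_zero, sub_zero]
    have h3 := (smul_eq_zero.mp h2).resolve_left (by simp)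
    exact ⟨h3, by rwa [h3, zero_add] at hab⟩
  intro a b hab
  obtain ⟨h0, h1⟩ := key a b hab
  have h2 := step hx a b hab
  simp [gateX] at h2
  obtain ⟨h3, h4⟩ := key (-(I * b)) (-(I * a)) (by simpa using h2)
  have hV' : V 0 ≠ 0 ∨ V 1 ≠ 0 := by
    by_contra! h
    exact hV (funext fun j => by fin_cases j; exacts [h.1, h.2])
  rcases hV' with hne | hne
  · exact ⟨(smul_eq_zero.mp h0).resolve_right hne,
      by simpa using (smul_eq_zero.mp h3).resolve_right hne⟩
  · exact ⟨by simpa using (smul_eq_zero.mp h4).resolve_right hne,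
      (smul_eq_zero.mp h1).resolve_right hne⟩

/-- Physical gates are scalar exactly when their logical gates are. -/
theorem center_iff_of_gatePairs {n : ℕ} (hn : n < 9) {V : Fin 2 → Tensor n} (hV : V ≠ 0)
    {x z f s : U2} (hx : (x, gateX) ∈ gatePairs V) (hz : (z, gateZ) ∈ gatePairs V)
    (hf : (f, gateF) ∈ gatePairs V) (hΦ : (s, gatePhi) ∈ gatePairs V) {h g : U2}
    (hg : (h, g) ∈ gatePairs V) : h ∈ Subgroup.center U2 ↔ g ∈ Subgroup.center U2 := by
  refine ⟨center_of_center (indep_of_ne_zero hV hx hz) hg, fun hc => ?_⟩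
  -- The reduction only enlarges the group of matching pairs, so it suffices to bound the kernel on
  -- symmetric tensors.
  obtain ⟨m, hm, W, hW, hs, hle⟩ := exists_symm_reduction n V hV
  exact kernel_le_center (by omega) (indep_of_ne_zero hW (hle hx) (hle hz)) hs (hle hx) (hle hz)
    (hle hf) (hle hΦ) (hle (kernel_iff hg hc))

/-! ### Conjugating X, Z and F into standard position. -/

theorem isCenter_sq_gateX : gateX * gateX ∈ Subgroup.center U2 := by
  refine mem_center_iff.mpr ⟨-1, ?_⟩
  ext i j
  fin_cases i <;> fin_cases j <;> simp [gateX]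

theorem isCenter_sq_gateZ : gateZ * gateZ ∈ Subgroup.center U2 := by
  refine mem_center_iff.mpr ⟨-1, ?_⟩
  ext i j
  fin_cases i <;> fin_cases j <;> simp [gateZ]

theorem gateX_mul_gateZ : (gateX : Matrix (Fin 2) (Fin 2) ℂ) * gateZ =
    (!![0, 1; -1, 0] : Matrix (Fin 2) (Fin 2) ℂ) := by
  ext i j
  fin_cases i <;> fin_cases j <;> simp [gateX, gateZ]

theorem gateX_anticomm_gateZ : (gateX : Matrix (Fin 2) (Fin 2) ℂ) * gateZ = -(gateZ * gateX) := by
  ext i j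
  fin_cases i <;> fin_cases j <;> simp [gateX, gateZ]

theorem icosa_gateX {a : ℂ} (ha : a ^ 2 = a + 1) :
    icosa a * (gateX : Matrix (Fin 2) (Fin 2) ℂ) * icosa a = gateX := by
  ext i j
  fin_cases i <;> fin_cases j <;> simp [icosa, gateX]
  · ring
  · linear_combination (-I / 2) * ha + (I * (a - 1) ^ 2 / 4) * I_sq
  · linear_combination (-I / 2) * ha + (I * (a - 1) ^ 2 / 4) * I_sq
  · ring

theorem icosa_gateF {a : ℂ} (ha : a ^ 2 = a + 1) :
    icosa a * ((gateF : Matrix (Fin 2) (Fin 2) ℂ) * gateF) * icosa a = gateF := by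
  ext i j
  fin_cases i <;> fin_cases j <;> simp [icosa, gateF] <;> grind [I_sq]

theorem icosa_gateXZ {a : ℂ} (ha : a ^ 2 = a + 1) :
    icosa a * ((gateX : Matrix (Fin 2) (Fin 2) ℂ) * gateZ) *
      (icosa a * ((gateX : Matrix (Fin 2) (Fin 2) ℂ) * gateZ)) *
      (icosa a * ((gateX : Matrix (Fin 2) (Fin 2) ℂ) * gateZ)) = 1 := by
  rw [gateX_mul_gateZ]
  ext i j
  fin_cases i <;> fin_cases j <;> simp [icosa] <;> grind [I_sq]

/-- Two anticommuting unitaries with square `-1` are simultaneously conjugate to `X` and `Z`. -/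
theorem exists_frame {A B : Matrix (Fin 2) (Fin 2) ℂ} (hA : A ∈ unitaryGroup (Fin 2) ℂ)
    (hB : B ∈ unitaryGroup (Fin 2) ℂ) (hA2 : A * A = -1) (hB2 : B * B = -1)
    (hAB : A * B = -(B * A)) :
    ∃ u : U2, A * u = u * gateX ∧ B * (u : Matrix (Fin 2) (Fin 2) ℂ) = u * gateZ := by
  have hBI : B - I • 1 ≠ 0 := by
    intro h
    rw [sub_eq_zero] at h
    have h0 : (2 : ℂ) • (A * (I • (1 : Matrix (Fin 2) (Fin 2) ℂ))) = 0 := by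
      rw [h] at hAB
      rw [two_smul]
      nth_rewrite 1 [hAB]
      simp
    have h1 : A = 0 := by simpa using h0
    rw [h1] at hA2
    have := congrFun (congrFun hA2 0) 0
    simp at this
  -- Since (B + i)(B - i) = B² + 1 = 0, every vector in the image of B - i is an eigenvector for -i,
  -- the first diagonal entry of Z.
  obtain ⟨w, hw⟩ : ∃ w, (B - I • 1) *ᵥ w ≠ 0 := by
    by_contra! h
    exact hBI (Matrix.toLin'.injective (LinearMap.ext fun w => by
      rw [Matrix.toLin'_apply, h w]; simp))
  obtain ⟨v, hv⟩ : ∃ v, v = (B - I • 1) *ᵥ w := ⟨_, rfl⟩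
  rw [← hv] at hw
  have hBv : B *ᵥ v = (-I) • v := by
    rw [hv, Matrix.mulVec_mulVec, mul_sub, hB2, ← Matrix.smul_mulVec]
    congr 1
    rw [smul_sub, smul_smul]
    simp
    abel
  -- The second column is forced by the first column of Au = uX.
  let u : Matrix (Fin 2) (Fin 2) ℂ := Matrix.of fun i j => ![v i, I * (A *ᵥ v) i] j
  have hu0 : ∀ i, u i 0 = v i := fun i => rfl
  have hu1 : ∀ i, u i 1 = I * (A *ᵥ v) i := fun i => rfl
  have hcol : ∀ M : Matrix (Fin 2) (Fin 2) ℂ, ∀ i j, (M * u) i j = (M *ᵥ fun k => u k j) i :=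
    fun M i j => rfl
  have hc0 : (fun k => u k 0) = v := rfl
  have hc1 : (fun k => u k 1) = I • (A *ᵥ v) := rfl
  have hAAv : A *ᵥ (A *ᵥ v) = -v := by rw [Matrix.mulVec_mulVec, hA2, Matrix.neg_mulVec, Matrix.one_mulVec]
  have hBAv : B *ᵥ (A *ᵥ v) = I • (A *ᵥ v) := by
    have : B * A = -(A * B) := by rw [hAB, neg_neg]
    rw [Matrix.mulVec_mulVec, this, Matrix.neg_mulVec, ← Matrix.mulVec_mulVec, hBv,
      Matrix.mulVec_smul, neg_smul, neg_neg]
  have hAu : A * u = u * gateX := by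
    ext i j
    rw [hcol, Matrix.mul_apply, Fin.sum_univ_two, hu0, hu1]
    fin_cases j
    · simp only [Fin.zero_eta, hc0]
      generalize A *ᵥ v = t
      simp [gateX]
      linear_combination t i * I_sq
    · simp only [Fin.mk_one, hc1]
      rw [Matrix.mulVec_smul, hAAv]
      simp [gateX]
      ring
  have hBu : B * u = u * gateZ := by
    ext i j
    rw [hcol, Matrix.mul_apply, Fin.sum_univ_two, hu0, hu1]
    fin_cases j
    · simp only [Fin.zero_eta, hc0, hBv]
      simp [gateZ]
      ring
    · simp only [Fin.mk_one, hc1]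
      rw [Matrix.mulVec_smul, hBAv]
      generalize A *ᵥ v = t
      simp [gateZ]
      ring
  have adj : ∀ {M : Matrix (Fin 2) (Fin 2) ℂ} {G : U2}, M ∈ unitaryGroup (Fin 2) ℂ →
      M * u = u * G → star u * u * G = G * (star u * u) := by
    intro M G hM h
    have h1 : star u * M = G * star u := by
      have h2 := congrArg star h
      rw [star_mul, star_mul] at h2
      have h3 : (G : Matrix (Fin 2) (Fin 2) ℂ) * (star (G : Matrix (Fin 2) (Fin 2) ℂ)) = 1 :=
        Matrix.mem_unitaryGroup_iff.mp G.2
      have h4 : star M * M = 1 := Matrix.mem_unitaryGroup_iff'.mp hM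
      calc star u * M = G * (star (G : Matrix (Fin 2) (Fin 2) ℂ) * star u) * M := by
            rw [← mul_assoc, h3, one_mul]
        _ = G * star u := by rw [← h2, mul_assoc, mul_assoc, h4, mul_one]
    rw [mul_assoc, ← h, ← mul_assoc, h1, mul_assoc]
  -- Unitarity of A and B makes u*u commute with X and Z, so it is a scalar, positive because v ≠ 0.
  -- Dividing u by its square root gives a unitary.
  obtain ⟨c, hc⟩ := scalar_of_comm_pair (k := gateX) (l := gateZ)
    (by rintro ⟨c, hc⟩
        have := congrFun (congrFun hc 0) 1
        simp [gateX] at this)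
    (fun h => gateX_mul_gateZ_ne (Subtype.ext h)) (adj hA hAu) (adj hB hBu)
  obtain ⟨r, hr, hcr⟩ : ∃ r : ℝ, 0 < r ∧ c = r := by
    refine ⟨‖v 0‖ ^ 2 + ‖v 1‖ ^ 2, ?_, ?_⟩
    · by_contra h
      have h0 : ‖v 0‖ = 0 := by nlinarith [sq_nonneg ‖v 0‖, sq_nonneg ‖v 1‖]
      have h1 : ‖v 1‖ = 0 := by nlinarith [sq_nonneg ‖v 0‖, sq_nonneg ‖v 1‖]
      exact hw (funext fun i => by
        fin_cases i
        · simpa using h0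
        · simpa using h1)
    · have h1 := congrFun (congrFun hc 0) 0
      rw [Matrix.mul_apply, Fin.sum_univ_two] at h1
      simp only [Matrix.star_apply, hu0, Matrix.smul_apply, Matrix.one_apply_eq, smul_eq_mul,
        mul_one] at h1
      rw [← h1]
      push_cast
      rw [← Complex.conj_mul', ← Complex.conj_mul']
      rfl
  have hs : ((√r : ℝ) : ℂ) ≠ 0 := by exact_mod_cast (Real.sqrt_pos.mpr hr).ne'
  have hs2 : ((√r : ℝ) : ℂ) * ((√r : ℝ) : ℂ) = r := by exact_mod_cast Real.mul_self_sqrt hr.le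
  refine ⟨⟨((√r : ℝ) : ℂ)⁻¹ • u, ?_⟩, ?_, ?_⟩
  · rw [Matrix.mem_unitaryGroup_iff', star_smul, smul_mul_smul_comm, hc, hcr, smul_smul]
    have : star ((√r : ℝ) : ℂ)⁻¹ = ((√r : ℝ) : ℂ)⁻¹ := by simp
    rw [this, ← hs2, ← mul_inv, inv_mul_cancel₀ (mul_ne_zero hs hs), one_smul]
  · simp [hAu]
  · simp [hBu]

/-- The projection of `U(2)` onto the projective unitary group. -/
abbrev proj : U2 →* U2 ⧸ Subgroup.center U2 := QuotientGroup.mk' _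

theorem proj_eq_iff {a b : U2} : proj a = proj b ↔
    ∃ c : ℂ, (b : Matrix (Fin 2) (Fin 2) ℂ) = c • a := mk_eq_iff

theorem proj_eq_one_iff {a : U2} : proj a = 1 ↔ a ∈ Subgroup.center U2 :=
  QuotientGroup.eq_one_iff a

/-- If x² = c, take for l a square root of -c⁻¹; it has modulus one because c does. -/
theorem exists_smul_sq_eq {x : U2} (hx : x * x ∈ Subgroup.center U2) :
    ∃ l : ℂ, l ≠ 0 ∧ l • (x : Matrix (Fin 2) (Fin 2) ℂ) ∈ unitaryGroup (Fin 2) ℂ ∧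
      (l • (x : Matrix (Fin 2) (Fin 2) ℂ)) * (l • (x : Matrix (Fin 2) (Fin 2) ℂ)) = -1 := by
  obtain ⟨c, hc⟩ := mem_center_iff.mp hx
  rw [coe_mul] at hc
  have hnc : ‖c‖ ^ 2 = 1 := by
    have h := Matrix.mem_unitaryGroup_iff.mp (x * x).2
    rw [coe_mul, hc] at h
    have h0 := congrFun (congrFun h 0) 0
    simp at h0
    have h1 := Complex.mul_conj' c
    rw [mul_comm, h0] at h1
    exact_mod_cast h1.symm
  have hc0 : c ≠ 0 := by
    rintro rfl
    simp at hnc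
  obtain ⟨l, hl⟩ := IsAlgClosed.exists_pow_nat_eq (-c⁻¹) (n := 2) (by norm_num)
  have hnl : ‖l‖ ^ 2 = 1 := by
    have h1 : ‖c‖ = 1 := by nlinarith [norm_nonneg c]
    rw [← norm_pow, hl, norm_neg, norm_inv, h1, inv_one]
  refine ⟨l, ?_, ?_, ?_⟩
  · rintro rfl
    simp at hnl
  · rw [Matrix.mem_unitaryGroup_iff, star_smul, smul_mul_smul_comm, Matrix.mem_unitaryGroup_iff.mp x.2]
    have : l * star l = 1 := by
      have := Complex.mul_conj' l
      rw [← ofReal_pow, hnl] at this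
      simpa using this
    rw [this, one_smul]
  · rw [smul_mul_smul_comm, hc, smul_smul, ← pow_two, hl]
    simp [hc0]

/-- Distinct commuting projective involutions lift to anticommuting matrices: if the lifts commuted,
z would be a combination of 1 and x, and z² scalar would make it proportional to one of them. -/
theorem exists_conj_XZ {x z : U2} (hx : proj x * proj x = 1) (hz : proj z * proj z = 1)
    (hxz : proj x * proj z = proj z * proj x) (nx : proj x ≠ 1) (nz : proj z ≠ 1)
    (nxz : proj x ≠ proj z) :
    ∃ u : U2, proj (u⁻¹ * x * u) = proj gateX ∧ proj (u⁻¹ * z * u) = proj gateZ := by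
  rw [← map_mul, proj_eq_one_iff] at hx hz
  rw [Ne, proj_eq_one_iff, mem_center_iff] at nx nz
  have hsc : SignComm x z := signComm_of_mk (by rwa [pow_two]) hxz
  have hanti : (x : Matrix (Fin 2) (Fin 2) ℂ) * z = -(z * x) := by
    refine hsc.resolve_left fun h => ?_
    obtain ⟨a, b, hab⟩ := comm_span nx h
    obtain ⟨c, hc⟩ := mem_center_iff.mp hx
    obtain ⟨d, hd⟩ := mem_center_iff.mp hz
    rw [coe_mul] at hc hd
    have h2 : (2 * a * b) • (x : Matrix (Fin 2) (Fin 2) ℂ) = (d - a ^ 2 - b ^ 2 * c) • 1 := by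
      rw [hab] at hd
      simp only [add_mul, mul_add, smul_mul_smul_comm, one_mul, mul_one, hc, smul_smul] at hd
      rw [sub_smul, sub_smul, ← hd]
      module
    by_cases h0 : 2 * a * b = 0
    · simp only [mul_eq_zero, OfNat.ofNat_ne_zero, false_or] at h0
      rcases h0 with rfl | rfl
      · exact nxz (proj_eq_iff.mpr ⟨b, by rw [hab]; simp⟩)
      · exact nz ⟨a, by rw [hab]; simp⟩
    · exact nx ⟨(2 * a * b)⁻¹ * (d - a ^ 2 - b ^ 2 * c), by
        rw [mul_smul, ← h2, smul_smul, inv_mul_cancel₀ h0, one_smul]⟩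
  obtain ⟨l, hl0, hlu, hl⟩ := exists_smul_sq_eq hx
  obtain ⟨k, hk0, hku, hk⟩ := exists_smul_sq_eq hz
  obtain ⟨u, hu1, hu2⟩ := exists_frame hlu hku hl hk (by
    rw [smul_mul_smul_comm, smul_mul_smul_comm, hanti, mul_comm l, smul_neg])
  refine ⟨u, proj_eq_iff.mpr ⟨l, ?_⟩, proj_eq_iff.mpr ⟨k, ?_⟩⟩
  · rw [coe_mul, coe_mul, mul_assoc, ← mul_smul_comm, ← smul_mul_assoc, hu1, ← mul_assoc,
      coe_inv_mul, one_mul]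
  · rw [coe_mul, coe_mul, mul_assoc, ← mul_smul_comm, ← smul_mul_assoc, hu2, ← mul_assoc,
      coe_inv_mul, one_mul]

theorem proj_gateX_sq : proj gateX * proj gateX = 1 := by
  rw [← map_mul, proj_eq_one_iff]; exact isCenter_sq_gateX

theorem proj_gateZ_sq : proj gateZ * proj gateZ = 1 := by
  rw [← map_mul, proj_eq_one_iff]; exact isCenter_sq_gateZ

theorem proj_gateX_gateZ : proj gateX * proj gateZ = proj gateZ * proj gateX :=
  SignComm.mk_comm (Or.inr gateX_anticomm_gateZ)

theorem proj_gateF_gateX : proj gateF * proj gateX = proj gateZ * proj gateX * proj gateF := by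
  simp only [← map_mul, gateF_mul_gateX]

theorem proj_gateF_gateZ : proj gateF * proj gateZ = proj gateX * proj gateF := by
  simp only [← map_mul, gateF_mul_gateZ]

/-- f and F act alike on the Klein four-group of X and Z, so f = Fr⁻¹ projectively with r in that
group. F permutes its three involutions cyclically, so every such r is absorbed by conjugating with
some Pauli q: r = X, Z, XZ need q = Z, XZ, X. -/
theorem exists_conj_F {f : U2} (h1 : proj f * proj gateX = proj gateZ * proj gateX * proj f)
    (h2 : proj f * proj gateZ = proj gateX * proj f) :
    ∃ q : U2, proj (q⁻¹ * gateX * q) = proj gateX ∧ proj (q⁻¹ * gateZ * q) = proj gateZ ∧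
      proj (q⁻¹ * f * q) = proj gateF := by
  have hs1 : SignComm (gateF⁻¹ * f) gateX := signComm_of_mk (by
      rw [pow_two]; exact isCenter_sq_gateX) (by
    change proj _ = proj _
    simp only [map_mul, map_inv, mul_assoc]
    rw [h1, inv_mul_eq_iff_eq_mul, ← mul_assoc (proj gateF), proj_gateF_gateX]
    group)
  have hs2 : SignComm (gateF⁻¹ * f) gateZ := signComm_of_mk (by
      rw [pow_two]; exact isCenter_sq_gateZ) (by
    change proj _ = proj _
    simp only [map_mul, map_inv, mul_assoc]
    rw [h2, inv_mul_eq_iff_eq_mul, ← mul_assoc (proj gateF), proj_gateF_gateZ]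
    group)
  obtain ⟨r, hr, hrc⟩ := mem_klein gateX_anticomm_gateZ gateX_mul_gateZ_ne hs1 hs2
  rw [← proj_eq_one_iff] at hrc
  have hf : proj f = proj gateF * (proj r)⁻¹ := by
    rw [map_mul, map_mul, map_inv] at hrc
    rw [← mul_eq_one_iff_eq_inv.mp hrc, mul_inv_cancel_left]
  have X2 := proj_gateX_sq
  have Z2 := proj_gateZ_sq
  have ZX := proj_gateX_gateZ.symm
  have FX := proj_gateF_gateX
  have FZ := proj_gateF_gateZ
  have key : ∀ q : U2, proj q * proj gateX = proj gateX * proj q →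
      proj q * proj gateZ = proj gateZ * proj q → proj f * proj q = proj q * proj gateF →
      ∃ q : U2, proj (q⁻¹ * gateX * q) = proj gateX ∧ proj (q⁻¹ * gateZ * q) = proj gateZ ∧
      proj (q⁻¹ * f * q) = proj gateF := fun q h1 h2 h3 => by
    refine ⟨q, ?_⟩
    simp only [map_mul, map_inv, mul_assoc, ← h1, ← h2, h3, inv_mul_cancel_left, and_self]
  rcases hr with rfl | rfl | rfl | rfl
  · refine key 1 (by simp) (by simp) ?_
    rw [hf]
    simp
  · refine key gateZ ZX rfl ?_
    rw [hf]
    generalize proj gateX = X at *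
    generalize proj gateZ = Z at *
    generalize proj gateF = F at *
    rw [inv_eq_of_mul_eq_one_right X2, FX, mul_assoc, FZ, ← mul_assoc, mul_assoc Z X, X2, mul_one]
  · refine key (gateX * gateZ) (by rw [map_mul, mul_assoc, ZX]) (by
      rw [map_mul, ← mul_assoc, ZX]) ?_
    rw [hf, map_mul]
    generalize proj gateX = X at *
    generalize proj gateZ = Z at *
    generalize proj gateF = F at *
    rw [inv_eq_of_mul_eq_one_right Z2, ← ZX, mul_assoc, ← mul_assoc Z Z, Z2, one_mul, FX]
  · refine key gateX rfl ZX.symm ?_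
    rw [hf, map_mul]
    generalize proj gateX = X at *
    generalize proj gateZ = Z at *
    generalize proj gateF = F at *
    rw [_root_.mul_inv_rev, inv_eq_of_mul_eq_one_right X2, inv_eq_of_mul_eq_one_right Z2, mul_assoc,
      mul_assoc, X2, mul_one, FZ]

/-! ### Recovering Φ, up to Galois conjugation, from traces. -/

theorem mul_self_eq (A : Matrix (Fin 2) (Fin 2) ℂ) : A * A = A.trace • A - A.det • 1 := by
  ext i j
  fin_cases i <;> fin_cases j <;>
    simp [Matrix.mul_apply, Fin.sum_univ_two, Matrix.trace_fin_two, Matrix.det_fin_two] <;> ring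

theorem trace_eq_zero_of_sq {A : Matrix (Fin 2) (Fin 2) ℂ} (hA : ¬ ∃ c : ℂ, A = c • 1) {c : ℂ}
    (h : A * A = c • 1) : A.trace = 0 := by
  by_contra ht
  rw [mul_self_eq, sub_eq_iff_eq_add, ← add_smul] at h
  exact hA ⟨A.trace⁻¹ * (c + A.det), by rw [mul_smul, ← h, inv_smul_smul₀ ht]⟩

/-- By Cayley-Hamilton A³ is (tr² - det)A plus a scalar, and A is not scalar. -/
theorem trace_sq_of_cube {A : Matrix (Fin 2) (Fin 2) ℂ} (hA : ¬ ∃ c : ℂ, A = c • 1) {c : ℂ}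
    (h : A * A * A = c • 1) : A.trace ^ 2 = A.det := by
  by_contra ht
  rw [← sub_eq_zero] at ht
  have h2 : A * A * A = (A.trace ^ 2 - A.det) • A - (A.trace * A.det) • 1 := by
    rw [mul_self_eq, sub_mul, smul_mul_assoc, mul_self_eq, smul_mul_assoc, one_mul]
    module
  rw [h, eq_sub_iff_add_eq, ← add_smul] at h2
  exact hA ⟨(A.trace ^ 2 - A.det)⁻¹ * (c + A.trace * A.det), by
    rw [mul_smul, h2, inv_smul_smul₀ ht]⟩

theorem trace_smul_eq_zero {A : U2} {l : ℂ} (hl : l ≠ 0) (hA : proj A ≠ 1)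
    (h : proj A * proj A = 1) {B : Matrix (Fin 2) (Fin 2) ℂ} (hB : (A : Matrix (Fin 2) (Fin 2) ℂ) = l • B) :
    B.trace = 0 := by
  rw [← map_mul, proj_eq_one_iff, mem_center_iff] at h
  rw [Ne, proj_eq_one_iff, mem_center_iff] at hA
  obtain ⟨c, hc⟩ := h
  have ht := trace_eq_zero_of_sq hA hc
  rw [hB, Matrix.trace_smul, smul_eq_zero] at ht
  exact ht.resolve_left hl

/-- A gate that satisfies the projective relations of `Φ` with `X`, `Z` and `F` is `Φ` or its
Galois conjugate. -/
theorem exists_icosa {p : U2} (h1 : proj (p * gateX) * proj (p * gateX) = 1)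
    (n1 : proj (p * gateX) ≠ 1) (h2 : proj (p * gateF⁻¹) * proj (p * gateF⁻¹) = 1)
    (n2 : proj (p * gateF⁻¹) ≠ 1)
    (h3 : proj (p * (gateX * gateZ)) * proj (p * (gateX * gateZ)) * proj (p * (gateX * gateZ)) = 1)
    (n3 : proj (p * (gateX * gateZ)) ≠ 1) :
    ∃ a : ℝ, a ^ 2 = a + 1 ∧ ∃ c : ℂ, c ≠ 0 ∧ (p : Matrix (Fin 2) (Fin 2) ℂ) = c • icosa a := by
  obtain ⟨l, hl⟩ := IsAlgClosed.exists_pow_nat_eq (p : Matrix (Fin 2) (Fin 2) ℂ).det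
    (n := 2) (by norm_num)
  have hl0 : l ≠ 0 := by
    rintro rfl
    exact det_ne_zero p (by rw [← hl]; simp)
  have hnl : l * star l = 1 := by
    have hd : (p : Matrix (Fin 2) (Fin 2) ℂ).det * star (p : Matrix (Fin 2) (Fin 2) ℂ).det = 1 := by
      rw [← Matrix.det_conjTranspose, ← Matrix.det_mul, ← Matrix.star_eq_conjTranspose,
        Matrix.mem_unitaryGroup_iff.mp p.2, Matrix.det_one]
    rw [← hl] at hd
    have h4 : ‖l‖ ^ 4 = 1 := by
      have h5 := congrArg norm hd
      rw [norm_mul, norm_star, norm_pow, norm_one] at h5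
      rw [← h5]; ring
    have h6 : ‖l‖ ^ 2 = 1 := by nlinarith [sq_nonneg ‖l‖]
    have := Complex.mul_conj' l
    rw [← ofReal_pow, h6] at this
    simpa using this
  obtain ⟨N, hN⟩ : ∃ N : Matrix (Fin 2) (Fin 2) ℂ, (p : Matrix (Fin 2) (Fin 2) ℂ) = l • N :=
    ⟨l⁻¹ • p, by rw [smul_inv_smul₀ hl0]⟩
  have hdN : N.det = 1 := by
    rw [hN, Matrix.det_smul, Fintype.card_fin] at hl
    have := mul_left_cancel₀ (pow_ne_zero 2 hl0) ((mul_one _).trans hl)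
    exact this.symm
  have hNu : N * star N = 1 := by
    have h := Matrix.mem_unitaryGroup_iff.mp p.2
    rwa [hN, star_smul, smul_mul_smul_comm, hnl, one_smul] at h
  have hadj : star N = N.adjugate := by
    have h := Matrix.adjugate_mul N
    rw [hdN, one_smul] at h
    rw [← one_mul (star N), ← h, mul_assoc, hNu, mul_one]
  -- Each projective order becomes a trace condition on N: order two kills the traces of NX and NF*,
  -- and order three fixes the square of the trace of NXZ. With N in SU(2) these leave a sign and a
  -- quadratic equation.
  have t1 := trace_smul_eq_zero hl0 n1 h1 (B := N * gateX) (by rw [coe_mul, hN, smul_mul_assoc])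
  have t2 := trace_smul_eq_zero hl0 n2 h2 (B := N * star (gateF : Matrix (Fin 2) (Fin 2) ℂ))
    (by rw [coe_mul, hN, smul_mul_assoc]; rfl)
  have t3 : (N * (gateX * gateZ)).trace ^ 2 = 1 := by
    rw [← map_mul, ← map_mul, proj_eq_one_iff, mem_center_iff] at h3
    rw [Ne, proj_eq_one_iff, mem_center_iff] at n3
    obtain ⟨c, hc⟩ := h3
    have ht := trace_sq_of_cube n3 hc
    rw [coe_mul, coe_mul, hN, smul_mul_assoc, Matrix.trace_smul, Matrix.det_smul,
      Fintype.card_fin, smul_eq_mul, mul_pow, Matrix.det_mul, hdN, one_mul] at ht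
    have := mul_left_cancel₀ (pow_ne_zero 2 hl0) ht
    rw [this, gateX_mul_gateZ]
    simp [Matrix.det_fin_two]
  have s00 : (starRingEnd ℂ) (N 0 0) = N 1 1 := by
    have := congrFun (congrFun hadj 0) 0
    simpa [Matrix.adjugate_fin_two, Matrix.star_apply] using this
  rw [gateX_mul_gateZ] at t3
  simp [gateX, Matrix.trace_fin_two, Matrix.mul_apply, Fin.sum_univ_two] at t1
  simp [Matrix.trace_fin_two, Matrix.mul_apply, Fin.sum_univ_two] at t3
  simp [gateF, Matrix.trace_fin_two, Matrix.mul_apply, Fin.sum_univ_two, Matrix.star_apply] at t2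
  rw [Matrix.det_fin_two] at hdN
  have c2 : (starRingEnd ℂ) 2 = 2 := map_ofNat _ 2
  rw [c2] at t2
  have e10 : N 1 0 = -N 0 1 := mul_left_cancel₀ I_ne_zero (by linear_combination -t1)
  obtain ⟨e, he, e01⟩ : ∃ e : ℝ, e ^ 2 = 1 ∧ N 0 1 = (e : ℂ) / 2 := by
    rw [e10] at t3
    rcases t3 with h | h
    · exact ⟨-1, by norm_num, by push_cast; linear_combination -h / 2⟩
    · exact ⟨1, by norm_num, by push_cast; linear_combination -h / 2⟩
  obtain ⟨x, y, hxy⟩ : ∃ x y : ℝ, N 0 0 = x + y * I := ⟨_, _, (re_add_im (N 0 0)).symm⟩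
  have e11 : N 1 1 = x - y * I := by
    rw [← s00, hxy]
    simp
    ring
  have hsub : x - y = e / 2 := by
    rw [e10, e01, hxy, e11] at t2
    have h : ((x : ℂ) - y) - e / 2 = 0 := by
      refine (mul_eq_zero.mp (?_ : (1 + I) * (1 - I) / 2 * (((x : ℂ) - y) - e / 2) = 0)).resolve_left ?_
      · linear_combination t2 - (1 + I) / 2 * (y : ℂ) * I_sq
      · have : (1 + I) * (1 - I) / 2 = 1 := by linear_combination (-1 / 2 : ℂ) * I_sq
        rw [this]
        exact one_ne_zero
    exact_mod_cast sub_eq_zero.mp h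
  have hnorm : x ^ 2 + y ^ 2 + 1 / 4 = 1 := by
    have he' : (e : ℂ) ^ 2 = 1 := by exact_mod_cast he
    rw [e10, e01, hxy, e11] at hdN
    have h : ((x ^ 2 + y ^ 2 + 1 / 4 : ℝ) : ℂ) = 1 := by
      push_cast
      linear_combination hdN + (y : ℂ) ^ 2 * I_sq - he' / 4
    exact_mod_cast h
  -- N has first row (x + iy, e/2) with e = ±1 and y = x - e/2. The sign e goes into the scalar, and
  -- the condition x² + y² = 3/4 becomes the golden equation for a = 2ex.
  refine ⟨2 * e * x, ?_, l * e, mul_ne_zero hl0 ?_, ?_⟩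
  · have hy : y = x - e / 2 := by linarith
    rw [hy] at hnorm
    linear_combination 2 * hnorm + (4 * x ^ 2 - 1 / 2) * he
  · intro h0
    have : e = 0 := by exact_mod_cast h0
    rw [this] at he
    norm_num at he
  · have he' : (e : ℂ) ^ 2 = 1 := by exact_mod_cast he
    have hy : (y : ℂ) = x - e / 2 := by
      have : y = x - e / 2 := by linarith
      rw [this]; push_cast; rfl
    rw [hN, mul_smul]
    congr 1
    ext i j
    fin_cases i <;> fin_cases j <;> simp [icosa, e10, e01, hxy, e11, hy]
    · linear_combination (-x - x * I : ℂ) * he'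
    · ring
    · ring
    · linear_combination (-x + x * I : ℂ) * he'

/-! ### The icosahedral relations and their transfer between the two sides. -/

/-- The relations among the images of `X`, `Z`, `F` and `Φ` in the projective unitary group that
determine them up to conjugation and Galois conjugation. -/
structure IcosahedralRelations {G : Type*} [Group G] (x z f p : G) : Prop where
  xx : x * x = 1
  zz : z * z = 1
  xz : x * z = z * x
  x_ne : x ≠ 1
  z_ne : z ≠ 1
  x_ne_z : x ≠ z
  fx : f * x = z * x * f
  fz : f * z = x * f
  px : p * x * (p * x) = 1
  p_ne_x : p * x ≠ 1
  pf : p * f⁻¹ * (p * f⁻¹) = 1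
  p_ne_f : p * f⁻¹ ≠ 1
  pxz : p * (x * z) * (p * (x * z)) * (p * (x * z)) = 1
  p_ne_xz : p * (x * z) ≠ 1

theorem IcosahedralRelations.map {G : Type*} [Group G] {x z f p : G}
    (h : IcosahedralRelations x z f p) (φ : G ≃* G) :
    IcosahedralRelations (φ x) (φ z) (φ f) (φ p) := by
  constructor <;> simp only [← map_mul, ← map_inv, ne_eq, EmbeddingLike.map_eq_one_iff,
    EmbeddingLike.apply_eq_iff_eq]
  exacts [h.xx, h.zz, h.xz, h.x_ne, h.z_ne, h.x_ne_z, h.fx, h.fz, h.px, h.p_ne_x, h.pf, h.p_ne_f,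
    h.pxz, h.p_ne_xz]

theorem icosahedralRelations_gates :
    IcosahedralRelations (proj gateX) (proj gateZ) (proj gateF) (proj gatePhi) := by
  have hr := goldenRatio_sq'
  have h00 : icosa Real.goldenRatio 0 0 ≠ 0 := fun h => by
    have h1 := congrArg re h
    have h2 : icosa Real.goldenRatio 0 0 =
        ((Real.goldenRatio / 2 : ℝ) : ℂ) + ((Real.goldenRatio - 1) / 2 : ℝ) * I := by
      simp only [icosa, Matrix.smul_apply, Matrix.of_apply, Matrix.cons_val', Matrix.cons_val_zero,
        smul_eq_mul]
      push_cast
      ring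
    rw [h2, add_re, ofReal_re, re_ofReal_mul, I_re, mul_zero, add_zero, zero_re] at h1
    exact Real.goldenRatio_ne_zero (by linarith)
  have e1 : gatePhi * gateX * gatePhi = gateX := Subtype.ext (by
    rw [coe_mul, coe_mul, coe_gatePhi, icosa_gateX hr])
  have e2 : gatePhi * (gateF * gateF) * gatePhi = gateF := Subtype.ext (by
    rw [coe_mul, coe_mul, coe_mul, coe_gatePhi, icosa_gateF hr])
  have e3 : gatePhi * (gateX * gateZ) * (gatePhi * (gateX * gateZ)) * (gatePhi * (gateX * gateZ))
      = 1 := Subtype.ext (by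
    simp only [coe_mul]
    rw [coe_gatePhi, icosa_gateXZ hr]
    rfl)
  -- F³ = -1.
  have e4 : proj gateF * proj gateF = (proj gateF)⁻¹ := by
    rw [← mul_eq_one_iff_eq_inv, ← map_mul, ← map_mul, proj_eq_one_iff]
    refine mem_center_iff.mpr ⟨-1, ?_⟩
    ext i j
    fin_cases i <;> fin_cases j <;> simp [gateF] <;> grind [I_sq]
  refine ⟨proj_gateX_sq, proj_gateZ_sq, proj_gateX_gateZ, ?_, ?_, ?_, proj_gateF_gateX,
    proj_gateF_gateZ, ?_, ?_, ?_, ?_, ?_, ?_⟩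
  · rw [Ne, proj_eq_one_iff, mem_center_iff]
    rintro ⟨c, hc⟩
    have := congrFun (congrFun hc 0) 1
    simp [gateX] at this
  · rw [Ne, proj_eq_one_iff, mem_center_iff]
    rintro ⟨c, hc⟩
    have h0 := congrFun (congrFun hc 0) 0
    have h1 := congrFun (congrFun hc 1) 1
    simp [gateZ] at h0 h1
    rw [← h1] at h0
    exact I_ne_zero (by linear_combination (-1 / 2 : ℂ) * h0)
  · rw [Ne, proj_eq_iff]
    rintro ⟨c, hc⟩
    have := congrFun (congrFun hc 0) 0
    simp [gateX, gateZ] at this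
  · rw [← mul_assoc, ← map_mul, ← map_mul, e1, proj_gateX_sq]
  · rw [Ne, mul_eq_one_iff_eq_inv, inv_eq_of_mul_eq_one_right proj_gateX_sq, eq_comm, proj_eq_iff]
    rintro ⟨c, hc⟩
    have := congrFun (congrFun hc 0) 0
    rw [coe_gatePhi] at this
    exact h00 (by rw [this]; simp [gateX])
  · rw [← e4, ← mul_assoc, ← map_mul, ← map_mul, ← map_mul, e2, map_mul, e4, mul_inv_cancel]
  · rw [Ne, mul_inv_eq_one, proj_eq_iff]
    rintro ⟨c, hc⟩
    have h1 := congrFun (congrFun hc 0) 1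
    have h2 := congrFun (congrFun hc 1) 0
    rw [coe_gatePhi] at h1 h2
    simp [icosa, gateF] at h1 h2
    exact I_ne_zero (by linear_combination -h1 - h2 + I_sq / 2)
  · simp only [← map_mul, e3, map_one]
  · rw [Ne, mul_eq_one_iff_eq_inv, _root_.mul_inv_rev, inv_eq_of_mul_eq_one_right proj_gateX_sq,
      inv_eq_of_mul_eq_one_right proj_gateZ_sq, ← proj_gateX_gateZ, ← map_mul, eq_comm, proj_eq_iff]
    rintro ⟨c, hc⟩
    have := congrFun (congrFun hc 0) 0
    rw [coe_gatePhi, coe_mul, gateX_mul_gateZ] at this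
    exact h00 (by rw [this]; simp)

/-- Every clause states that some word in the gates is, or is not, central, and T matches central
elements with central elements. -/
theorem icosahedralRelations_transfer {T : Subgroup (U2 × U2)}
    (hT : ∀ h g, (h, g) ∈ T → (h ∈ Subgroup.center U2 ↔ g ∈ Subgroup.center U2))
    {x z f p x' z' f' p' : U2} (hx : (x, x') ∈ T) (hz : (z, z') ∈ T) (hf : (f, f') ∈ T)
    (hp : (p, p') ∈ T)
    (H : IcosahedralRelations (proj x') (proj z') (proj f') (proj p')) :
    IcosahedralRelations (proj x) (proj z) (proj f) (proj p) := by
  have key : ∀ {h g}, (h, g) ∈ T → (proj h = 1 ↔ proj g = 1) := fun hg => by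
    rw [proj_eq_one_iff, proj_eq_one_iff, hT _ _ hg]
  have mul' : ∀ {h g h' g'}, (h, g) ∈ T → (h', g') ∈ T → (h * h', g * g') ∈ T := mul_mem
  have inv' : ∀ {h g}, (h, g) ∈ T → (h⁻¹, g⁻¹) ∈ T := inv_mem
  have tr : ∀ {h g h' g'}, (h, g) ∈ T → (h', g') ∈ T → (proj h = proj h' ↔ proj g = proj g') := by
    intro h g h' g' h1 h2
    have : proj (h * h'⁻¹) = 1 ↔ proj (g * g'⁻¹) = 1 := key (mul' h1 (inv' h2))
    rwa [map_mul, map_mul, map_inv, map_inv, mul_inv_eq_one, mul_inv_eq_one] at this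
  have hxz := mul' hp (mul' hx hz)
  obtain ⟨h1, h2, h3, h4, h5, h6, h7, h8, h9, h10, h11, h12, h13, h14⟩ := H
  simp only [← map_mul, ← map_inv] at *
  exact ⟨(key (mul' hx hx)).2 h1, (key (mul' hz hz)).2 h2,
    (tr (mul' hx hz) (mul' hz hx)).2 h3, (key hx).not.2 h4, (key hz).not.2 h5,
    (tr hx hz).not.2 h6, (tr (mul' hf hx) (mul' (mul' hz hx) hf)).2 h7,
    (tr (mul' hf hz) (mul' hx hf)).2 h8, (key (mul' (mul' hp hx) (mul' hp hx))).2 h9,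
    (key (mul' hp hx)).not.2 h10,
    (key (mul' (mul' hp (inv' hf)) (mul' hp (inv' hf)))).2 h11,
    (key (mul' hp (inv' hf))).not.2 h12, (key (mul' (mul' hxz hxz) hxz)).2 h13,
    (key hxz).not.2 h14⟩

/-- Gates satisfying the icosahedral relations are conjugate to `X`, `Z`, `F` and either `Φ` or its
Galois conjugate, up to scalars. -/
theorem IcosahedralRelations.exists_frame {x z f p : U2}
    (H : IcosahedralRelations (proj x) (proj z) (proj f) (proj p)) :
    ∃ u : U2, proj (u⁻¹ * x * u) = proj gateX ∧ proj (u⁻¹ * z * u) = proj gateZ ∧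
      proj (u⁻¹ * f * u) = proj gateF ∧ ∃ a : ℝ, a ^ 2 = a + 1 ∧ ∃ c : ℂ, c ≠ 0 ∧
      ((u⁻¹ * p * u : U2) : Matrix (Fin 2) (Fin 2) ℂ) = c • icosa a := by
  obtain ⟨u, hu1, hu2⟩ := exists_conj_XZ H.xx H.zz H.xz H.x_ne H.z_ne H.x_ne_z
  have H1 := H.map (MulAut.conj (proj u)⁻¹)
  simp only [MulAut.conj_apply, inv_inv, ← map_mul, ← map_inv] at H1
  rw [hu1, hu2] at H1
  obtain ⟨q, hq1, hq2, hq3⟩ := exists_conj_F H1.fx H1.fz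
  have H2 := H1.map (MulAut.conj (proj q)⁻¹)
  simp only [MulAut.conj_apply, inv_inv, ← map_mul, ← map_inv] at H2
  rw [hq1, hq2, hq3] at H2
  obtain ⟨a, ha, c, hc, h⟩ := exists_icosa (p := q⁻¹ * (u⁻¹ * p * u) * q)
    (by simpa only [map_mul] using H2.px) (by simpa only [map_mul] using H2.p_ne_x)
    (by simpa only [map_mul, map_inv] using H2.pf) (by simpa only [map_mul, map_inv] using H2.p_ne_f)
    (by simpa only [map_mul] using H2.pxz) (by simpa only [map_mul] using H2.p_ne_xz)
  have assoc : ∀ t : U2, (u * q)⁻¹ * t * (u * q) = q⁻¹ * (u⁻¹ * t * u) * q := fun t => by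
    simp [mul_assoc]
  refine ⟨u * q, ?_, ?_, ?_, a, ha, c, hc, ?_⟩
  · rw [assoc, map_mul, map_mul, hu1, ← map_mul, ← map_mul, hq1]
  · rw [assoc, map_mul, map_mul, hu2, ← map_mul, ← map_mul, hq2]
  · rw [assoc, hq3]
  · rw [assoc, h]

/-! ### From projective to linear equivariance. -/

/-- The gates `X`, `Z`, `F` and `Φ_a` implement `X`, `Z`, `F` and `Φ_b`. -/
structure Equivariant {n : ℕ} (a b : ℂ) (V : Fin 2 → Tensor n) : Prop where
  x : Intertwines V gateX gateX
  z : Intertwines V gateZ gateZ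
  f : Intertwines V gateF gateF
  p : Intertwines V (icosa a) (icosa b)

/-- The scalars satisfy the exact relations of the gates: FX = ZXF and FZ = XF give cz = cx = 1,
then ΦXΦ = X and (ΦXZ)³ = 1 give cp² = cp³ = 1, and ΦF²Φ = F gives cf = 1. -/
theorem equivariant_of_smul {n : ℕ} {a b : ℂ} (ha : a ^ 2 = a + 1) (hb : b ^ 2 = b + 1)
    {V : Fin 2 → Tensor n} (hV : Indep V) {cx cz cf cp : ℂ} (hx0 : cx ≠ 0)
    (hf0 : cf ≠ 0)
    (hx : Intertwines V gateX (cx • (gateX : Matrix (Fin 2) (Fin 2) ℂ)))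
    (hz : Intertwines V gateZ (cz • (gateZ : Matrix (Fin 2) (Fin 2) ℂ)))
    (hf : Intertwines V gateF (cf • (gateF : Matrix (Fin 2) (Fin 2) ℂ)))
    (hp : Intertwines V (icosa a) (cp • icosa b)) : Odd n ∧ Equivariant a b V := by
  have key : ∀ {h M N : Matrix (Fin 2) (Fin 2) ℂ} {c d : ℂ}, Intertwines V h (c • M) →
      Intertwines V h (d • N) → M = N → M ≠ 0 → c = d := by
    intro h M N c d h1 h2 hMN hM
    subst hMN
    exact smul_left_injective _ hM (h1.unique hV h2)
  have fx : (gateF : Matrix (Fin 2) (Fin 2) ℂ) * gateX = gateZ * gateX * gateF :=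
    congrArg Subtype.val gateF_mul_gateX
  have fz : (gateF : Matrix (Fin 2) (Fin 2) ℂ) * gateZ = gateX * gateF :=
    congrArg Subtype.val gateF_mul_gateZ
  have h1 := hf.mul hx
  have h2 := (hz.mul hx).mul hf
  rw [fx] at h1
  simp only [smul_mul_smul_comm] at h1 h2
  have e1 := key h1 h2 fx (coe_ne_zero (gateF * gateX))
  have h3 := hf.mul hz
  have h4 := hx.mul hf
  rw [fz] at h3
  simp only [smul_mul_smul_comm] at h3 h4
  have e2 := key h3 h4 fz (coe_ne_zero (gateF * gateZ))
  have cz1 : cz = 1 := by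
    have : (cf * cx) * (cz - 1) = 0 := by linear_combination -e1
    exact sub_eq_zero.mp ((mul_eq_zero.mp this).resolve_left (mul_ne_zero hf0 hx0))
  have cx1 : cx = 1 := by
    rw [cz1] at e2
    have : cf * (cx - 1) = 0 := by linear_combination -e2
    exact sub_eq_zero.mp ((mul_eq_zero.mp this).resolve_left hf0)
  rw [cz1, one_smul] at hz
  rw [cx1, one_smul] at hx
  have h5 := (hp.mul hx).mul hp
  rw [icosa_gateX ha] at h5
  simp only [smul_mul_assoc, mul_smul_comm, smul_smul, icosa_gateX hb] at h5
  have e3 := key (d := 1) h5 (by rwa [one_smul]) rfl (coe_ne_zero gateX)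
  have h6 := hp.mul (hx.mul hz)
  have h7 := (h6.mul h6).mul h6
  rw [icosa_gateXZ ha] at h7
  simp only [smul_mul_assoc, mul_smul_comm, smul_smul, icosa_gateXZ hb] at h7
  have e4 := key (d := 1) h7 (by rw [one_smul]; exact Intertwines.one V) rfl one_ne_zero
  have cp1 : cp = 1 := by linear_combination e4 - cp * e3
  rw [cp1, one_smul] at hp
  have h8 := (hp.mul (hf.mul hf)).mul hp
  rw [icosa_gateF ha] at h8
  simp only [smul_mul_assoc, mul_smul_comm, smul_smul, icosa_gateF hb] at h8
  have e5 := key h8 hf rfl (coe_ne_zero gateF)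
  have cf1 : cf = 1 := mul_left_cancel₀ hf0 (by linear_combination e5)
  rw [cf1, one_smul] at hf
  refine ⟨?_, hx, hz, hf, hp⟩
  -- For even n the scalar -1 acts trivially, so the physical gate XZ = -ZX would implement both ZX
  -- and XZ.
  by_contra hn
  rw [Nat.not_odd_iff_even] at hn
  have h9 := (hz.mul hx).smul (-1)
  rw [hn.neg_one_pow, one_smul, neg_one_smul, ← gateX_anticomm_gateZ] at h9
  exact gateX_mul_gateZ_ne (Subtype.ext ((hx.mul hz).unique hV h9))

/-! ### Equivariant pairs of binary forms of degree one, three and five. -/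

theorem Intertwines.form_eq {n : ℕ} {V : Fin 2 → Tensor n} {h g : Matrix (Fin 2) (Fin 2) ℂ}
    (H : Intertwines V h g) (j : Fin 2) (v : Fin 2 → ℂ) :
    form (V j) (v ᵥ* h) = g 0 j * form (V 0) v + g 1 j * form (V 1) v := by
  rw [← form_actPow, H j, Fin.sum_univ_two, form_add, form_smul, form_smul]

theorem actPow_gateZ {n : ℕ} (T : Tensor n) (x : Fin n → Fin 2) :
    actPow (gateZ : Matrix (Fin 2) (Fin 2) ℂ) T x =
      (-I) ^ (n - hammingWeight x) * I ^ hammingWeight x * T x := by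
  rw [act_apply, Finset.sum_eq_single x]
  · have h : ∀ i, (gateZ : Matrix (Fin 2) (Fin 2) ℂ) (x i) (x i) = ![-I, I] (x i) := fun i => by
      generalize x i = k
      fin_cases k <;> simp [gateZ]
    simp only [h]
    rw [prod_apply_eq]
    simp
  · intro y _ hy
    obtain ⟨i, hi⟩ := Function.ne_iff.mp hy.symm
    rw [Finset.prod_eq_zero (Finset.mem_univ i), zero_mul]
    generalize x i = k at *
    generalize y i = l at *
    fin_cases k <;> fin_cases l <;> simp_all [gateZ]
  · simp

/-- The bitwise complement. -/
def flip {n : ℕ} (x : Fin n → Fin 2) : Fin n → Fin 2 := fun i => 1 - x i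

theorem hammingWeight_flip {n : ℕ} (x : Fin n → Fin 2) :
    hammingWeight (flip x) = n - hammingWeight x := by
  have h2 := Finset.card_filter_add_card_filter_not (s := (Finset.univ : Finset (Fin n)))
    (fun i => x i = 1)
  rw [Finset.card_univ, Fintype.card_fin] at h2
  have h3 : (Finset.univ.filter fun i => flip x i = 1) = Finset.univ.filter fun i => ¬ x i = 1 := by
    refine Finset.filter_congr fun i _ => ?_
    unfold flip
    generalize x i = k
    fin_cases k <;> simp
  rw [hammingWeight, hammingWeight, h3]
  omega

theorem actPow_gateX {n : ℕ} (T : Tensor n) (x : Fin n → Fin 2) :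
    actPow (gateX : Matrix (Fin 2) (Fin 2) ℂ) T x = (-I) ^ n * T (flip x) := by
  rw [act_apply, Finset.sum_eq_single (flip x)]
  · have h : ∀ i, (gateX : Matrix (Fin 2) (Fin 2) ℂ) (x i) (flip x i) = -I := fun i => by
      unfold flip
      generalize x i = k
      fin_cases k <;> simp [gateX]
    simp [h]
  · intro y _ hy
    obtain ⟨i, hi⟩ := Function.ne_iff.mp hy.symm
    rw [Finset.prod_eq_zero (Finset.mem_univ i), zero_mul]
    unfold flip at hi
    generalize x i = k at *
    generalize y i = l at *
    fin_cases k <;> fin_cases l <;> simp_all [gateX]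
  · simp

theorem Equivariant.apply_one {n : ℕ} {a b : ℂ} {V : Fin 2 → Tensor n} (H : Equivariant a b V)
    (x : Fin n → Fin 2) : V 1 x = I * (-I) ^ n * V 0 (flip x) := by
  have h := congrFun (H.x 0) x
  rw [actPow_gateX, Fin.sum_univ_two] at h
  simp [gateX] at h
  linear_combination -I * h + V 1 x * I_sq

/-- Z is diagonal, so for odd n this kills the amplitudes of `V 0` at all weights of one parity. -/
theorem Equivariant.apply_zero {n : ℕ} {a b : ℂ} {V : Fin 2 → Tensor n} (H : Equivariant a b V)
    (x : Fin n → Fin 2) :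
    ((-I) ^ (n - hammingWeight x) * I ^ hammingWeight x + I) * V 0 x = 0 := by
  have h := congrFun (H.z 0) x
  rw [actPow_gateZ, Fin.sum_univ_two] at h
  simp [gateZ] at h
  linear_combination h

theorem Equivariant.bits_one {n : ℕ} {a b : ℂ} {V : Fin 2 → Tensor n} (H : Equivariant a b V)
    (hs : ∀ j, IsSymm (V j)) {w : ℕ} (hw : w ≤ n) :
    V 1 (bits n w) = I * (-I) ^ n * V 0 (bits n (n - w)) := by
  rw [H.apply_one, (hs 0).apply_eq (flip _), hammingWeight_flip, hammingWeight_bits hw]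

theorem Equivariant.bits_zero {n : ℕ} {a b : ℂ} {V : Fin 2 → Tensor n} (H : Equivariant a b V)
    {w : ℕ} (hw : w ≤ n) : ((-I) ^ (n - w) * I ^ w + I) * V 0 (bits n w) = 0 := by
  have := H.apply_zero (bits n w)
  rwa [hammingWeight_bits hw] at this

theorem Equivariant.eq_zero {n : ℕ} {a b : ℂ} {V : Fin 2 → Tensor n} (H : Equivariant a b V)
    (hs : IsSymm (V 0)) (h : ∀ w ≤ n, V 0 (bits n w) = 0) : V = 0 := by
  have h0 : V 0 = 0 := by
    ext x
    rw [hs.apply_eq, h _ (hammingWeight_le x)]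
    rfl
  funext j
  fin_cases j
  · exact h0
  · ext x
    simp [H.apply_one x, h0]

theorem vecMul_gateF (s t : ℂ) : ![s, t] ᵥ* (gateF : Matrix (Fin 2) (Fin 2) ℂ) =
    ((1 - I) / 2) • ![s + t, -I * (s - t)] := by
  ext k
  fin_cases k <;> simp [gateF, Matrix.vecMul, dotProduct, Fin.sum_univ_two] <;> ring

theorem vecMul_icosa (a s t : ℂ) : ![s, t] ᵥ* icosa a =
    ![((a + I * (a - 1)) * s - t) / 2, (s + (a - I * (a - 1)) * t) / 2] := by
  ext k
  fin_cases k <;> simp [icosa, Matrix.vecMul, dotProduct, Fin.sum_univ_two] <;> ring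

/-- The prefactor (1 - i)/2 of F has square -i/2. In odd degree one copy of it remains and cancels
against the prefactor of the logical F. -/
theorem Equivariant.form_gateF {k : ℕ} {a b : ℂ} {V : Fin 2 → Tensor (2 * k + 1)}
    (H : Equivariant a b V) (s t : ℂ) : (-I / 2) ^ k * form (V 0) ![s + t, -I * (s - t)] =
      form (V 0) ![s, t] + form (V 1) ![s, t] := by
  have h := H.f.form_eq 0 ![s, t]
  rw [vecMul_gateF, form_smul_right] at h
  have hI : (1 - I) / 2 ≠ 0 := fun h => by simpa using congrArg re h
  have hq : ((1 - I) / 2) ^ 2 = -I / 2 := by linear_combination I_sq / 4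
  refine mul_left_cancel₀ hI ?_
  rw [← hq, ← pow_mul, ← mul_assoc, ← pow_succ', h]
  simp [gateF]
  ring

theorem Equivariant.form_icosa {n : ℕ} {a b : ℂ} {V : Fin 2 → Tensor n} (H : Equivariant a b V)
    (s t : ℂ) : form (V 0) ![((a + I * (a - 1)) * s - t) / 2, (s + (a - I * (a - 1)) * t) / 2] =
      (b + I * (b - 1)) / 2 * form (V 0) ![s, t] - form (V 1) ![s, t] / 2 := by
  have h := H.p.form_eq 0 ![s, t]
  rw [vecMul_icosa] at h
  rw [h]
  simp [icosa]
  ring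

theorem I_pow_three : I ^ 3 = -I := by rw [pow_succ, I_sq, neg_one_mul]

theorem I_pow_five : I ^ 5 = I := by rw [pow_succ, I_pow_four, one_mul]

theorem I_pow_six : I ^ 6 = -1 := by rw [pow_succ, I_pow_five, I_mul_I]

theorem I_pow_seven : I ^ 7 = -I := by rw [pow_succ, I_pow_six, neg_one_mul]

theorem neg_I_pow_three : (-I) ^ 3 = I := by rw [Odd.neg_pow (by decide), I_pow_three, neg_neg]

theorem neg_I_pow_four : (-I) ^ 4 = 1 := by rw [Even.neg_pow (by decide), I_pow_four]

theorem neg_I_pow_five : (-I) ^ 5 = -I := by rw [Odd.neg_pow (by decide), I_pow_five]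

theorem neg_I_pow_six : (-I) ^ 6 = -1 := by rw [Even.neg_pow (by decide), I_pow_six]

theorem neg_I_pow_seven : (-I) ^ 7 = I := by rw [Odd.neg_pow (by decide), I_pow_seven, neg_neg]

/-- On one qubit the encoding is a scalar, so comparing the upper left entries of Φ_a and Φ_b leaves
the factor a - b. -/
theorem Equivariant.eq_zero_one {a b : ℂ} (hab : a ≠ b)
    {V : Fin 2 → Tensor 1} (H : Equivariant a b V) (hs : ∀ j, IsSymm (V j)) : V = 0 := by
  have z1 := H.bits_zero (w := 1) (by norm_num)
  have r0 := H.bits_one hs (w := 0) (by norm_num)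
  have r1 := H.bits_one hs (w := 1) (by norm_num)
  have p0 := H.form_icosa 1 0
  simp only [(hs _).form_eq, Finset.sum_range_succ, Finset.range_zero, Finset.sum_empty] at p0
  simp at z1 r0 r1 p0
  rw [r0, z1] at p0
  have h : (a - b) * ((1 + I) * V 0 (bits 1 0)) = 0 := by linear_combination 2 * p0
  have hI : (1 + I) ≠ 0 := fun h => by simpa using congrArg re h
  have h0 : V 0 (bits 1 0) = 0 := (mul_eq_zero.mp
    ((mul_eq_zero.mp h).resolve_left (sub_ne_zero.mpr hab))).resolve_left hI
  refine H.eq_zero (hs 0) fun w hw => ?_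
  interval_cases w <;> assumption

/-- X, Z and F alone exclude degree three, so nothing is needed about a and b. -/
theorem Equivariant.eq_zero_three {a b : ℂ} {V : Fin 2 → Tensor 3} (H : Equivariant a b V)
    (hs : ∀ j, IsSymm (V j)) : V = 0 := by
  have z0 := H.bits_zero (w := 0) (by norm_num)
  have z2 := H.bits_zero (w := 2) (by norm_num)
  have r0 := H.bits_one hs (w := 0) (by norm_num)
  have r1 := H.bits_one hs (w := 1) (by norm_num)
  have r2 := H.bits_one hs (w := 2) (by norm_num)
  have r3 := H.bits_one hs (w := 3) (by norm_num)
  have f0 := H.form_gateF (k := 1) 1 0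
  have f1 := H.form_gateF (k := 1) 1 (-1)
  simp only [(hs _).form_eq, Finset.sum_range_succ, Finset.range_zero, Finset.sum_empty] at f0 f1
  have c31 : Nat.choose 3 1 = 3 := rfl
  simp [c31, neg_I_pow_three] at z0 z2 r0 r1 r2 r3 f0 f1
  rw [z0, z2, r0] at f0
  rw [z0, z2, r0, r1, r2, r3, z0, z2] at f1
  have h3 : V 0 (bits 3 3) = 0 := by grind [I_sq]
  have h1 : V 0 (bits 3 1) = 0 := by grind [I_sq]
  refine H.eq_zero (hs 0) fun w hw => ?_
  interval_cases w <;> assumption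

/-- X, Z and F leave one free amplitude. The equation for Φ at (1, 0) multiplies it by a factor from
which a cancels and which vanishes only for a nonreal b violating the golden equation. -/
theorem Equivariant.eq_zero_five {a b : ℂ} (ha : a ^ 2 = a + 1) (hb : b ^ 2 = b + 1)
    {V : Fin 2 → Tensor 5} (H : Equivariant a b V) (hs : ∀ j, IsSymm (V j)) : V = 0 := by
  have z1 := H.bits_zero (w := 1) (by norm_num)
  have z3 := H.bits_zero (w := 3) (by norm_num)
  have z5 := H.bits_zero (w := 5) (by norm_num)
  have r0 := H.bits_one hs (w := 0) (by norm_num)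
  have r1 := H.bits_one hs (w := 1) (by norm_num)
  have r2 := H.bits_one hs (w := 2) (by norm_num)
  have r3 := H.bits_one hs (w := 3) (by norm_num)
  have r4 := H.bits_one hs (w := 4) (by norm_num)
  have r5 := H.bits_one hs (w := 5) (by norm_num)
  have f0 := H.form_gateF (k := 2) 1 0
  have f1 := H.form_gateF (k := 2) 1 1
  have p0 := H.form_icosa 1 0
  simp only [(hs _).form_eq, Finset.sum_range_succ, Finset.range_zero, Finset.sum_empty] at f0 f1 p0
  have c51 : Nat.choose 5 1 = 5 := rfl
  have c52 : Nat.choose 5 2 = 10 := rfl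
  have c53 : Nat.choose 5 3 = 10 := rfl
  simp [c51, c52, c53, I_pow_five, neg_I_pow_three, neg_I_pow_four,
    neg_I_pow_five] at z1 z3 z5 r0 r1 r2 r3 r4 r5 f0 f1 p0
  rw [z1, z3, z5, r0, z5] at f0
  rw [r0, r1, r2, r3, r4, r5, z1, z3, z5] at f1
  rw [z1, z3, z5, r0, z5] at p0
  have h2 : V 0 (bits 5 2) = 0 := by
    linear_combination -1 / 40 * (f1 - 8 * V 0 (bits 5 0) * I_sq) + 1 / 5 * (f0 -
      (V 0 (bits 5 0) - 10 * V 0 (bits 5 2) + 5 * V 0 (bits 5 4)) / 4 * I_sq)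
  have h4 : V 0 (bits 5 4) = -V 0 (bits 5 0) := by
    linear_combination -1 / 10 * (f1 - 8 * V 0 (bits 5 0) * I_sq) - 2 * h2
  rw [h2, h4] at p0
  have q : ((a + I * (a - 1)) / 2) ^ 5 = (5 * a - 12 + I * (5 * a + 7)) / 32 := by
    have q2 : ((a + I * (a - 1)) / 2) ^ 2 = (2 * a - 1 + 2 * I) / 4 := by
      linear_combination I / 2 * ha + (a - 1) ^ 2 / 4 * I_sq
    have q4 : ((a + I * (a - 1)) / 2) ^ 4 = (1 + 4 * I * (2 * a - 1)) / 16 := by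
      rw [pow_mul _ 2 2, q2]
      linear_combination ha / 4 + I_sq / 4
    rw [pow_succ, q4]
    linear_combination (-8 + 8 * I) / 32 * ha + (8 * a ^ 2 - 12 * a + 4) / 32 * I_sq
  rw [q] at p0
  have e : (-3 + 3 * I - 4 * (b + I * (b - 1))) * V 0 (bits 5 0) = 0 := by
    linear_combination 8 * p0
  have h0 : V 0 (bits 5 0) = 0 := by
    refine (mul_eq_zero.mp e).resolve_left fun hc => ?_
    have hb' : b = 1 / 2 + 5 / 4 * I := by
      linear_combination -(1 - I) / 8 * hc + (-7 + 4 * b) / 8 * I_sq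
    rw [hb'] at hb
    have := congrArg re hb
    norm_num [pow_two] at this
  rw [h0, neg_zero] at h4
  refine H.eq_zero (hs 0) fun w hw => ?_
  interval_cases w <;> assumption

/-! ### Equivariant pairs of binary forms of degree seven. -/

/-- The amplitude of the seven-qubit code on bit strings of given Hamming weight. -/
def codeAmp (a : ℂ) : ℕ → ℂ
  | 1 => -3 * (2 * a - 1)
  | 3 => 3
  | 5 => 2 * a - 1
  | 7 => 15
  | _ => 0

/-- The unnormalized seven-qubit code. -/
def codeTensor (a : ℂ) : Fin 2 → Tensor 7 :=
  ![fun x => codeAmp a (hammingWeight x), fun x => -codeAmp a (7 - hammingWeight x)]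

theorem isSymm_codeTensor (a : ℂ) (j : Fin 2) : IsSymm (codeTensor a j) := by
  fin_cases j
  · exact isSymm_of_apply (t := codeAmp a) fun x => rfl
  · exact isSymm_of_apply (t := fun w => -codeAmp a (7 - w)) fun x => rfl

theorem icosa_apply_sq {a i : ℂ} (ha : a ^ 2 = a + 1) (hi : i ^ 2 = -1) :
    ((a + i * (a - 1)) / 2) ^ 2 = (2 * a - 1 + 2 * i) / 4 := by
  linear_combination i / 2 * ha + (a - 1) ^ 2 / 4 * hi

theorem icosa_apply_pow_four {a i : ℂ} (ha : a ^ 2 = a + 1) (hi : i ^ 2 = -1) :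
    ((a + i * (a - 1)) / 2) ^ 4 = (1 + 4 * i * (2 * a - 1)) / 16 := by
  rw [pow_mul _ 2 2, icosa_apply_sq ha hi]
  linear_combination ha / 4 + hi / 4

theorem icosa_apply_pow_six {a i : ℂ} (ha : a ^ 2 = a + 1) (hi : i ^ 2 = -1) :
    ((a + i * (a - 1)) / 2) ^ 6 = (-7 * (2 * a - 1) + 22 * i) / 64 := by
  rw [pow_mul _ 2 3, icosa_apply_sq ha hi]
  linear_combination (8 * a - 4 + 24 * i) / 64 * ha + (24 * a - 12 + 8 * i) / 64 * hi

/-- Z leaves four odd-weight amplitudes and F leaves two. The equation for Φ at (1, 0) ties these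
together, and the one at (0, 1) forces b to be the conjugate of a. -/
theorem Equivariant.symm_seven {a b : ℂ} (ha : a ^ 2 = a + 1)
    {V : Fin 2 → Tensor 7} (H : Equivariant a b V) (hs : ∀ j, IsSymm (V j)) :
    (V ≠ 0 → b = 1 - a) ∧ ∃ c : ℂ, V = c • codeTensor a := by
  have z0 := H.bits_zero (w := 0) (by norm_num)
  have z2 := H.bits_zero (w := 2) (by norm_num)
  have z4 := H.bits_zero (w := 4) (by norm_num)
  have z6 := H.bits_zero (w := 6) (by norm_num)
  have r0 := H.bits_one hs (w := 0) (by norm_num)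
  have r1 := H.bits_one hs (w := 1) (by norm_num)
  have r2 := H.bits_one hs (w := 2) (by norm_num)
  have r3 := H.bits_one hs (w := 3) (by norm_num)
  have r4 := H.bits_one hs (w := 4) (by norm_num)
  have r5 := H.bits_one hs (w := 5) (by norm_num)
  have r6 := H.bits_one hs (w := 6) (by norm_num)
  have r7 := H.bits_one hs (w := 7) (by norm_num)
  have f0 := H.form_gateF (k := 3) 1 0
  have f1 := H.form_gateF (k := 3) 1 (-1)
  have p0 := H.form_icosa 1 0
  have p1 := H.form_icosa 0 1
  simp only [(hs _).form_eq, Finset.sum_range_succ, Finset.range_zero, Finset.sum_empty]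
    at f0 f1 p0 p1
  have c71 : Nat.choose 7 1 = 7 := rfl
  have c72 : Nat.choose 7 2 = 21 := rfl
  have c73 : Nat.choose 7 3 = 35 := rfl
  have c74 : Nat.choose 7 4 = 35 := rfl
  have c75 : Nat.choose 7 5 = 21 := rfl
  simp [c71, c72, c73, c74, c75, I_pow_six, neg_I_pow_three, neg_I_pow_four,
    neg_I_pow_five, neg_I_pow_six, neg_I_pow_seven] at z0 z2 z4 z6 r0 r1 r2 r3 r4 r5 r6 r7 f0 f1 p0 p1
  rw [z0, z2, z4, z6, r0] at f0
  rw [z0, z2, z4, z6, r0, r1, r2, r3, r4, r5, r6, r7, z0, z2, z4, z6] at f1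
  rw [z0, z2, z4, z6, r0, icosa_apply_sq ha I_sq, icosa_apply_pow_four ha I_sq,
    icosa_apply_pow_six ha I_sq] at p0
  have hI : (-I) ^ 2 = -1 := by rw [neg_sq, I_sq]
  have q : (a - I * (a - 1)) / 2 = (a + -I * (a - 1)) / 2 := by ring
  rw [q, pow_succ ((a + -I * (a - 1)) / 2) 6, pow_succ ((a + -I * (a - 1)) / 2) 4,
    pow_succ ((a + -I * (a - 1)) / 2) 2, z0, z2, z4, z6, r7, z0, icosa_apply_sq ha hI,
    icosa_apply_pow_four ha hI, icosa_apply_pow_six ha hI] at p1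
  have hI10 : I ^ 10 = -1 := by rw [pow_mul I 2 5, I_sq]; norm_num
  have h15 : V 0 (bits 7 1) = -3 * V 0 (bits 7 5) := by
    linear_combination 4 / 7 * (f0 + (-7 * V 0 (bits 7 1) + 35 * V 0 (bits 7 3) -
      21 * V 0 (bits 7 5) + V 0 (bits 7 7)) / 8 * I_pow_four) +
      1 / 28 * (f1 - 16 * V 0 (bits 7 7) * hI10)
  have h73 : V 0 (bits 7 7) = 5 * V 0 (bits 7 3) := by
    linear_combination 4 / 7 * (f0 + (-7 * V 0 (bits 7 1) + 35 * V 0 (bits 7 3) -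
      21 * V 0 (bits 7 5) + V 0 (bits 7 7)) / 8 * I_pow_four) -
      1 / 28 * (f1 - 16 * V 0 (bits 7 7) * hI10)
  rw [h15, h73] at p0 p1
  have h53 : 3 * V 0 (bits 7 5) = (2 * a - 1) * V 0 (bits 7 3) := by
    have e : (2 * (2 * a - 1) - 5 * I) * (3 * V 0 (bits 7 5) - (2 * a - 1) * V 0 (bits 7 3)) = 0 := by
      linear_combination 32 / 7 * p0 - 8 * V 0 (bits 7 3) * ha
    -- Since (2a - 1)² = 5, multiplying by 2(2a - 1) + 5i gives 20 + 25 = 45.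
    have n : 2 * (2 * a - 1) - 5 * I ≠ 0 := fun h => by
      have : (45 : ℂ) = 0 := by
        linear_combination (2 * (2 * a - 1) + 5 * I) * h - 16 * ha + 25 * I_sq
      norm_num at this
    exact sub_eq_zero.mp ((mul_eq_zero.mp e).resolve_left n)
  have hb : (b - (1 - a)) * V 0 (bits 7 3) = 0 := by
    have : (1 + I) * ((b - (1 - a)) * V 0 (bits 7 3)) = 0 := by
      linear_combination -2 / 5 * (p1 + (a - I * (a - 1)) / 128 *
        (28 * I * (2 * a - 1) * h53 + 112 * I * V 0 (bits 7 3) * ha)) +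
        (a - 1) * V 0 (bits 7 3) * I_sq
    exact (mul_eq_zero.mp this).resolve_left fun h => by simpa using congrArg re h
  have hc : V = (V 0 (bits 7 3) / 3) • codeTensor a := by
    have h0 : V 0 = (V 0 (bits 7 3) / 3) • codeTensor a 0 := by
      ext x
      rw [(hs 0).apply_eq x, Pi.smul_apply, codeTensor]
      simp only [Matrix.cons_val_zero]
      have := hammingWeight_le x
      generalize hammingWeight x = w at *
      interval_cases w <;> simp only [codeAmp, smul_eq_mul]
      all_goals first
        | linear_combination z0 | linear_combination z2 | linear_combination z4
        | linear_combination z6 | linear_combination h15 - h53 | linear_combination h73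
        | linear_combination h53 / 3 | ring
    funext j
    fin_cases j
    · exact h0
    · ext x
      have e := H.apply_one x
      rw [neg_I_pow_seven, I_mul_I, h0] at e
      simp only [Fin.mk_one, Pi.smul_apply, smul_eq_mul, codeTensor, Matrix.cons_val_one,
        Matrix.cons_val_zero, hammingWeight_flip] at e ⊢
      linear_combination e
  refine ⟨fun hV => ?_, _, hc⟩
  refine sub_eq_zero.mp ((mul_eq_zero.mp hb).resolve_right fun h3 => hV ?_)
  rw [hc, h3, zero_div, zero_smul]

/-! ### Descent by contractions to arbitrary tensors. -/

theorem Equivariant.map {n m : ℕ} {a b : ℂ} {V : Fin 2 → Tensor n} (H : Equivariant a b V)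
    (f : Tensor n →ₗ[ℂ] Tensor m)
    (hf : ∀ h : Matrix (Fin 2) (Fin 2) ℂ, h.det = 1 → ∀ T, actPow h (f T) = f (actPow h T))
    (ha : a ^ 2 = a + 1) : Equivariant a b fun j => f (V j) := by
  have key : ∀ {h g : Matrix (Fin 2) (Fin 2) ℂ}, h.det = 1 → Intertwines V h g →
      Intertwines (fun j => f (V j)) h g := fun hd hI j => by
    simp only [hf _ hd, hI j, map_sum, map_smul]
  -- All four physical gates have determinant one, so equivariance under such matrices suffices;
  -- contractions have it without any scalar.
  refine ⟨key ?_ H.x, key ?_ H.z, key ?_ H.f, key ?_ H.p⟩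
  · simp [gateX, Matrix.det_fin_two]
  · simp [gateZ, Matrix.det_fin_two]
  · simp [gateF, Matrix.det_fin_two]
    linear_combination (I / 2 - 1) * I_sq
  · simp [icosa, Matrix.det_fin_two]
    linear_combination ha / 2 - (a - 1) ^ 2 / 4 * I_sq

theorem Equivariant.contr_perm {n : ℕ} {a b : ℂ} {V : Fin 2 → Tensor (n + 2)}
    (H : Equivariant a b V) (ha : a ^ 2 = a + 1) (σ : Equiv.Perm (Fin (n + 2))) :
    Equivariant a b fun j => contr (perm σ (V j)) :=
  H.map (contr ∘ₗ perm σ) (fun h hd T => by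
    rw [LinearMap.comp_apply, LinearMap.comp_apply, ← actPow_perm, contr_actPow, hd, one_smul]) ha

theorem Equivariant.isSymm {n : ℕ} {a b : ℂ} {V : Fin 2 → Tensor (n + 2)}
    (H : Equivariant a b V) (ha : a ^ 2 = a + 1)
    (h : ∀ W : Fin 2 → Tensor n, Equivariant a b W → W = 0) (j : Fin 2) : IsSymm (V j) :=
  isSymm_of_contr fun σ => congrFun (h _ (H.contr_perm ha σ)) j

/-- If nothing equivariant exists on n qubits, all contractions from n + 2 qubits vanish, so only
symmetric tensors need to be excluded there. -/
theorem Equivariant.eq_zero_of_ne {a b : ℂ} (ha : a ^ 2 = a + 1) (hb : b ^ 2 = b + 1)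
    (hab : a ≠ b) : ∀ {n : ℕ}, Odd n → n < 7 → ∀ V : Fin 2 → Tensor n, Equivariant a b V → V = 0
  | 0, h, _ => by simp at h
  | 1, _, _ => fun V H => H.eq_zero_one hab fun _ => isSymm_of_subsingleton _
  | n + 2, ho, hn => fun V H => by
    have hs := H.isSymm ha (eq_zero_of_ne ha hb hab (by simpa [parity_simps] using ho) (by omega))
    obtain ⟨k, hk⟩ := ho
    have : n = 1 ∨ n = 3 := by omega
    rcases this with rfl | rfl
    · exact H.eq_zero_three hs
    · exact H.eq_zero_five ha hb hs

theorem Equivariant.seven_of_ne {a b : ℂ} (ha : a ^ 2 = a + 1) (hb : b ^ 2 = b + 1)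
    (hab : a ≠ b) {V : Fin 2 → Tensor 7} (H : Equivariant a b V) : ∃ c : ℂ, V = c • codeTensor a :=
  (H.symm_seven ha (H.isSymm ha (eq_zero_of_ne ha hb hab (by decide) (by norm_num)))).2

/-- If the logical and the physical representations agree, the code detects the total spin. -/
theorem Equivariant.weightOp_eq {a : ℂ} (ha : a ^ 2 = a + 1) : ∀ {n : ℕ}, Odd n → n ≤ 7 →
    ∀ V : Fin 2 → Tensor n, Equivariant a a V → ∀ j, weightOp (V j) = ![(1 : ℂ), -1] j • V j
  | 0, h, _ => by simp at h
  | 1, _, _ => fun V H j => by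
    have h0 : ∀ x : Fin 1 → Fin 2, x 0 = 1 → V 0 x = 0 := fun x hx => by
      have h := H.apply_zero x
      have : hammingWeight x = 1 := by
        rw [hammingWeight, Finset.filter_true_of_mem fun i _ => by rwa [Subsingleton.elim i 0]]
        rfl
      simpa [this] using h
    have h1 : ∀ x : Fin 1 → Fin 2, x 0 = 0 → V 1 x = 0 := fun x hx => by
      rw [H.apply_one x, h0 _ (by simp [flip, hx]), mul_zero]
    ext x
    rw [weightOp_apply, Fin.sum_univ_one]
    rcases Fin.exists_fin_two.mp ⟨x 0, rfl⟩ with hx | hx <;> fin_cases j <;>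
      simp [hx, h0 x, h1 x]
  | n + 2, ho, hn => fun V H j => by
    have ih := weightOp_eq ha (n := n) (by simpa [parity_simps] using ho) (by omega)
    -- Symmetrization is equivariant with equal parameters. Degrees three and five are excluded
    -- outright, and degree seven would need a = 1 - a, contrary to the golden equation.
    have hsymm : symm (V j) = 0 := by
      have hE : Equivariant a a fun j => symm (V j) :=
        H.map symm (fun h _ T => actPow_symm h T) ha
      refine congrFun (?_ : (fun j => symm (V j)) = 0) j
      have hs : ∀ j, IsSymm (symm (V j)) := fun j => isSymm_symm _
      obtain ⟨k, hk⟩ := ho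
      have : n = 1 ∨ n = 3 ∨ n = 5 := by omega
      rcases this with rfl | rfl | rfl
      · exact hE.eq_zero_three hs
      · exact hE.eq_zero_five ha ha hs
      · by_contra hne
        have h := (hE.symm_seven ha hs).1 hne
        have h2 : a = 1 / 2 := by linear_combination h / 2
        rw [h2] at ha
        norm_num at ha
    -- The difference of the two sides has vanishing contractions by induction, so it is symmetric;
    -- its symmetrization vanishes by `hsymm`, so it is zero.
    refine sub_eq_zero.mp (IsSymm.eq_zero (isSymm_of_contr fun σ => ?_) ?_)
    · have := ih _ (H.contr_perm ha σ) j
      rw [map_sub, map_sub, map_smul, map_smul, ← weightOp_perm, contr_weightOp, this, sub_self]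
    · rw [map_sub, map_smul, ← weightOp_symm, hsymm, map_zero, smul_zero, sub_zero]

/-! ### Codes, changes of frame and the passage between isometries and columns. -/

/-- The code spanned by two tensors. -/
def code {n : ℕ} (V : Fin 2 → Tensor n) : Submodule ℂ (Qubits n) :=
  Submodule.span ℂ (Set.range fun j => (WithLp.toLp 2 (V j) : Qubits n))

theorem toLp_mem_code {n : ℕ} (V : Fin 2 → Tensor n) (j : Fin 2) :
    (WithLp.toLp 2 (V j) : Qubits n) ∈ code V := Submodule.subset_span ⟨j, rfl⟩

theorem code_le {n : ℕ} {V : Fin 2 → Tensor n} {S : Submodule ℂ (Qubits n)}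
    (h : ∀ j, (WithLp.toLp 2 (V j) : Qubits n) ∈ S) : code V ≤ S :=
  Submodule.span_le.mpr (by rintro _ ⟨j, rfl⟩; exact h j)

theorem code_smul {n : ℕ} {c : ℂ} (hc : c ≠ 0) (V : Fin 2 → Tensor n) : code (c • V) = code V := by
  refine le_antisymm (code_le fun j => ?_) (code_le fun j => ?_)
  · exact Submodule.smul_mem _ c (toLp_mem_code V j)
  · have := Submodule.smul_mem _ c⁻¹ (toLp_mem_code (c • V) j)
    rwa [Pi.smul_apply, WithLp.toLp_smul, inv_smul_smul₀ hc] at this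

/-- Change of the logical frame. -/
def rotate {n : ℕ} (u : Matrix (Fin 2) (Fin 2) ℂ) (V : Fin 2 → Tensor n) : Fin 2 → Tensor n :=
  fun j => ∑ i, u i j • V i

theorem rotate_mul {n : ℕ} (u v : Matrix (Fin 2) (Fin 2) ℂ) (V : Fin 2 → Tensor n) :
    rotate v (rotate u V) = rotate (u * v) V := by
  funext j
  simp only [rotate, Fin.sum_univ_two, Matrix.mul_apply]
  module

theorem rotate_one {n : ℕ} (V : Fin 2 → Tensor n) : rotate 1 V = V := by
  funext j
  fin_cases j <;> simp [rotate, Matrix.one_apply]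

theorem code_rotate_le {n : ℕ} (u : Matrix (Fin 2) (Fin 2) ℂ) (V : Fin 2 → Tensor n) :
    code (rotate u V) ≤ code V := code_le fun j => by
  rw [rotate, WithLp.toLp_sum]
  exact Submodule.sum_mem _ fun i _ => Submodule.smul_mem _ _ (toLp_mem_code V i)

theorem code_rotate {n : ℕ} (u : U2) (V : Fin 2 → Tensor n) : code (rotate u V) = code V := by
  refine le_antisymm (code_rotate_le _ _) ?_
  have := code_rotate_le (u⁻¹ : U2).1 (rotate u V)
  rwa [rotate_mul, coe_mul_inv, rotate_one] at this

theorem intertwines_iff_rotate {n : ℕ} {V : Fin 2 → Tensor n} {h g : Matrix (Fin 2) (Fin 2) ℂ} :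
    Intertwines V h g ↔ (fun j => actPow h (V j)) = rotate g V :=
  ⟨fun H => funext H, fun H j => congrFun H j⟩

theorem Intertwines.rotate {n : ℕ} {V : Fin 2 → Tensor n} {h g : Matrix (Fin 2) (Fin 2) ℂ}
    (H : Intertwines V h g) (u : U2) :
    Intertwines (rotate u V) h ((u⁻¹ : U2) * g * (u : Matrix (Fin 2) (Fin 2) ℂ)) := by
  rw [intertwines_iff_rotate, rotate_mul, ← mul_assoc, ← mul_assoc, coe_mul_inv, one_mul,
    ← rotate_mul, ← intertwines_iff_rotate.mp H]
  funext j
  simp only [QubitCode.rotate, map_sum, map_smul]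

theorem Intertwines.conj {n : ℕ} {V : Fin 2 → Tensor n} {h : U2} {g : Matrix (Fin 2) (Fin 2) ℂ}
    (H : Intertwines V h g) (u : U2) : Intertwines (fun j => actPow (u⁻¹ : U2) (V j))
      ((u⁻¹ * h * u : U2) : Matrix (Fin 2) (Fin 2) ℂ) g := fun j => by
  rw [← actPow_mul, coe_mul, coe_mul, mul_assoc, coe_mul_inv, mul_one, actPow_mul, H j]
  simp only [map_sum, map_smul]

theorem Indep.map {n m : ℕ} {V : Fin 2 → Tensor n} (hV : Indep V) (f : Tensor n →ₗ[ℂ] Tensor m)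
    (hf : Function.Injective f) : Indep fun j => f (V j) := fun a b h => by
  rw [← map_smul, ← map_smul, ← map_add] at h
  exact hV a b (hf (h.trans (map_zero f).symm))

theorem actPow_injective {n : ℕ} (u : U2) :
    Function.Injective (actPow (n := n) (u : Matrix (Fin 2) (Fin 2) ℂ)) :=
  Function.LeftInverse.injective (g := actPow (u⁻¹ : U2)) fun T => by
    rw [← actPow_mul, coe_inv_mul, act_one]

theorem Indep.ne_zero {n : ℕ} {V : Fin 2 → Tensor n} (hV : Indep V) (j : Fin 2) : V j ≠ 0 := by
  intro h
  fin_cases j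
  · exact one_ne_zero (hV 1 0 (by simpa using h)).1
  · exact one_ne_zero (hV 0 1 (by simpa using h)).2

theorem Indep.rotate {n : ℕ} {V : Fin 2 → Tensor n} (hV : Indep V) (u : U2) :
    Indep (rotate u V) := by
  intro a b h
  have h2 : (u.1 0 0 * a + u.1 0 1 * b) • V 0 + (u.1 1 0 * a + u.1 1 1 * b) • V 1 = 0 := by
    rw [← h]
    simp only [QubitCode.rotate, Fin.sum_univ_two]
    module
  obtain ⟨h3, h4⟩ := hV _ _ h2
  have hd := det_ne_zero u
  rw [Matrix.det_fin_two] at hd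
  constructor
  · refine (mul_eq_zero.mp ?_).resolve_left hd
    linear_combination u.1 1 1 * h3 - u.1 0 1 * h4
  · refine (mul_eq_zero.mp ?_).resolve_left hd
    linear_combination u.1 0 0 * h4 - u.1 1 0 * h3

theorem code_actPow {n : ℕ} (u : U2) (V : Fin 2 → Tensor n) :
    code (fun j => actPow (u : Matrix (Fin 2) (Fin 2) ℂ) (V j)) = (code V).map (tensorPow n u) := by
  rw [code, code, Submodule.map_span, ← Set.range_comp]
  rfl

theorem inner_toLp {n : ℕ} (S T : Tensor n) :
    inner ℂ (WithLp.toLp 2 S : Qubits n) (WithLp.toLp 2 T) = ∑ x, star (S x) * T x := by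
  rw [PiLp.inner_apply]
  exact Finset.sum_congr rfl fun x _ => mul_comm _ _

theorem inner_tensorOp {n : ℕ} (A : Fin n → Matrix (Fin 2) (Fin 2) ℂ) (u v : Qubits n) :
    inner ℂ (tensorOp A u) v = inner ℂ u (tensorOp (fun i => (A i)ᴴ) v) := by
  have : tensorOp (fun i => (A i)ᴴ) = LinearMap.adjoint (tensorOp A) := by
    rw [tensorOp, tensorOp, ← Matrix.toEuclideanLin_conjTranspose_eq_adjoint]
    congr 1
    ext x y
    simp [Matrix.conjTranspose_apply]
  rw [this, LinearMap.adjoint_inner_right]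

theorem tensorOp_mul {n : ℕ} (A B : Fin n → Matrix (Fin 2) (Fin 2) ℂ) (v : Qubits n) :
    tensorOp (fun i => A i * B i) v = tensorOp A (tensorOp B v) := by
  simp only [tensorOp_apply, act_mul]

theorem coe_inv_eq (u : U2) : ((u⁻¹ : U2) : Matrix (Fin 2) (Fin 2) ℂ) = (u : Matrix _ _ ℂ)ᴴ := rfl

theorem inner_tensorPow {n : ℕ} (u : U2) (v w : Qubits n) :
    inner ℂ (tensorPow n u v) (tensorPow n u w) = inner ℂ v w := by
  rw [tensorPow, inner_tensorOp, ← tensorOp_mul, ← coe_inv_eq, coe_inv_mul, tensorOp_apply, act_one]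

/-- Moving the unitaries onto the error conjugates each factor, which keeps identity factors and so
does not enlarge the support. -/
theorem DistanceAtLeast.map {n d : ℕ} {C : Submodule ℂ (Qubits n)} (hC : DistanceAtLeast C d)
    (u : U2) : DistanceAtLeast (C.map (tensorPow n u)) d := by
  intro A hA
  obtain ⟨c, hc⟩ := hC (fun i => (u⁻¹ : U2) * A i * (u : Matrix (Fin 2) (Fin 2) ℂ)) (by
    refine lt_of_le_of_lt (Set.ncard_le_ncard (t := {i | A i ≠ 1}) (fun i hi h => hi ?_)
      (Set.toFinite _)) hA
    rw [h, mul_one, coe_inv_mul])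
  refine ⟨c, ?_⟩
  rintro _ ⟨v, hv, rfl⟩ _ ⟨w, hw, rfl⟩
  rw [inner_tensorPow, ← hc v hv w hw, tensorPow, inner_tensorOp, ← tensorOp_mul, ← tensorOp_mul]
  rfl

theorem DistanceAtLeast.mono {n d e : ℕ} {C : Submodule ℂ (Qubits n)} (hC : DistanceAtLeast C d)
    (he : e ≤ d) : DistanceAtLeast C e := fun A hA => hC A (hA.trans_le he)

/-- Orthonormality of the columns is dropped: the bound and the uniqueness statements use only their
independence and span. -/
theorem StronglyTransversalVia.exists_indep {n : ℕ} {H G : Subgroup U2}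
    {C : Submodule ℂ (Qubits n)} (hC : StronglyTransversalVia H G C) :
    ∃ V : Fin 2 → Tensor n, Indep V ∧ code V = C ∧
      ∀ g ∈ G, ∃ h ∈ H, Intertwines V (h : Matrix (Fin 2) (Fin 2) ℂ) g := by
  obtain ⟨L, hL, hG⟩ := hC
  have hv : ∀ v : EuclideanSpace ℂ (Fin 2), L v =
      WithLp.toLp 2 (∑ j, v j • (L (EuclideanSpace.single j 1)).ofLp) := fun v => by
    have : v = ∑ j, v j • EuclideanSpace.single j (1 : ℂ) := by
      ext i
      fin_cases i <;> simp [Fin.sum_univ_two]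
    conv_lhs => rw [this]
    simp only [map_sum, map_smul, WithLp.toLp_sum]
    rfl
  refine ⟨fun j => (L (EuclideanSpace.single j 1)).ofLp, fun a b hab => ?_, ?_, fun g hg => ?_⟩
  · have h0 : L !₂[a, b] = 0 := by
      rw [hv, Fin.sum_univ_two]
      exact congrArg (WithLp.toLp 2) hab
    have h1 := L.injective (h0.trans (map_zero L).symm)
    exact ⟨congrFun (congrArg WithLp.ofLp h1) 0, congrFun (congrArg WithLp.ofLp h1) 1⟩
  · rw [← hL]
    refine le_antisymm (code_le fun j => ⟨_, rfl⟩) ?_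
    rintro _ ⟨v, rfl⟩
    change L v ∈ _
    rw [hv, WithLp.toLp_sum]
    exact Submodule.sum_mem _ fun j _ => Submodule.smul_mem _ _ (toLp_mem_code _ j)
  · obtain ⟨h, hh, H⟩ := hG g hg
    refine ⟨h, hh, fun j => ?_⟩
    have := congrArg WithLp.ofLp (H (EuclideanSpace.single j 1))
    rw [hv (toEuclideanLin _ _)] at this
    refine this.trans ?_
    simp only [Fin.sum_univ_two]
    fin_cases j <;> simp [Matrix.toLpLin_apply]

theorem stronglyTransversalVia_code {n : ℕ} {H G : Subgroup U2} {V : Fin 2 → Tensor n}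
    (hV : Orthonormal ℂ fun j => (WithLp.toLp 2 (V j) : Qubits n))
    (hG : ∀ g ∈ G, ∃ h ∈ H, Intertwines V (h : Matrix (Fin 2) (Fin 2) ℂ) g) :
    StronglyTransversalVia H G (code V) := by
  let L : EuclideanSpace ℂ (Fin 2) →ₗ[ℂ] Qubits n :=
    (EuclideanSpace.basisFun (Fin 2) ℂ).toBasis.constr ℂ fun j => WithLp.toLp 2 (V j)
  have hL : ∀ v, L v = ∑ j, v j • (WithLp.toLp 2 (V j) : Qubits n) := fun v => by
    simp [L, Module.Basis.constr_apply_fintype]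
  have hb : (L ∘ (EuclideanSpace.basisFun (Fin 2) ℂ).toBasis) = fun j => WithLp.toLp 2 (V j) := by
    funext j
    exact Module.Basis.constr_basis _ _ _ _
  refine ⟨L.isometryOfOrthonormal (v := (EuclideanSpace.basisFun (Fin 2) ℂ).toBasis)
    (by simp) (by rwa [hb]), ?_, ?_⟩
  · change LinearMap.range L = _
    rw [code, Module.Basis.constr_range]
  · intro g hg
    obtain ⟨h, hh, H⟩ := hG g hg
    refine ⟨h, hh, fun v => ?_⟩
    change tensorPow n h (L v) = L _
    have e : ∀ j, tensorPow n h (WithLp.toLp 2 (V j)) =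
        ∑ i, (g : Matrix (Fin 2) (Fin 2) ℂ) i j • (WithLp.toLp 2 (V i) : Qubits n) := fun j => by
      rw [tensorPow, tensorOp_apply, H j, WithLp.toLp_sum]
      rfl
    rw [hL, hL, map_sum]
    simp only [map_smul, e, Fin.sum_univ_two]
    simp only [Matrix.toLpLin_apply, Matrix.mulVec, dotProduct, Fin.sum_univ_two]
    module

theorem intertwines_of_proj_eq {n : ℕ} {V : Fin 2 → Tensor n} {h k : U2}
    {g : Matrix (Fin 2) (Fin 2) ℂ} (H : Intertwines V h g) (e : proj h = proj k) :
    ∃ c : ℂ, c ≠ 0 ∧ Intertwines V k (c • g) := by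
  obtain ⟨c, hc⟩ := proj_eq_iff.mp e
  refine ⟨c ^ n, pow_ne_zero _ fun h0 => coe_ne_zero k (by rw [hc, h0, zero_smul]), ?_⟩
  rw [hc]
  exact H.smul c

/-! ### Icosahedral frames for physical and for logical gates. -/

theorem icosa_param {a : ℝ} (ha : a ^ 2 = a + 1) :
    (a : ℂ) = Real.goldenRatio ∨ (a : ℂ) = 1 - Real.goldenRatio := by
  have h : (a - Real.goldenRatio) * (a - (1 - Real.goldenRatio)) = 0 := by
    linear_combination ha - Real.goldenRatio_sq
  rcases mul_eq_zero.mp h with h | h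
  · exact Or.inl (by exact_mod_cast sub_eq_zero.mp h)
  · exact Or.inr (by exact_mod_cast sub_eq_zero.mp h)

theorem gateX_mem : gateX ∈ binaryIcosahedral := Subgroup.subset_closure (by simp)
theorem gateZ_mem : gateZ ∈ binaryIcosahedral := Subgroup.subset_closure (by simp)
theorem gateF_mem : gateF ∈ binaryIcosahedral := Subgroup.subset_closure (by simp)
theorem gatePhi_mem : gatePhi ∈ binaryIcosahedral := Subgroup.subset_closure (by simp)

theorem Intertwines.mem_gatePairs {n : ℕ} {V : Fin 2 → Tensor n} {h g : U2}
    (H : Intertwines V (h : Matrix (Fin 2) (Fin 2) ℂ) g) : (h, g) ∈ gatePairs V :=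
  ⟨1, one_ne_zero, by rwa [one_smul]⟩

/-- After a physical change of frame the physical gates are the icosahedral ones. -/
theorem exists_equivariant {n : ℕ} (hn : n < 9) {V : Fin 2 → Tensor n} (hV : Indep V)
    (hG : ∀ g ∈ binaryIcosahedral, ∃ h : U2, Intertwines V (h : Matrix (Fin 2) (Fin 2) ℂ) g) :
    Odd n ∧ ∃ u : U2, ∃ a : ℂ, (a = Real.goldenRatio ∨ a = 1 - Real.goldenRatio) ∧
      Equivariant a Real.goldenRatio fun j => actPow (u⁻¹ : U2) (V j) := by
  obtain ⟨x, hx⟩ := hG _ gateX_mem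
  obtain ⟨z, hz⟩ := hG _ gateZ_mem
  obtain ⟨f, hf⟩ := hG _ gateF_mem
  obtain ⟨p, hp⟩ := hG _ gatePhi_mem
  have R := icosahedralRelations_transfer (T := gatePairs V) (fun h g hg =>
    center_iff_of_gatePairs hn (fun h0 => hV.ne_zero 0 (congrFun h0 0)) hx.mem_gatePairs
      hz.mem_gatePairs hf.mem_gatePairs hp.mem_gatePairs hg)
    hx.mem_gatePairs hz.mem_gatePairs hf.mem_gatePairs hp.mem_gatePairs icosahedralRelations_gates
  obtain ⟨u, ux, uz, uf, a, ha, c, hc, up⟩ := R.exists_frame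
  have hW : Indep fun j => actPow (u⁻¹ : U2) (V j) := hV.map _ (actPow_injective u⁻¹)
  obtain ⟨cx, hcx, Hx⟩ := intertwines_of_proj_eq (hx.conj u) ux
  obtain ⟨cz, -, Hz⟩ := intertwines_of_proj_eq (hz.conj u) uz
  obtain ⟨cf, hcf, Hf⟩ := intertwines_of_proj_eq (hf.conj u) uf
  have Hp := (hp.conj u).smul c⁻¹
  rw [up, inv_smul_smul₀ hc, coe_gatePhi] at Hp
  have ha' : (a : ℂ) ^ 2 = a + 1 := by exact_mod_cast ha
  have hE := equivariant_of_smul ha' goldenRatio_sq' hW hcx hcf Hx Hz Hf Hp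
  exact ⟨hE.1, u, a, icosa_param ha, hE.2⟩

/-- After a logical change of frame the logical gates are the icosahedral ones. -/
theorem exists_equivariant_rotate {n : ℕ} (hn : n < 9) {V : Fin 2 → Tensor n} (hV : Indep V)
    (hG : ∀ g ∈ binaryIcosahedral, ∃ h : U2, Intertwines V (h : Matrix (Fin 2) (Fin 2) ℂ) g)
    {x z f p : U2} (hx : (gateX, x) ∈ gatePairs V) (hz : (gateZ, z) ∈ gatePairs V)
    (hf : (gateF, f) ∈ gatePairs V) (hp : (gatePhi, p) ∈ gatePairs V) :
    ∃ u : U2, ∃ b : ℂ, (b = Real.goldenRatio ∨ b = 1 - Real.goldenRatio) ∧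
      Odd n ∧ Equivariant Real.goldenRatio b (rotate u V) := by
  obtain ⟨x', hx'⟩ := hG _ gateX_mem
  obtain ⟨z', hz'⟩ := hG _ gateZ_mem
  obtain ⟨f', hf'⟩ := hG _ gateF_mem
  obtain ⟨p', hp'⟩ := hG _ gatePhi_mem
  -- The pairs are swapped: here the physical gates are the standard ones and the relations pass to
  -- the logical gates.
  have R := icosahedralRelations_transfer
    (T := (gatePairs V).comap (MulEquiv.prodComm : U2 × U2 ≃* U2 × U2).toMonoidHom)
    (fun g h hg => (center_iff_of_gatePairs hn (fun h0 => hV.ne_zero 0 (congrFun h0 0))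
      hx'.mem_gatePairs hz'.mem_gatePairs hf'.mem_gatePairs hp'.mem_gatePairs hg).symm)
    (x := x) (z := z) (f := f) (p := p) hx hz hf hp icosahedralRelations_gates
  obtain ⟨u, ux, uz, uf, b, hb, c, hc, up⟩ := R.exists_frame
  have hb' : (b : ℂ) ^ 2 = b + 1 := by exact_mod_cast hb
  have key : ∀ {k g g' : U2}, (k, g) ∈ gatePairs V → proj (u⁻¹ * g * u) = proj g' →
      ∃ c : ℂ, c ≠ 0 ∧ Intertwines (rotate u V) (k : Matrix (Fin 2) (Fin 2) ℂ)
        (c • (g' : Matrix (Fin 2) (Fin 2) ℂ)) := by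
    rintro k g g' ⟨c, hc, H⟩ e
    obtain ⟨d, hd⟩ := proj_eq_iff.mp e.symm
    have hd0 : d ≠ 0 := fun h0 => coe_ne_zero _ (by rw [hd, h0, zero_smul])
    refine ⟨c * d, mul_ne_zero hc hd0, ?_⟩
    have := H.rotate u
    rwa [mul_smul_comm, smul_mul_assoc, ← coe_mul, ← coe_mul, hd, smul_smul] at this
  obtain ⟨cx, hcx, Hx⟩ := key hx ux
  obtain ⟨cz, -, Hz⟩ := key hz uz
  obtain ⟨cf, hcf, Hf⟩ := key hf uf
  obtain ⟨d, hd, Hp⟩ := hp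
  have Hp := Hp.rotate u
  rw [mul_smul_comm, smul_mul_assoc, ← coe_mul, ← coe_mul, up, smul_smul, coe_gatePhi] at Hp
  exact ⟨u, b, icosa_param hb,
    equivariant_of_smul goldenRatio_sq' hb' (hV.rotate u) hcx hcf Hx Hz Hf Hp⟩

/-! ### Distance two excludes equal parameters; the lower bound. -/

theorem act_single_diagonal {n : ℕ} (i : Fin n) (A : Matrix (Fin 2) (Fin 2) ℂ) (T : Tensor n)
    (hA : A = Matrix.diagonal ![1, -1]) (x : Fin n → Fin 2) :
    act (fun k => if k = i then A else 1) T x = (-1 : ℂ) ^ (x i : ℕ) * T x := by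
  rw [act_apply, Finset.sum_eq_single x]
  · congr 1
    rw [Finset.prod_eq_single i]
    · rw [if_pos rfl, hA]
      generalize x i = k
      fin_cases k <;> simp
    · intro k _ hk
      rw [if_neg hk, Matrix.one_apply_eq]
    · simp
  · intro y _ hy
    obtain ⟨k, hk⟩ := Function.ne_iff.mp hy.symm
    rw [Finset.prod_eq_zero (Finset.mem_univ k), zero_mul]
    split_ifs
    · rw [hA, Matrix.diagonal_apply_ne _ hk]
    · exact Matrix.one_apply_ne hk
  · simp

/-- A code of distance two does not detect the total spin. -/
theorem not_distanceAtLeast_two {n : ℕ} {V : Fin 2 → Tensor n} (hV : Indep V)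
    (h : ∀ j, weightOp (V j) = ![(1 : ℂ), -1] j • V j) : ¬ DistanceAtLeast (code V) 2 := by
  intro hd
  have hA : ∀ i : Fin n, ∃ c : ℂ, ∀ u ∈ code V, ∀ v ∈ code V,
      inner ℂ u (tensorOp (fun k => if k = i then Matrix.diagonal ![1, -1] else 1) v) =
        c * inner ℂ u v := fun i => hd _ (by
    refine lt_of_le_of_lt (Set.ncard_le_ncard (t := {i}) (fun k hk => ?_)) (by simp)
    by_contra hne
    exact hk (if_neg hne))
  choose c hc using hA
  -- Adding the Knill-Laflamme constants of the errors Z_i makes the expectation of ∑ Z_i the same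
  -- for both basis vectors, but their eigenvalues are 1 and -1.
  have key : ∀ j, ![(1 : ℂ), -1] j = ∑ i, c i := fun j => by
    have h0 : (inner ℂ (WithLp.toLp 2 (V j) : Qubits n) (WithLp.toLp 2 (V j))) ≠ 0 := by
      rw [inner_self_ne_zero]
      exact fun h0 => hV.ne_zero j (by simpa using h0)
    refine mul_right_cancel₀ h0 ?_
    rw [Finset.sum_mul, Finset.sum_congr rfl fun i _ =>
      (hc i _ (toLp_mem_code V j) _ (toLp_mem_code V j)).symm, ← inner_sum, ← inner_smul_right,
      ← WithLp.toLp_smul, ← h j]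
    congr 1
    ext x
    rw [WithLp.ofLp_sum, Finset.sum_apply]
    change weightOp (V j) x = ∑ i, act (fun k => if k = i then _ else 1) (V j) x
    simp only [act_single_diagonal _ _ _ rfl, weightOp_apply, Finset.sum_mul]
  have := (key 0).trans (key 1).symm
  norm_num at this

theorem goldenRatio_ne : (Real.goldenRatio : ℂ) ≠ 1 - Real.goldenRatio := fun h => by
  have h2 : (Real.goldenRatio : ℂ) = 1 / 2 := by linear_combination h / 2
  have := goldenRatio_sq'
  rw [h2] at this
  norm_num at this

theorem one_sub_goldenRatio_sq : (1 - Real.goldenRatio : ℂ) ^ 2 = (1 - Real.goldenRatio) + 1 := by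
  linear_combination goldenRatio_sq'

/-- On at most seven qubits the physical and the logical representation are conjugate under the
Galois action. -/
theorem exists_equivariant_conj {n : ℕ} (hn : n ≤ 7) {V : Fin 2 → Tensor n} (hV : Indep V)
    (hd : DistanceAtLeast (code V) 2)
    (hG : ∀ g ∈ binaryIcosahedral, ∃ h : U2, Intertwines V (h : Matrix (Fin 2) (Fin 2) ℂ) g) :
    Odd n ∧ ∃ u : U2, Equivariant (1 - Real.goldenRatio) Real.goldenRatio
      fun j => actPow (u⁻¹ : U2) (V j) := by
  obtain ⟨ho, u, a, ha, hE⟩ := exists_equivariant (by omega) hV hG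
  refine ⟨ho, u, ?_⟩
  rcases ha with rfl | rfl
  · refine absurd ?_ (not_distanceAtLeast_two (hV.map _ (actPow_injective u⁻¹))
      (Equivariant.weightOp_eq goldenRatio_sq' ho hn _ hE))
    rw [code_actPow]
    exact hd.map _
  · exact hE

theorem StronglyTransversalVia.exists_indep_unitary {n : ℕ} {H G : Subgroup U2}
    {C : Submodule ℂ (Qubits n)} (hC : StronglyTransversalVia H G C) :
    ∃ V : Fin 2 → Tensor n, Indep V ∧ code V = C ∧
      ∀ g ∈ G, ∃ h : U2, Intertwines V (h : Matrix (Fin 2) (Fin 2) ℂ) g := by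
  obtain ⟨V, hV, hc, hG⟩ := StronglyTransversalVia.exists_indep hC
  exact ⟨V, hV, hc, fun g hg => (hG g hg).imp fun _ h => h.2⟩

theorem seven_le {n : ℕ} {C : Submodule ℂ (Qubits n)} (hd : DistanceAtLeast C 2)
    (hC : StronglyTransversal binaryIcosahedral C) : 7 ≤ n := by
  by_contra! hn
  obtain ⟨V, hV, rfl, hG⟩ := StronglyTransversalVia.exists_indep_unitary hC
  obtain ⟨ho, u, hE⟩ := exists_equivariant_conj hn.le hV hd hG
  exact (hV.map _ (actPow_injective u⁻¹)).ne_zero 0 (congrFun (Equivariant.eq_zero_of_ne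
    one_sub_goldenRatio_sq goldenRatio_sq' goldenRatio_ne.symm ho hn _ hE) 0)

/-- The reference code uses 1 - φ because the logical gate is fixed to be Φ_φ and the physical one
is its conjugate. `eq_map_dickeCode` later trades it for the Dicke code by applying this statement
to that code too. -/
theorem eq_map_code {C : Submodule ℂ (Qubits 7)} (hd : DistanceAtLeast C 2)
    (hC : StronglyTransversal binaryIcosahedral C) :
    ∃ u : U2, C = (code (codeTensor (1 - Real.goldenRatio))).map (tensorPow 7 u) := by
  obtain ⟨V, hV, rfl, hG⟩ := StronglyTransversalVia.exists_indep_unitary hC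
  obtain ⟨-, u, hE⟩ := exists_equivariant_conj le_rfl hV hd hG
  refine ⟨u, ?_⟩
  obtain ⟨c, hc⟩ := hE.seven_of_ne one_sub_goldenRatio_sq goldenRatio_sq' goldenRatio_ne.symm
  have hc0 : c ≠ 0 := by
    rintro rfl
    refine (hV.map _ (actPow_injective u⁻¹)).ne_zero 0 ((congrFun hc 0).trans ?_)
    rw [zero_smul]
    rfl
  rw [← code_smul hc0 (codeTensor _), ← hc, ← code_actPow]
  congr 1
  funext j
  rw [← actPow_mul, coe_mul_inv, act_one]

/-! ### Equivariance of the explicit seven-qubit tensors. -/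

theorem I_pow_eight : I ^ 8 = 1 := by rw [pow_succ, I_pow_seven, neg_mul, I_mul_I, neg_neg]

theorem I_pow_nine : I ^ 9 = I := by rw [pow_succ, I_pow_eight, one_mul]

theorem form_codeTensor_zero (a s t : ℂ) : form (codeTensor a 0) ![s, t] =
    -21 * (2 * a - 1) * s ^ 6 * t + 105 * s ^ 4 * t ^ 3 + 21 * (2 * a - 1) * s ^ 2 * t ^ 5
      + 15 * t ^ 7 := by
  have h : ∀ w ≤ 7, codeTensor a 0 (bits 7 w) = codeAmp a w := fun w hw => by
    simp [codeTensor, hammingWeight_bits hw]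
  simp only [(isSymm_codeTensor a _).form_eq, Finset.sum_range_succ, Finset.range_zero,
    Finset.sum_empty]
  rw [h 0 (by norm_num), h 1 (by norm_num), h 2 (by norm_num), h 3 (by norm_num),
    h 4 (by norm_num), h 5 (by norm_num), h 6 (by norm_num), h 7 (by norm_num)]
  have c73 : Nat.choose 7 3 = 35 := rfl
  have c75 : Nat.choose 7 5 = 21 := rfl
  simp [codeAmp, c73, c75]
  ring

theorem form_codeTensor_one (a s t : ℂ) :
    form (codeTensor a 1) ![s, t] = -form (codeTensor a 0) ![t, s] := by
  have h : ∀ w ≤ 7, codeTensor a 1 (bits 7 w) = -codeAmp a (7 - w) := fun w hw => by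
    simp [codeTensor, hammingWeight_bits hw]
  rw [form_codeTensor_zero]
  simp only [(isSymm_codeTensor a _).form_eq, Finset.sum_range_succ, Finset.range_zero,
    Finset.sum_empty]
  rw [h 0 (by norm_num), h 1 (by norm_num), h 2 (by norm_num), h 3 (by norm_num),
    h 4 (by norm_num), h 5 (by norm_num), h 6 (by norm_num), h 7 (by norm_num)]
  have c72 : Nat.choose 7 2 = 21 := rfl
  have c74 : Nat.choose 7 4 = 35 := rfl
  simp [codeAmp, c72, c74]
  ring

/-- Symmetric tensors are determined by their forms, so equivariance is a polynomial identity in s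
and t. -/
theorem intertwines_codeTensor {a : ℂ} {h g : Matrix (Fin 2) (Fin 2) ℂ}
    (H : ∀ j, ∀ s t : ℂ, form (codeTensor a j) (![s, t] ᵥ* h) =
      g 0 j * form (codeTensor a 0) ![s, t] + g 1 j * form (codeTensor a 1) ![s, t]) :
    Intertwines (codeTensor a) h g := fun j => by
  refine IsSymm.ext_form (fun σ => ?_) (fun σ => ?_) fun v => ?_
  · rw [← actPow_perm, isSymm_codeTensor a j σ]
  · rw [map_sum]
    exact Finset.sum_congr rfl fun i _ => by rw [map_smul, isSymm_codeTensor a i σ]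
  · have hv : v = ![v 0, v 1] := by ext k; fin_cases k <;> rfl
    rw [form_actPow, hv, H, Fin.sum_univ_two, form_add, form_smul, form_smul]

theorem intertwines_codeTensor_gateX (a : ℂ) : Intertwines (codeTensor a) gateX gateX := by
  refine intertwines_codeTensor fun j s t => ?_
  have e : ![s, t] ᵥ* (gateX : Matrix (Fin 2) (Fin 2) ℂ) = -I • ![t, s] := by
    ext k; fin_cases k <;> simp [gateX, Matrix.vecMul, dotProduct, Fin.sum_univ_two] <;> ring
  rw [e, form_smul_right, neg_I_pow_seven]
  fin_cases j <;> simp [gateX, form_codeTensor_one]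

theorem intertwines_codeTensor_gateZ (a : ℂ) : Intertwines (codeTensor a) gateZ gateZ := by
  refine intertwines_codeTensor fun j s t => ?_
  have e : ![s, t] ᵥ* (gateZ : Matrix (Fin 2) (Fin 2) ℂ) = I • ![-s, t] := by
    ext k; fin_cases k <;> simp [gateZ, Matrix.vecMul, dotProduct, Fin.sum_univ_two] <;> ring
  rw [e, form_smul_right, I_pow_seven]
  fin_cases j <;> simp [gateZ, form_codeTensor_one, form_codeTensor_zero] <;> ring

theorem intertwines_codeTensor_gateF (a : ℂ) : Intertwines (codeTensor a) gateF gateF := by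
  refine intertwines_codeTensor fun j s t => ?_
  rw [vecMul_gateF, form_smul_right]
  have hq : ((1 - I) / 2) ^ 7 = I / 8 * ((1 - I) / 2) := by
    have : ((1 - I) / 2) ^ 2 = -I / 2 := by linear_combination I_sq / 4
    rw [pow_succ, pow_mul _ 2 3, this]
    linear_combination (-I / 8) * (1 - I) / 2 * I_sq
  rw [hq]
  fin_cases j <;> simp [gateF, form_codeTensor_one, form_codeTensor_zero] <;> ring_nf <;>
    simp only [I_sq, I_pow_three, I_pow_four, I_pow_five, I_pow_six, I_pow_seven, I_pow_eight,
      I_pow_nine] <;>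
    ring

theorem pow_golden {a : ℂ} (ha : a ^ 2 = a + 1) : a ^ 3 = 2 * a + 1 ∧ a ^ 4 = 3 * a + 2 ∧
    a ^ 5 = 5 * a + 3 ∧ a ^ 6 = 8 * a + 5 ∧ a ^ 7 = 13 * a + 8 ∧ a ^ 8 = 21 * a + 13 := by
  have h3 : a ^ 3 = 2 * a + 1 := by linear_combination (a + 1) * ha
  have h4 : a ^ 4 = 3 * a + 2 := by linear_combination a * h3 + 2 * ha
  have h5 : a ^ 5 = 5 * a + 3 := by linear_combination a * h4 + 3 * ha
  have h6 : a ^ 6 = 8 * a + 5 := by linear_combination a * h5 + 5 * ha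
  have h7 : a ^ 7 = 13 * a + 8 := by linear_combination a * h6 + 8 * ha
  exact ⟨h3, h4, h5, h6, h7, by linear_combination a * h7 + 13 * ha⟩

-- Expand, then reduce powers of i and of a by i² = -1 and the golden equation.
set_option maxRecDepth 20000 in
set_option maxHeartbeats 4000000 in
theorem intertwines_codeTensor_icosa {a : ℂ} (ha : a ^ 2 = a + 1) :
    Intertwines (codeTensor a) (icosa a) (icosa (1 - a)) := by
  obtain ⟨h3, h4, h5, h6, h7, h8⟩ := pow_golden ha
  refine intertwines_codeTensor fun j s t => ?_
  rw [vecMul_icosa]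
  fin_cases j <;> simp [icosa, form_codeTensor_one, form_codeTensor_zero] <;> ring_nf <;>
    simp only [I_sq, I_pow_three, I_pow_four, I_pow_five, I_pow_six, I_pow_seven, ha, h3, h4, h5,
      h6, h7, h8] <;> ring

theorem equivariant_codeTensor {a : ℂ} (ha : a ^ 2 = a + 1) :
    Equivariant a (1 - a) (codeTensor a) :=
  ⟨intertwines_codeTensor_gateX a, intertwines_codeTensor_gateZ a, intertwines_codeTensor_gateF a,
    intertwines_codeTensor_icosa ha⟩

theorem Intertwines.rotate_of_mul_eq {n : ℕ} {V : Fin 2 → Tensor n}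
    {h k g : Matrix (Fin 2) (Fin 2) ℂ} (H : Intertwines V h k) {u : U2}
    (e : k * (u : Matrix (Fin 2) (Fin 2) ℂ) = u * g) : Intertwines (QubitCode.rotate u V) h g := by
  have := H.rotate u
  rwa [mul_assoc, e, ← mul_assoc, coe_inv_mul, one_mul] at this

theorem orthonormal_rotate {n : ℕ} {V : Fin 2 → Tensor n}
    (hV : Orthonormal ℂ fun j => (WithLp.toLp 2 (V j) : Qubits n)) (u : U2) :
    Orthonormal ℂ fun j => (WithLp.toLp 2 (rotate u V j) : Qubits n) := by
  rw [orthonormal_iff_ite] at hV ⊢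
  intro i j
  have e := congrFun (congrFun (coe_inv_mul u) i) j
  rw [coe_inv_eq, Matrix.mul_apply, Fin.sum_univ_two, Matrix.one_apply] at e
  simp only [rotate, Fin.sum_univ_two, WithLp.toLp_add, WithLp.toLp_smul, inner_add_left,
    inner_add_right, inner_smul_left, inner_smul_right, hV]
  rw [← e]
  simp [Matrix.conjTranspose_apply]
  ring

/-! ### The Hadamard gate exchanges the two icosahedral groups. -/

/-- The Hadamard gate. -/
noncomputable def hadamard : U2 :=
  ⟨((√2 : ℝ)⁻¹ : ℂ) • !![1, 1; 1, -1], by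
    have h : ((√2 : ℝ) : ℂ)⁻¹ * ((√2 : ℝ) : ℂ)⁻¹ = 1 / 2 := by
      rw [← mul_inv, ← ofReal_mul, Real.mul_self_sqrt (by norm_num)]
      norm_num
    rw [Matrix.mem_unitaryGroup_iff]
    ext i j
    fin_cases i <;> fin_cases j <;>
      simp [Matrix.mul_apply, Matrix.star_apply, Fin.sum_univ_two, h] <;> norm_num⟩

theorem mul_hadamard {k g : Matrix (Fin 2) (Fin 2) ℂ}
    (h : k * !![1, 1; 1, -1] = !![1, 1; 1, -1] * g) :
    k * (hadamard : Matrix (Fin 2) (Fin 2) ℂ) = hadamard * g := by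
  simp only [hadamard, Matrix.mul_smul, Matrix.smul_mul, h]

/-- This and the next three identities write the Hadamard conjugates of X, Z, F and Φ_a as words in
X, Z, F and Φ_{1-a}. The logical group of `codeTensor` is thereby moved back to 2I, the same words
giving the physical gates. -/
theorem gateZ_hadamard : (gateZ : Matrix (Fin 2) (Fin 2) ℂ) * hadamard = hadamard * gateX :=
  mul_hadamard (by ext i j; fin_cases i <;> fin_cases j <;> simp [gateZ, gateX])

theorem gateX_hadamard : (gateX : Matrix (Fin 2) (Fin 2) ℂ) * hadamard = hadamard * gateZ :=
  mul_hadamard (by ext i j; fin_cases i <;> fin_cases j <;> simp [gateZ, gateX])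

theorem gateF_hadamard : ((gateF * (gateX * gateZ) * gateF : Matrix (Fin 2) (Fin 2) ℂ)) *
    hadamard = hadamard * gateF := by
  refine mul_hadamard ?_
  rw [gateX_mul_gateZ]
  ext i j
  fin_cases i <;> fin_cases j <;>
    simp [gateF, Matrix.mul_apply, Fin.sum_univ_two] <;> ring_nf <;>
    simp only [I_sq, I_pow_three, I_pow_four] <;> ring

theorem icosa_hadamard (a : ℂ) :
    (icosa (1 - a) * (gateF * gateX) : Matrix (Fin 2) (Fin 2) ℂ) * hadamard =
      hadamard * icosa a := by
  refine mul_hadamard ?_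
  ext i j
  fin_cases i <;> fin_cases j <;>
    simp [icosa, gateF, gateX, Matrix.mul_apply, Fin.sum_univ_two] <;> ring_nf <;>
    simp only [I_sq, I_pow_three, I_pow_four] <;> ring

theorem exists_intertwines_codeTensor {g : U2} (hg : g ∈ binaryIcosahedral) :
    ∃ h ∈ binaryIcosahedral, Intertwines (rotate hadamard (codeTensor Real.goldenRatio))
      (h : Matrix (Fin 2) (Fin 2) ℂ) g := by
  have E := equivariant_codeTensor goldenRatio_sq'
  induction hg using Subgroup.closure_induction with
  | mem g hg =>
    simp only [Set.mem_insert_iff, Set.mem_singleton_iff] at hg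
    rcases hg with rfl | rfl | rfl | rfl
    · exact ⟨gateZ, gateZ_mem, E.z.rotate_of_mul_eq gateZ_hadamard⟩
    · exact ⟨gateX, gateX_mem, E.x.rotate_of_mul_eq gateX_hadamard⟩
    · exact ⟨gateF * (gateX * gateZ) * gateF,
        mul_mem (mul_mem gateF_mem (mul_mem gateX_mem gateZ_mem)) gateF_mem,
        ((E.f.mul (E.x.mul E.z)).mul E.f).rotate_of_mul_eq gateF_hadamard⟩
    · refine ⟨gatePhi * (gateF * gateX), mul_mem gatePhi_mem (mul_mem gateF_mem gateX_mem), ?_⟩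
      rw [coe_mul, coe_mul, coe_gatePhi]
      exact (E.p.mul (E.f.mul E.x)).rotate_of_mul_eq (icosa_hadamard _)
  | one => exact ⟨1, one_mem _, Intertwines.one _⟩
  | mul g k _ _ hg hk =>
    obtain ⟨h, hh, H⟩ := hg
    obtain ⟨l, hl, L⟩ := hk
    exact ⟨h * l, mul_mem hh hl, H.mul L⟩
  | inv g _ hg =>
    obtain ⟨h, hh, H⟩ := hg
    exact ⟨h⁻¹, inv_mem hh, H.inv (coe_inv_mul h) (coe_mul_inv g)⟩

/-! ### Identification with the span of the Dicke states. -/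

theorem coe_sqrt_sq {x : ℝ} (hx : 0 ≤ x) : ((√x : ℝ) : ℂ) ^ 2 = x := by
  rw [← ofReal_pow, Real.sq_sqrt hx]

/-- At the golden ratio 2a - 1 = √5. The basis order is reversed: on seven qubits the Z-eigenvalue
-i of the first column belongs to odd weights. -/
theorem logicalOne_eq : logicalOne = ((1 / (8 * √15) : ℝ) : ℂ) •
    (WithLp.toLp 2 (codeTensor Real.goldenRatio 0) : Qubits 7) := by
  have s15 : √15 = √3 * √5 := by rw [← Real.sqrt_mul (by norm_num)]; norm_num
  have s21 : √21 = √3 * √7 := by rw [← Real.sqrt_mul (by norm_num)]; norm_num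
  have s35 : √35 = √5 * √7 := by rw [← Real.sqrt_mul (by norm_num)]; norm_num
  have h3 := coe_sqrt_sq (x := 3) (by norm_num)
  have h5 := coe_sqrt_sq (x := 5) (by norm_num)
  have n3 : ((√3 : ℝ) : ℂ) ≠ 0 := by simp
  have n5 : ((√5 : ℝ) : ℂ) ≠ 0 := by simp
  have n7 : ((√7 : ℝ) : ℂ) ≠ 0 := by simp
  have c73 : Nat.choose 7 3 = 35 := rfl
  have c75 : Nat.choose 7 5 = 21 := rfl
  ext x
  have hw := hammingWeight_le x
  simp only [logicalOne, dicke, codeTensor, Matrix.cons_val_zero, PiLp.add_apply, PiLp.smul_apply,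
    smul_eq_mul]
  generalize hammingWeight x = w at *
  interval_cases w <;> simp [codeAmp, c73, c75, s15, s21, s35] <;> field_simp <;>
    simp [h3, h5] <;> norm_num

theorem logicalZero_eq : logicalZero = ((-1 / (8 * √15) : ℝ) : ℂ) •
    (WithLp.toLp 2 (codeTensor Real.goldenRatio 1) : Qubits 7) := by
  have s15 : √15 = √3 * √5 := by rw [← Real.sqrt_mul (by norm_num)]; norm_num
  have s21 : √21 = √3 * √7 := by rw [← Real.sqrt_mul (by norm_num)]; norm_num
  have s35 : √35 = √5 * √7 := by rw [← Real.sqrt_mul (by norm_num)]; norm_num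
  have h3 := coe_sqrt_sq (x := 3) (by norm_num)
  have h5 := coe_sqrt_sq (x := 5) (by norm_num)
  have n3 : ((√3 : ℝ) : ℂ) ≠ 0 := by simp
  have n5 : ((√5 : ℝ) : ℂ) ≠ 0 := by simp
  have n7 : ((√7 : ℝ) : ℂ) ≠ 0 := by simp
  have c72 : Nat.choose 7 2 = 21 := rfl
  have c74 : Nat.choose 7 4 = 35 := rfl
  ext x
  have hw := hammingWeight_le x
  simp only [logicalZero, dicke, codeTensor, Matrix.cons_val_one, Matrix.cons_val_zero, PiLp.sub_apply,
    PiLp.add_apply, PiLp.smul_apply, smul_eq_mul]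
  generalize hammingWeight x = w at *
  interval_cases w <;> simp [codeAmp, c72, c74, s15, s21, s35] <;> field_simp <;>
    simp [h3, h5] <;> norm_num

theorem dickeCode_eq : dickeCode = code (codeTensor Real.goldenRatio) := by
  have n : (8 * √15 : ℝ) ≠ 0 := by simp
  refine le_antisymm (Submodule.span_le.mpr ?_) (code_le fun j => ?_)
  · rintro _ (rfl | rfl)
    · rw [logicalZero_eq]
      exact Submodule.smul_mem _ _ (toLp_mem_code _ 1)
    · rw [logicalOne_eq]
      exact Submodule.smul_mem _ _ (toLp_mem_code _ 0)
  · fin_cases j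
    · refine (Submodule.smul_mem_iff _ (s := ((1 / (8 * √15) : ℝ) : ℂ)) ?_).mp ?_
      · exact_mod_cast div_ne_zero one_ne_zero n
      · rw [Fin.zero_eta, ← logicalOne_eq]
        exact Submodule.subset_span (by simp)
    · refine (Submodule.smul_mem_iff _ (s := ((-1 / (8 * √15) : ℝ) : ℂ)) ?_).mp ?_
      · exact_mod_cast div_ne_zero (neg_ne_zero.mpr one_ne_zero) n
      · rw [Fin.mk_one, ← logicalZero_eq]
        exact Submodule.subset_span (by simp)

/-! ### Knill-Laflamme conditions and the exact distance. -/

/-- The matrix element of a product operator between states whose amplitudes depend only on the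
Hamming weight. -/
noncomputable def element {n : ℕ} (A : Fin n → Matrix (Fin 2) (Fin 2) ℂ) (p q : ℕ → ℂ) : ℂ :=
  ∑ x, ∑ y, p (hammingWeight x) * (∏ i, A i (x i) (y i)) * q (hammingWeight y)

theorem element_perm {n : ℕ} (A : Fin n → Matrix (Fin 2) (Fin 2) ℂ) (p q : ℕ → ℂ)
    (σ : Equiv.Perm (Fin n)) : element (fun i => A (σ i)) p q = element A p q := by
  have e : ∀ x : Fin n → Fin 2, Equiv.arrowCongr σ.symm (Equiv.refl (Fin 2)) x = x ∘ σ :=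
    fun x => rfl
  symm
  refine Fintype.sum_equiv (Equiv.arrowCongr σ.symm (Equiv.refl _)) _ _ fun x =>
    Fintype.sum_equiv (Equiv.arrowCongr σ.symm (Equiv.refl _)) _ _ fun y => ?_
  rw [e, e, hammingWeight_comp, hammingWeight_comp]
  congr 2
  exact (Equiv.prod_comp σ fun i => A i (x i) (y i)).symm

theorem hammingWeight_cons {n : ℕ} (a : Fin 2) (x : Fin n → Fin 2) :
    hammingWeight (Fin.cons a x : Fin (n + 1) → Fin 2) = hammingWeight x + a := by
  simp only [hammingWeight, Finset.card_filter, Fin.sum_univ_succ, Fin.cons_zero, Fin.cons_succ]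
  fin_cases a <;> simp [add_comm]

/-- Summing out the first qubit shifts the weight argument of the remaining amplitudes by its bit.
-/
theorem element_cons {n : ℕ} (P : Matrix (Fin 2) (Fin 2) ℂ)
    (A : Fin n → Matrix (Fin 2) (Fin 2) ℂ) (p q : ℕ → ℂ) :
    element (Fin.cons P A : Fin (n + 1) → Matrix (Fin 2) (Fin 2) ℂ) p q =
      ∑ a, ∑ b, P a b * element A (fun w => p (w + a)) fun w => q (w + b) := by
  simp only [element, sum_cons, Fin.sum_univ_two, Fin.prod_univ_succ, Fin.cons_zero, Fin.cons_succ,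
    hammingWeight_cons, Finset.mul_sum, ← Finset.sum_add_distrib]
  exact Finset.sum_congr rfl fun x _ => Finset.sum_congr rfl fun y _ => by ring

theorem element_one {n : ℕ} (p q : ℕ → ℂ) :
    element (fun _ : Fin n => 1) p q = ∑ w ∈ Finset.range (n + 1), (n.choose w : ℂ) * (p w * q w) := by
  rw [← sum_hammingWeight fun w => p w * q w, element]
  refine Finset.sum_congr rfl fun x _ => ?_
  rw [Finset.sum_eq_single x]
  · simp
  · intro y _ hy
    rw [prod_one_apply, if_neg hy.symm]
    ring
  · simp

theorem inner_tensorOp_eq_element {n : ℕ} (A : Fin n → Matrix (Fin 2) (Fin 2) ℂ) {p q : ℕ → ℂ}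
    (hp : ∀ w, star (p w) = p w) : inner ℂ (WithLp.toLp 2 fun x => p (hammingWeight x) : Qubits n)
      (tensorOp A (WithLp.toLp 2 fun x => q (hammingWeight x))) = element A p q := by
  rw [tensorOp_apply, inner_toLp]
  refine Finset.sum_congr rfl fun x _ => ?_
  rw [act_apply, hp, Finset.mul_sum]
  exact Finset.sum_congr rfl fun y _ => (mul_assoc _ _ _).symm

/-- The amplitudes of both basis states of the seven-qubit code. -/
def codeAmps (a : ℂ) : Fin 2 → ℕ → ℂ := ![codeAmp a, fun w => -codeAmp a (7 - w)]

theorem codeTensor_eq (a : ℂ) (j : Fin 2) :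
    codeTensor a j = fun x => codeAmps a j (hammingWeight x) := by
  fin_cases j <;> rfl

/-- The Knill-Laflamme sums of the seven-qubit code. -/
def codeSum (a : ℂ) (k l : ℕ) : ℂ :=
  ∑ w ∈ Finset.range 6, (Nat.choose 5 w : ℂ) * (codeAmp a (w + k) * codeAmp a (w + l))

/-- These are the Knill-Laflamme conditions for two-qubit errors: five qubits are untouched, and the
bits of the other two shift the weights by k and l. -/
theorem sum_codeAmps {a : ℂ} (ha : a ^ 2 = a + 1) (i j : Fin 2) {k l : ℕ} (hk : k ≤ 2)
    (hl : l ≤ 2) :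
    ∑ w ∈ Finset.range 6, (Nat.choose 5 w : ℂ) * (codeAmps a i (w + k) * codeAmps a j (w + l)) =
      if i = j then codeSum a k l else 0 := by
  have c52 : Nat.choose 5 2 = 10 := rfl
  have c53 : Nat.choose 5 3 = 10 := rfl
  fin_cases i <;> fin_cases j <;> interval_cases k <;> interval_cases l <;>
    simp [codeSum, codeAmps, codeAmp, Finset.sum_range_succ, c52, c53] <;> grind

theorem sum_codeAmps_sq {a : ℂ} (ha : a ^ 2 = a + 1) (i j : Fin 2) :
    ∑ w ∈ Finset.range 8, (Nat.choose 7 w : ℂ) * (codeAmps a i w * codeAmps a j w) =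
      if i = j then 960 else 0 := by
  have c72 : Nat.choose 7 2 = 21 := rfl
  have c73 : Nat.choose 7 3 = 35 := rfl
  have c74 : Nat.choose 7 4 = 35 := rfl
  have c75 : Nat.choose 7 5 = 21 := rfl
  fin_cases i <;> fin_cases j <;>
    simp [codeAmps, codeAmp, Finset.sum_range_succ, c72, c73, c74, c75] <;> grind

theorem distanceAtLeast_code {n d : ℕ} {V : Fin 2 → Tensor n}
    (h : ∀ A : Fin n → Matrix (Fin 2) (Fin 2) ℂ, {i | A i ≠ 1}.ncard < d → ∃ c : ℂ, ∀ i j,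
      inner ℂ (WithLp.toLp 2 (V i) : Qubits n) (tensorOp A (WithLp.toLp 2 (V j))) =
        c * inner ℂ (WithLp.toLp 2 (V i) : Qubits n) (WithLp.toLp 2 (V j))) :
    DistanceAtLeast (code V) d := by
  intro A hA
  obtain ⟨c, hc⟩ := h A hA
  refine ⟨c, fun u hu v hv => ?_⟩
  obtain ⟨a, rfl⟩ := (Submodule.mem_span_range_iff_exists_fun ℂ).mp hu
  obtain ⟨b, rfl⟩ := (Submodule.mem_span_range_iff_exists_fun ℂ).mp hv
  simp only [map_add, map_smul, Fin.sum_univ_two, inner_add_left, inner_add_right,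
    inner_smul_left, inner_smul_right, hc]
  ring

theorem star_codeAmps {a : ℝ} (i : Fin 2) (w : ℕ) : star (codeAmps a i w) = codeAmps a i w := by
  have h : ∀ w, star (codeAmp a w) = codeAmp a w := fun w => by
    unfold codeAmp
    split <;> simp
  fin_cases i
  · exact h w
  · simpa [codeAmps] using h (7 - w)

theorem inner_codeTensor {a : ℝ} (A : Fin 7 → Matrix (Fin 2) (Fin 2) ℂ) (i j : Fin 2) :
    inner ℂ (WithLp.toLp 2 (codeTensor a i) : Qubits 7)
      (tensorOp A (WithLp.toLp 2 (codeTensor a j))) = element A (codeAmps a i) (codeAmps a j) := by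
  rw [codeTensor_eq, codeTensor_eq, inner_tensorOp_eq_element A (star_codeAmps i)]

theorem inner_codeTensor_codeTensor {a : ℝ} (ha : a ^ 2 = a + 1) (i j : Fin 2) :
    inner ℂ (WithLp.toLp 2 (codeTensor a i) : Qubits 7) (WithLp.toLp 2 (codeTensor a j)) =
      if i = j then 960 else 0 := by
  have h := inner_codeTensor (a := a) (fun _ => 1) i j
  rw [element_one, sum_codeAmps_sq (by exact_mod_cast ha), tensorOp_apply, act_one] at h
  exact h

theorem element_codeAmps {a : ℂ} (ha : a ^ 2 = a + 1) {A : Fin 7 → Matrix (Fin 2) (Fin 2) ℂ}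
    {k l : Fin 7} (hkl : k ≠ l) (hA : ∀ m, m ≠ k → m ≠ l → A m = 1) :
    ∃ c, ∀ i j, element A (codeAmps a i) (codeAmps a j) = if i = j then c else 0 := by
  -- The amplitudes are symmetric, so the error can be moved to the first two qubits.
  obtain ⟨σ, h0, h1⟩ : ∃ σ : Equiv.Perm (Fin 7), σ 0 = k ∧ σ 1 = l := by
    have h2 : Equiv.swap 0 k l ≠ 0 := fun h => hkl
      ((Equiv.swap 0 k).injective (by rw [h, Equiv.swap_apply_right]))
    refine ⟨(Equiv.swap 1 (Equiv.swap 0 k l)).trans (Equiv.swap 0 k), ?_, ?_⟩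
    · rw [Equiv.trans_apply, Equiv.swap_apply_of_ne_of_ne (by decide) h2.symm,
        Equiv.swap_apply_left]
    · simp
  have e : (fun m => A (σ m)) = Fin.cons (A k) (Fin.cons (A l) fun _ : Fin 5 => 1) := by
    funext m
    refine Fin.cases ?_ (fun m => Fin.cases ?_ (fun m => ?_) m) m
    · rw [h0]; rfl
    · rw [← h1]; rfl
    · refine hA _ (fun h => ?_) fun h => ?_
      · exact Fin.succ_ne_zero _ (σ.injective (h.trans h0.symm))
      · exact Fin.succ_ne_zero m (Fin.succ_injective _ (σ.injective (h.trans h1.symm)))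
  refine ⟨∑ b : Fin 2, ∑ c : Fin 2, A k b c * ∑ b' : Fin 2, ∑ c' : Fin 2, A l b' c' *
    codeSum a (b' + b) (c' + c), fun i j => ?_⟩
  rw [← element_perm A _ _ σ, e]
  simp only [element_cons, element_one, add_assoc]
  have key : ∀ b c b' c' : Fin 2, _ := fun b c b' c' =>
    sum_codeAmps ha i j (k := (b' : ℕ) + b) (l := (c' : ℕ) + c) (by omega) (by omega)
  simp only [key]
  split_ifs <;> simp

theorem distanceAtLeast_three {a : ℝ} (ha : a ^ 2 = a + 1) :
    DistanceAtLeast (code (codeTensor a)) 3 := by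
  refine distanceAtLeast_code fun A hA => ?_
  -- The support is padded to exactly two qubits to avoid separate cases for smaller errors.
  obtain ⟨t, ht, hc⟩ := Finset.exists_superset_card_eq (s := {i | A i ≠ 1}) (n := 2)
    (by rw [Set.ncard_eq_toFinset_card'] at hA; simpa [Nat.lt_succ_iff] using hA) (by simp)
  obtain ⟨k, l, hkl, rfl⟩ := Finset.card_eq_two.mp hc
  obtain ⟨c, hc⟩ := element_codeAmps (a := a) (by exact_mod_cast ha) hkl (A := A)
    fun m hk hl => by
      by_contra h
      have := ht (by simpa using h : m ∈ _)
      simp [hk, hl] at this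
  refine ⟨c / 960, fun i j => ?_⟩
  rw [inner_codeTensor, inner_codeTensor_codeTensor ha, hc]
  split_ifs <;> norm_num

theorem not_distanceAtLeast_four {a : ℝ} (ha : a ^ 2 = a + 1) :
    ¬ DistanceAtLeast (code (codeTensor a)) 4 := by
  intro h
  have ha' : (a : ℂ) ^ 2 = a + 1 := by exact_mod_cast ha
  -- The three-qubit error ZZZ changes sign under the global bit flip that exchanges the basis
  -- states up to sign. Its expectations there are opposite and nonzero, so no common constant
  -- exists.
  let D : Matrix (Fin 2) (Fin 2) ℂ := Matrix.diagonal ![1, -1]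
  let A : Fin 7 → Matrix (Fin 2) (Fin 2) ℂ :=
    Fin.cons D (Fin.cons D (Fin.cons D fun _ : Fin 4 => 1))
  obtain ⟨c, hc⟩ := h A (by
    refine lt_of_le_of_lt (Set.ncard_le_ncard (t := ((Finset.univ.filter fun i : Fin 7 => i < 3) :
      Set (Fin 7))) (fun m hm => ?_)) (by rw [Set.ncard_coe_finset]; decide)
    by_contra h
    simp at h
    refine hm ?_
    fin_cases m <;> first | rfl | simp at h)
  have key : ∀ i, element A (codeAmps a i) (codeAmps a i) = c * 960 := fun i => by
    have := hc _ (toLp_mem_code _ i) _ (toLp_mem_code _ i)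
    rwa [inner_codeTensor, inner_codeTensor_codeTensor ha, if_pos rfl] at this
  have h0 := key 0
  have h1 := key 1
  have c42 : Nat.choose 4 2 = 6 := rfl
  simp only [A, element_cons, element_one, Finset.sum_range_succ, Finset.range_zero,
    Finset.sum_empty, Fin.sum_univ_two] at h0 h1
  simp [D, codeAmps, codeAmp, c42] at h0 h1
  grind

/-! ### The Dicke code: parameters, transversality, uniqueness up to frame. -/

/-- The normalized seven-qubit code in the frame in which the logical gates are standard. -/
noncomputable def codeFrame : Fin 2 → Tensor 7 :=
  rotate hadamard (((√960 : ℝ)⁻¹ : ℂ) • codeTensor Real.goldenRatio)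

theorem orthonormal_codeFrame :
    Orthonormal ℂ fun j => (WithLp.toLp 2 (codeFrame j) : Qubits 7) := by
  refine orthonormal_rotate ?_ _
  have h : ((√960 : ℝ) : ℂ)⁻¹ * (((√960 : ℝ) : ℂ)⁻¹ * 960) = 1 := by
    rw [← mul_assoc, ← mul_inv, ← ofReal_mul, Real.mul_self_sqrt (by norm_num)]
    norm_num
  rw [orthonormal_iff_ite]
  intro i j
  simp only [Pi.smul_apply, WithLp.toLp_smul, inner_smul_left, inner_smul_right,
    inner_codeTensor_codeTensor Real.goldenRatio_sq, map_inv₀, conj_ofReal]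
  split_ifs
  · exact h
  · simp

theorem code_codeFrame : code codeFrame = dickeCode := by
  rw [codeFrame, code_rotate, code_smul (by simp), dickeCode_eq]

theorem rotate_smul {n : ℕ} (u : Matrix (Fin 2) (Fin 2) ℂ) (c : ℂ) (V : Fin 2 → Tensor n) :
    rotate u (c • V) = c • rotate u V := by
  funext j
  simp only [rotate, Pi.smul_apply, Fin.sum_univ_two, smul_add, smul_comm c]

theorem Intertwines.const_smul {n : ℕ} {V : Fin 2 → Tensor n} {h g : Matrix (Fin 2) (Fin 2) ℂ}
    (H : Intertwines V h g) (c : ℂ) : Intertwines (c • V) h g := fun j => by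
  simp only [Pi.smul_apply, map_smul, H j, Finset.smul_sum, smul_comm c]

theorem stronglyTransversalVia_dickeCode :
    StronglyTransversalVia binaryIcosahedral binaryIcosahedral dickeCode := by
  rw [← code_codeFrame]
  refine stronglyTransversalVia_code orthonormal_codeFrame fun g hg => ?_
  obtain ⟨h, hh, H⟩ := exists_intertwines_codeTensor hg
  refine ⟨h, hh, ?_⟩
  rw [codeFrame, rotate_smul]
  exact H.const_smul _

theorem StronglyTransversalVia.mono {n : ℕ} {H K G : Subgroup U2} {C : Submodule ℂ (Qubits n)}
    (h : H ≤ K) (hC : StronglyTransversalVia H G C) : StronglyTransversalVia K G C := by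
  obtain ⟨V, hV, hG⟩ := hC
  exact ⟨V, hV, fun g hg => (hG g hg).imp fun _ hk => ⟨h hk.1, hk.2⟩⟩

theorem isCode_dickeCode : IsCode dickeCode 2 3 := by
  refine ⟨?_, ?_, ?_⟩
  · rw [← code_codeFrame, code, finrank_span_eq_card orthonormal_codeFrame.linearIndependent,
      Fintype.card_fin]
  · rw [dickeCode_eq]
    exact distanceAtLeast_three Real.goldenRatio_sq
  · rw [dickeCode_eq]
    exact not_distanceAtLeast_four Real.goldenRatio_sq

theorem tensorPow_mul {n : ℕ} (g h : U2) :
    tensorPow n (g * h) = tensorPow n g ∘ₗ tensorPow n h :=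
  LinearMap.ext fun v => tensorOp_mul _ _ v

theorem eq_map_dickeCode {C : Submodule ℂ (Qubits 7)} (hd : DistanceAtLeast C 2)
    (hC : StronglyTransversal binaryIcosahedral C) :
    ∃ u : U2, C = dickeCode.map (tensorPow 7 u) := by
  obtain ⟨u, hu⟩ := eq_map_code hd hC
  obtain ⟨v, hv⟩ := eq_map_code (isCode_dickeCode.2.1.mono (by norm_num))
    (stronglyTransversalVia_dickeCode.mono le_top)
  refine ⟨u * v⁻¹, ?_⟩
  rw [hu, hv, ← Submodule.map_comp, ← tensorPow_mul, inv_mul_cancel_right]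

/-! ### Finiteness of the projective icosahedral group and uniqueness on the nose. -/

/-- The six diagonals of an icosahedron, as traceless matrices. -/
def diagonal (a : ℂ) : Fin 6 → Matrix (Fin 2) (Fin 2) ℂ :=
  ![!![-I, a; -a, I], !![I, a; -a, -I], !![-I * a, -I; -I, I * a], !![-I * a, I; I, I * a],
    !![0, -I * a + 1; -I * a - 1, 0], !![0, -I * a - 1; -I * a + 1, 0]]

/-- The twelve vertices of an icosahedron, as traceless matrices. -/
def vertices (a : ℂ) : Set (Matrix (Fin 2) (Fin 2) ℂ) :=
  Set.range (diagonal a) ∪ Set.range fun k => -diagonal a k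

theorem finite_vertices (a : ℂ) : (vertices a).Finite :=
  (Set.finite_range _).union (Set.finite_range _)

/-- π and s describe the signed permutation of the six diagonals induced by g; multiplying through
by g avoids computing its inverse. -/
theorem conj_mem_vertices {a : ℂ} {g : U2} (π : Fin 6 → Fin 6) (s : Fin 6 → ℤˣ)
    (h : ∀ k, (g : Matrix (Fin 2) (Fin 2) ℂ) * diagonal a k =
      ((s k : ℤ) : ℂ) • (diagonal a (π k) * (g : Matrix (Fin 2) (Fin 2) ℂ))) :
    ∀ M ∈ vertices a, (g : Matrix (Fin 2) (Fin 2) ℂ) * M * (g⁻¹ : U2) ∈ vertices a := by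
  have key : ∀ k, (g : Matrix (Fin 2) (Fin 2) ℂ) * diagonal a k * (g⁻¹ : U2) =
      ((s k : ℤ) : ℂ) • diagonal a (π k) := fun k => by
    rw [h, smul_mul_assoc, mul_assoc, coe_mul_inv, mul_one]
  rintro _ (⟨k, rfl⟩ | ⟨k, rfl⟩)
  · rw [key]
    rcases Int.units_eq_one_or (s k) with hs | hs
    · exact Or.inl ⟨π k, by simp [hs]⟩
    · exact Or.inr ⟨π k, by simp [hs]⟩
  · simp only [mul_neg, neg_mul, key]
    rcases Int.units_eq_one_or (s k) with hs | hs
    · exact Or.inr ⟨π k, by simp [hs]⟩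
    · exact Or.inl ⟨π k, by simp [hs]⟩

theorem binaryIcosahedral_conj_mem_vertices {g : U2} (hg : g ∈ binaryIcosahedral) :
    ∀ M ∈ vertices Real.goldenRatio,
      (g : Matrix (Fin 2) (Fin 2) ℂ) * M * (g⁻¹ : U2) ∈ vertices Real.goldenRatio := by
  induction hg using Subgroup.closure_induction with
  | mem g hg =>
    simp only [Set.mem_insert_iff, Set.mem_singleton_iff] at hg
    rcases hg with rfl | rfl | rfl | rfl
    · refine conj_mem_vertices ![0, 1, 3, 2, 5, 4] ![-1, -1, -1, -1, 1, 1] fun k => ?_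
      generalize (Real.goldenRatio : ℂ) = a
      fin_cases k <;> ext i j <;> fin_cases i <;> fin_cases j <;>
        simp [diagonal, gateX, Matrix.mul_apply, Fin.sum_univ_two] <;> ring
    · refine conj_mem_vertices ![1, 0, 3, 2, 4, 5] ![-1, -1, 1, 1, -1, -1] fun k => ?_
      generalize (Real.goldenRatio : ℂ) = a
      fin_cases k <;> ext i j <;> fin_cases i <;> fin_cases j <;>
        simp [diagonal, gateZ, Matrix.mul_apply, Fin.sum_univ_two] <;> ring
    · refine conj_mem_vertices ![3, 2, 5, 4, 0, 1] ![-1, -1, 1, 1, -1, -1] fun k => ?_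
      generalize (Real.goldenRatio : ℂ) = a
      fin_cases k <;> ext i j <;> fin_cases i <;> fin_cases j <;>
        simp [diagonal, gateF, Matrix.mul_apply, Fin.sum_univ_two] <;> ring_nf <;>
        simp only [I_sq, I_pow_three] <;> ring
    · refine conj_mem_vertices ![5, 1, 3, 4, 0, 2] ![-1, 1, 1, -1, 1, 1] fun k => ?_
      have ha := goldenRatio_sq'
      rw [coe_gatePhi]
      generalize (Real.goldenRatio : ℂ) = a at *
      fin_cases k <;> ext i j <;> fin_cases i <;> fin_cases j <;>
        simp [diagonal, icosa, Matrix.mul_apply, Fin.sum_univ_two] <;> ring_nf <;>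
        simp only [I_sq, ha] <;> ring
  | one => simp
  | mul g k _ _ hg hk =>
    intro M hM
    have := hg _ (hk M hM)
    simpa only [_root_.mul_inv_rev, coe_mul, mul_assoc] using this
  | inv g _ hg =>
    have hfin := (finite_vertices Real.goldenRatio).to_subtype
    -- Conjugation by g is injective on a finite set, hence surjective, so the inverse preserves the
    -- vertices too.
    let f : vertices Real.goldenRatio → vertices Real.goldenRatio := fun M => ⟨_, hg M M.2⟩
    have back : ∀ M : Matrix (Fin 2) (Fin 2) ℂ,
        (g⁻¹ : U2).1 * (g.1 * M * (g⁻¹ : U2).1) * g.1 = M := fun M => by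
      simp only [← mul_assoc, coe_inv_mul, one_mul]
      rw [mul_assoc, coe_inv_mul, mul_one]
    have hf : Function.Injective f := fun M N h => Subtype.ext (by
      rw [← back M, ← back N]
      exact congrArg (fun A => (g⁻¹ : U2).1 * A * g.1) (congrArg Subtype.val h))
    intro M hM
    obtain ⟨N, hN⟩ := Finite.surjective_of_injective hf ⟨M, hM⟩
    have hN : g.1 * N.1 * (g⁻¹ : U2).1 = M := congrArg Subtype.val hN
    rw [inv_inv, ← hN, back]
    exact N.2

/-- h⁻¹g commutes with the first two diagonals, which do not commute with each other when a ≠ 0, so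
it is scalar. -/
theorem proj_eq_of_conj_diagonal {a : ℂ} (ha : a ≠ 0) {g h : U2}
    (H : ∀ k, (g : Matrix (Fin 2) (Fin 2) ℂ) * diagonal a k * (g⁻¹ : U2) =
      (h : Matrix (Fin 2) (Fin 2) ℂ) * diagonal a k * (h⁻¹ : U2)) : proj g = proj h := by
  have hc : ∀ k, ((h⁻¹ * g : U2) : Matrix (Fin 2) (Fin 2) ℂ) * diagonal a k =
      diagonal a k * ((h⁻¹ * g : U2) : Matrix (Fin 2) (Fin 2) ℂ) := fun k => by
    have := congrArg (fun A => (h⁻¹ : U2).1 * A * g.1) (H k)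
    simp only [mul_assoc, coe_inv_mul, mul_one] at this
    rw [← mul_assoc (h⁻¹ : U2).1 h.1, coe_inv_mul, one_mul] at this
    rw [coe_mul, mul_assoc, this]
  by_contra hne
  have hk : ¬ ∃ c : ℂ, ((h⁻¹ * g : U2) : Matrix (Fin 2) (Fin 2) ℂ) = c • 1 := fun hs =>
    hne (by
      have := proj_eq_one_iff.mpr (mem_center_iff.mpr hs)
      rw [map_mul, map_inv, inv_mul_eq_one] at this
      exact this.symm)
  have hcomm := comm_of_comm hk (hc 0) (hc 1)
  have := congrFun (congrFun hcomm 0) 1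
  simp [diagonal, Matrix.mul_apply, Fin.sum_univ_two] at this
  have h2 : (8 * I) * a = 0 := by linear_combination -2 * this
  exact ha ((mul_eq_zero.mp h2).resolve_left (by simp))

theorem finite_map_proj : Finite (binaryIcosahedral.map proj) := by
  have hfin := (finite_vertices Real.goldenRatio).to_subtype
  have hrep : ∀ q : binaryIcosahedral.map proj, ∃ g ∈ binaryIcosahedral, proj g = q := fun q => q.2
  choose r hr hrq using hrep
  have hd : ∀ k, diagonal Real.goldenRatio k ∈ vertices Real.goldenRatio := fun k => Or.inl ⟨k, rfl⟩
  let f : binaryIcosahedral.map proj → Fin 6 → vertices Real.goldenRatio := fun q k =>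
    ⟨_, binaryIcosahedral_conj_mem_vertices (hr q) _ (hd k)⟩
  refine Finite.of_injective f fun p q h => Subtype.ext ?_
  rw [← hrq p, ← hrq q]
  exact proj_eq_of_conj_diagonal (by exact_mod_cast Real.goldenRatio_ne_zero) fun k =>
    congrArg Subtype.val (congrFun h k)

/-- If the physical gates lie in `2I`, then every element of `2I` is a physical gate. -/
theorem exists_mem_gatePairs {n : ℕ} {V : Fin 2 → Tensor n}
    (hT : ∀ h g, (h, g) ∈ gatePairs V → (h ∈ Subgroup.center U2 ↔ g ∈ Subgroup.center U2))
    (hG : ∀ g ∈ binaryIcosahedral, ∃ h ∈ binaryIcosahedral,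
      Intertwines V (h : Matrix (Fin 2) (Fin 2) ℂ) g) {h : U2} (hh : h ∈ binaryIcosahedral) :
    ∃ g, (h, g) ∈ gatePairs V := by
  have hfin := finite_map_proj
  have hrep : ∀ q : binaryIcosahedral.map proj, ∃ g ∈ binaryIcosahedral, proj g = q := fun q => q.2
  choose r hr hrq using hrep
  choose s hs hI using fun q => hG (r q) (hr q)
  -- Sends a logical class to the class of a chosen physical gate. It is injective because a scalar
  -- physical gate has a scalar logical gate, hence surjective by finiteness.
  let f : binaryIcosahedral.map proj → binaryIcosahedral.map proj := fun q =>
    ⟨proj (s q), Subgroup.mem_map_of_mem _ (hs q)⟩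
  have hf : Function.Injective f := fun p q e => by
    have e : proj (s p) = proj (s q) := congrArg Subtype.val e
    have h1 := mul_mem (hI p).mem_gatePairs (inv_mem (hI q).mem_gatePairs)
    have h2 := (hT _ _ h1).mp (proj_eq_one_iff.mp (by
      change proj (s p * (s q)⁻¹) = 1
      rw [map_mul, map_inv, e, mul_inv_cancel]))
    have h3 : proj (r p * (r q)⁻¹) = 1 := proj_eq_one_iff.mpr h2
    rw [map_mul, map_inv, mul_inv_eq_one, hrq, hrq] at h3
    exact Subtype.ext h3
  obtain ⟨q, hq⟩ := Finite.surjective_of_injective hf ⟨proj h, Subgroup.mem_map_of_mem _ hh⟩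
  have hq : proj (s q) = proj h := congrArg Subtype.val hq
  exact ⟨r q, intertwines_of_proj_eq (hI q) hq⟩

theorem eq_dickeCode {C : Submodule ℂ (Qubits 7)} (hd : DistanceAtLeast C 2)
    (hC : StronglyTransversalVia binaryIcosahedral binaryIcosahedral C) : C = dickeCode := by
  obtain ⟨V, hV, rfl, hG⟩ := hC.exists_indep
  have hG' : ∀ g ∈ binaryIcosahedral, ∃ h : U2, Intertwines V (h : Matrix (Fin 2) (Fin 2) ℂ) g :=
    fun g hg => (hG g hg).imp fun _ h => h.2
  obtain ⟨x, hx⟩ := hG' _ gateX_mem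
  obtain ⟨z, hz⟩ := hG' _ gateZ_mem
  obtain ⟨f, hf⟩ := hG' _ gateF_mem
  obtain ⟨p, hp⟩ := hG' _ gatePhi_mem
  have hT := fun h g hg => center_iff_of_gatePairs (h := h) (g := g) (n := 7) (by norm_num)
    (fun h0 => hV.ne_zero 0 (congrFun h0 0)) hx.mem_gatePairs hz.mem_gatePairs hf.mem_gatePairs
    hp.mem_gatePairs hg
  obtain ⟨x', hx'⟩ := exists_mem_gatePairs hT hG gateX_mem
  obtain ⟨z', hz'⟩ := exists_mem_gatePairs hT hG gateZ_mem
  obtain ⟨f', hf'⟩ := exists_mem_gatePairs hT hG gateF_mem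
  obtain ⟨p', hp'⟩ := exists_mem_gatePairs hT hG gatePhi_mem
  obtain ⟨u, b, hb, ho, hE⟩ := exists_equivariant_rotate (by norm_num) hV hG' hx' hz' hf' hp'
  have hW := hV.rotate u
  -- Only the logical frame was rotated, so the code itself is the span of an equivariant pair.
  rw [← code_rotate u] at hd ⊢
  rcases hb with rfl | rfl
  · exact absurd hd (not_distanceAtLeast_two hW
      (Equivariant.weightOp_eq goldenRatio_sq' ho le_rfl _ hE))
  · obtain ⟨c, hc⟩ := hE.seven_of_ne goldenRatio_sq' one_sub_goldenRatio_sq goldenRatio_ne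
    have hc0 : c ≠ 0 := by
      rintro rfl
      refine hW.ne_zero 0 ((congrFun hc 0).trans ?_)
      rw [zero_smul]
      rfl
    rw [hc, code_smul hc0, dickeCode_eq]

end QubitCode

theorem mainTheorem2 :
    -- the explicit code is a `((7, 2, 3))` code on which `2I` is strongly transversal; the
    -- physical gates may be taken to be `h ^ {⊗ 7}` with `h ∈ 2I`
    (QubitCode.IsCode QubitCode.dickeCode 2 3 ∧
      QubitCode.StronglyTransversal QubitCode.binaryIcosahedral QubitCode.dickeCode ∧
      QubitCode.StronglyTransversalVia QubitCode.binaryIcosahedral QubitCode.binaryIcosahedral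
        QubitCode.dickeCode) ∧
    -- no nontrivial code on fewer qubits has this property
    (∀ (n : ℕ) (C : Submodule ℂ (QubitCode.Qubits n)),
      Module.finrank ℂ C = 2 → QubitCode.DistanceAtLeast C 2 →
      QubitCode.StronglyTransversal QubitCode.binaryIcosahedral C → 7 ≤ n) ∧
    -- uniqueness on seven qubits, up to the local change of frame `u ^ {⊗ 7}`
    (∀ C : Submodule ℂ (QubitCode.Qubits 7),
      Module.finrank ℂ C = 2 → QubitCode.DistanceAtLeast C 2 →
      QubitCode.StronglyTransversal QubitCode.binaryIcosahedral C →
      ∃ u : QubitCode.U2, C = QubitCode.dickeCode.map (QubitCode.tensorPow 7 u)) ∧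
    -- uniqueness on the nose when the physical gates are `h ^ {⊗ 7}` with `h ∈ 2I`
    (∀ C : Submodule ℂ (QubitCode.Qubits 7),
      Module.finrank ℂ C = 2 → QubitCode.DistanceAtLeast C 2 →
      QubitCode.StronglyTransversalVia QubitCode.binaryIcosahedral QubitCode.binaryIcosahedral C →
      C = QubitCode.dickeCode) := by
  refine ⟨⟨QubitCode.isCode_dickeCode, ?_, QubitCode.stronglyTransversalVia_dickeCode⟩, ?_, ?_, ?_⟩
  · exact QubitCode.stronglyTransversalVia_dickeCode.mono le_top
  · exact fun n C _ hd hC => QubitCode.seven_le hd hC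
  · exact fun C _ hd hC => QubitCode.eq_map_dickeCode hd hC
  · exact fun C _ hd hC => QubitCode.eq_dickeCode hd hC
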